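/- Work over $\mathbb{C}$. Let $\sigma\in\mathbb{C}[X_0,X_1]$ be a non-zero homogeneous form of degree $6$, regarded as a global section of $\mathcal{O}_{\mathbb{P}^1}(6)$, with $6$ distinct zeros in $\mathbb{P}^1$. For $n\ge 0$ let $\mathbb{P}_n=\mathbb{P}(\mathcal{O}_{\mathbb{P}^1}\oplus\mathcal{O}_{\mathbb{P}^1}(n))$ be the rational ruled surface over $\mathbb{P}^1$; over the chart $X_0\neq 0$ with coordinate $x=X_1/X_0$ it has homogeneous fibre coordinates $(y_1:y_2)$, and $u=y_2/y_1$ transforms like a section of $\mathcal{O}(n)$. On $\mathbb{P}_6$ let $E_0=\{u=0\}$ and $E_\sigma=\{u=\sigma(1,x)\}$ be the sections defined by $0$ and $\sigma$. Let $\mu:\mathbb{P}_1\to\mathbb{P}_6$ be the degree $6$ covering over $\mathbb{P}^1$ given in these coordinates by $(y_1:y_2)\mapsto(y_1^6:y_2^6)$. Let $\mathcal{Y}\to\mathbb{P}_1$ be the Kummer covering of degree $2$ given by the square root of a rational function with divisor $\mu^*E_\sigma-\mu^*E_0$, that is, the normalization of $\mathbb{P}_1$ in $\mathbb{C}(x,u)\bigl(\sqrt{(u^6-\sigma(1,x))/u^6}\bigr)$.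 Let $C$ be the smooth projective curve $y^6=\sigma(X_0,X_1)$, a cyclic covering of $\mathbb{P}^1$ of degree $6$ branched exactly over the six zeros of $\sigma$, and let $C'$ be the smooth projective curve with affine equation $y^6=x(x-1)$. Fix a primitive sixth root of unity $\xi$, let $\gamma$ and $\gamma'$ be the automorphisms $(x,y)\mapsto(x,\xi y)$ of $C$ and of $C'$, and let $C\times C'/\langle(1,1)\rangle$ denote the quotient of $C\times C'$ by the group generated by $(\gamma,\gamma')$. Then $\mathcal{Y}$ is birationally equivalent over $\mathbb{C}$ to $C\times C'/\langle(1,1)\rangle$. Moreover, $\mathcal{Y}$ is birationally equivalent over $\mathbb{C}$ to the double covering of $\mathbb{P}^2$ branched along the sextic curve $C=\{Y^6=\sigma(X_0,X_1)\}\subset\mathbb{P}^2$. -/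

import Mathlib

open CategoryTheory CategoryTheory.Limits AlgebraicGeometry

noncomputable section

namespace KummerSurface

/-! ### Gluing affine charts inside a common function field -/

section Loc

variable {K : Type} [Field K] [Algebra ℂ K]

/-- `B = A[1/f]` inside `K`, for `A ≤ B ⊆ K` and `0 ≠ f ∈ A`. -/
structure IsLocAt (f : K) (A B : Subalgebra ℂ K) : Prop where
  le : A ≤ B
  mem : f ∈ A
  ne_zero : f ≠ 0
  inv_mem : f⁻¹ ∈ B
  exists_pow : ∀ b ∈ B, ∃ n : ℕ, f ^ n * b ∈ A

/-- The elements of `K` that become elements of `A` after multiplication by a power of `f`. -/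
def denomAlg {f : K} {A : Subalgebra ℂ K} (hf : f ∈ A) : Subalgebra ℂ K where
  carrier := {b | ∃ n : ℕ, f ^ n * b ∈ A}
  mul_mem' := by
    rintro a b ⟨m, hm⟩ ⟨n, hn⟩
    refine ⟨m + n, ?_⟩
    have := A.mul_mem hm hn
    rwa [show f ^ (m + n) * (a * b) = f ^ m * a * (f ^ n * b) by ring]
  add_mem' := by
    rintro a b ⟨m, hm⟩ ⟨n, hn⟩
    refine ⟨m + n, ?_⟩
    have h1 := A.mul_mem (A.pow_mem hf n) hm
    have h2 := A.mul_mem (A.pow_mem hf m) hn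
    have := A.add_mem h1 h2
    rwa [show f ^ (m + n) * (a + b) = f ^ n * (f ^ m * a) + f ^ m * (f ^ n * b) by ring]
  algebraMap_mem' := fun r => ⟨0, by simp [A.algebraMap_mem r]⟩

lemma IsLocAt.refl (A : Subalgebra ℂ K) : IsLocAt 1 A A :=
  ⟨le_rfl, A.one_mem, one_ne_zero, by simp [A.one_mem], fun b hb => ⟨0, by simpa using hb⟩⟩

lemma IsLocAt.sup_right {f : K} {A B : Subalgebra ℂ K} (h : IsLocAt f A B)
    (D : Subalgebra ℂ K) : IsLocAt f (A ⊔ D) (B ⊔ D) := by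
  have hf : f ∈ A ⊔ D := (le_sup_left : A ≤ A ⊔ D) h.mem
  refine ⟨sup_le_sup_right h.le D, hf, h.ne_zero, (le_sup_left : B ≤ B ⊔ D) h.inv_mem, ?_⟩
  have : B ⊔ D ≤ denomAlg hf := by
    refine sup_le (fun b hb => ?_) (fun d hd => ⟨0, ?_⟩)
    · obtain ⟨n, hn⟩ := h.exists_pow b hb
      exact ⟨n, (le_sup_left : A ≤ A ⊔ D) hn⟩
    · simpa using (le_sup_right : D ≤ A ⊔ D) hd
  exact fun b hb => this hb

lemma IsLocAt.sup {f g : K} {A B C : Subalgebra ℂ K} (h : IsLocAt f A B) (h' : IsLocAt g A C) :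
    IsLocAt (f * g) A (B ⊔ C) := by
  have hfg : f * g ∈ A := A.mul_mem h.mem h'.mem
  refine ⟨h.le.trans le_sup_left, hfg, mul_ne_zero h.ne_zero h'.ne_zero, ?_, ?_⟩
  · rw [mul_inv]
    exact (B ⊔ C).mul_mem ((le_sup_left : B ≤ B ⊔ C) h.inv_mem)
      ((le_sup_right : C ≤ B ⊔ C) h'.inv_mem)
  · have : B ⊔ C ≤ denomAlg hfg := by
      refine sup_le (fun b hb => ?_) (fun c hc => ?_)
      · obtain ⟨n, hn⟩ := h.exists_pow b hb
        exact ⟨n, by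
          rw [show (f * g) ^ n * b = g ^ n * (f ^ n * b) by ring]
          exact A.mul_mem (A.pow_mem h'.mem n) hn⟩
      · obtain ⟨n, hn⟩ := h'.exists_pow c hc
        exact ⟨n, by
          rw [show (f * g) ^ n * c = f ^ n * (g ^ n * c) by ring]
          exact A.mul_mem (A.pow_mem h.mem n) hn⟩
    exact fun b hb => this hb

lemma isLocAt_adjoin {f : K} {S T : Set K} (hf : f ∈ Algebra.adjoin ℂ S) (h0 : f ≠ 0)
    (hinv : f⁻¹ ∈ Algebra.adjoin ℂ S ⊔ Algebra.adjoin ℂ T)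
    (hT : ∀ t ∈ T, ∃ n : ℕ, f ^ n * t ∈ Algebra.adjoin ℂ S) :
    IsLocAt f (Algebra.adjoin ℂ S) (Algebra.adjoin ℂ S ⊔ Algebra.adjoin ℂ T) := by
  refine ⟨le_sup_left, hf, h0, hinv, ?_⟩
  have : Algebra.adjoin ℂ S ⊔ Algebra.adjoin ℂ T ≤ denomAlg hf :=
    sup_le (fun b hb => ⟨0, by simpa using hb⟩) (Algebra.adjoin_le hT)
  exact fun b hb => this hb

lemma IsLocAt.isLocalization {f : K} {A B : Subalgebra ℂ K} (h : IsLocAt f A B) :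
    letI := (Subalgebra.inclusion h.le).toRingHom.toAlgebra
    IsLocalization.Away (⟨f, h.mem⟩ : A) B := by
  let := (Subalgebra.inclusion h.le).toRingHom.toAlgebra
  have hmap : ∀ a : A, ((algebraMap A B a : B) : K) = a := fun a => rfl
  refine ⟨?_, ?_, ?_⟩
  · rintro ⟨_, n, rfl⟩
    refine IsUnit.of_mul_eq_one (⟨f⁻¹ ^ n, B.pow_mem h.inv_mem n⟩ : B) (Subtype.ext ?_)
    simp only [MulMemClass.coe_mul, hmap, SubmonoidClass.coe_pow, OneMemClass.coe_one, map_pow]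
    rw [← mul_pow, mul_inv_cancel₀ h.ne_zero, one_pow]
  · intro z
    obtain ⟨n, hn⟩ := h.exists_pow z z.2
    refine ⟨⟨⟨_, hn⟩, ⟨_, n, rfl⟩⟩, Subtype.ext ?_⟩
    simp only [MulMemClass.coe_mul, hmap, SubmonoidClass.coe_pow, map_pow]
    ring
  · intro x y hxy
    refine ⟨1, ?_⟩
    have : (x : K) = y := by rw [← hmap x, ← hmap y, hxy]
    rw [Subtype.ext this]

lemma IsLocAt.comap_injective {f : K} {A B : Subalgebra ℂ K} (h : IsLocAt f A B) :
    Function.Injective (PrimeSpectrum.comap (Subalgebra.inclusion h.le).toRingHom) := by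
  let := (Subalgebra.inclusion h.le).toRingHom.toAlgebra
  have := h.isLocalization
  exact PrimeSpectrum.localization_comap_injective B (Submonoid.powers (⟨f, h.mem⟩ : A))

lemma IsLocAt.range_comap {f : K} {A B : Subalgebra ℂ K} (h : IsLocAt f A B) :
    Set.range (PrimeSpectrum.comap (Subalgebra.inclusion h.le).toRingHom) =
      PrimeSpectrum.basicOpen (⟨f, h.mem⟩ : A) := by
  let := (Subalgebra.inclusion h.le).toRingHom.toAlgebra
  have := h.isLocalization
  exact PrimeSpectrum.localization_away_comap_range B (⟨f, h.mem⟩ : A)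

lemma IsLocAt.exists_common {f g : K} {A B C D : Subalgebra ℂ K} (hB : IsLocAt f A B)
    (hC : IsLocAt g A C) (hD : IsLocAt (f * g) A D) (hBD : B ≤ D) (hCD : C ≤ D)
    (x : PrimeSpectrum B) (y : PrimeSpectrum C)
    (hxy : PrimeSpectrum.comap (Subalgebra.inclusion hB.le).toRingHom x =
      PrimeSpectrum.comap (Subalgebra.inclusion hC.le).toRingHom y) :
    ∃ z : PrimeSpectrum D, PrimeSpectrum.comap (Subalgebra.inclusion hBD).toRingHom z = x ∧
      PrimeSpectrum.comap (Subalgebra.inclusion hCD).toRingHom z = y := by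
  set p := PrimeSpectrum.comap (Subalgebra.inclusion hB.le).toRingHom x with hp
  have h1 : p ∈ (PrimeSpectrum.basicOpen (⟨f, hB.mem⟩ : A) : Set (PrimeSpectrum A)) :=
    hB.range_comap ▸ ⟨x, rfl⟩
  have h2 : p ∈ (PrimeSpectrum.basicOpen (⟨g, hC.mem⟩ : A) : Set (PrimeSpectrum A)) :=
    hC.range_comap ▸ ⟨y, hxy.symm⟩
  have h3 : p ∈ (PrimeSpectrum.basicOpen (⟨f * g, hD.mem⟩ : A) : Set (PrimeSpectrum A)) := by
    rw [show (⟨f * g, hD.mem⟩ : A) = ⟨f, hB.mem⟩ * ⟨g, hC.mem⟩ from rfl,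
      PrimeSpectrum.basicOpen_mul]
    exact ⟨h1, h2⟩
  rw [← hD.range_comap] at h3
  obtain ⟨z, hz⟩ := h3
  refine ⟨z, hB.comap_injective ?_, hC.comap_injective ?_⟩
  · rw [← hp, ← hz]; rfl
  · rw [← hxy, ← hz]; rfl

end Loc

/-- A finite family of affine charts `Spec (chart i)` with common function field `K` over `ℂ`,
such that the overlap of any two charts, `Spec` of the ring generated by both coordinate rings,
is a principal open subset of each. -/
structure Atlas (K : Type) [Field K] [Algebra ℂ K] (ι : Type) where
  chart : ι → Subalgebra ℂ K
  overlap : ∀ i j, ∃ f, IsLocAt f (chart i) (chart i ⊔ chart j)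

namespace Atlas

variable {K : Type} [Field K] [Algebra ℂ K] {ι : Type} (A : Atlas K ι)

/-- The coordinate ring of the intersection of the charts in `s`. -/
def ring (s : Finset ι) : Subalgebra ℂ K := s.sup A.chart

lemma ring_mono {s t : Finset ι} (h : s ≤ t) : A.ring s ≤ A.ring t := Finset.sup_mono h

lemma exists_isLocAt {s t : Finset ι} (hs : s.Nonempty) (h : s ≤ t) :
    ∃ f, IsLocAt f (A.ring s) (A.ring t) := by
  classical
  obtain ⟨i, hi⟩ := hs
  have key : ∀ t' : Finset ι, ∃ f, IsLocAt f (A.ring s) (A.ring s ⊔ A.ring t') := by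
    intro t'
    induction t' using Finset.induction_on with
    | empty => exact ⟨1, by simpa [ring] using IsLocAt.refl (A.ring s)⟩
    | insert j t' _ ih =>
      obtain ⟨f, hf⟩ := ih
      obtain ⟨g, hg⟩ := A.overlap i j
      have h1 := hg.sup_right (A.ring s)
      have hle : A.chart i ≤ A.ring s := Finset.le_sup hi
      rw [sup_eq_right.mpr hle, sup_right_comm, sup_eq_right.mpr hle] at h1
      have h2 := h1.sup hf
      refine ⟨g * f, ?_⟩
      rwa [show (A.ring s ⊔ A.chart j) ⊔ (A.ring s ⊔ A.ring t') =
        A.ring s ⊔ A.ring (insert j t') by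
          simp only [ring, Finset.sup_insert]
          exact (sup_sup_distrib_left _ _ _).symm] at h2
  obtain ⟨f, hf⟩ := key t
  exact ⟨f, by rwa [sup_eq_right.mpr (A.ring_mono h)] at hf⟩

/-- Nonempty finite sets of charts. -/
abbrev Index (ι : Type) : Type := {s : Finset ι // s.Nonempty}

/-- The diagram of coordinate rings of the finite intersections of charts. -/
def ringFunctor : Index ι ⥤ CommRingCat.{0} where
  obj s := .of (A.ring s.1)
  map {_ _} h := CommRingCat.ofHom (Subalgebra.inclusion (A.ring_mono h.le)).toRingHom
  map_id _ := rfl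
  map_comp _ _ := rfl

/-- The diagram of finite intersections of charts. -/
def functor : (Index ι)ᵒᵖ ⥤ Scheme.{0} := A.ringFunctor.op ⋙ Scheme.Spec

instance {s t : (Index ι)ᵒᵖ} (h : s ⟶ t) : IsOpenImmersion (A.functor.map h) := by
  obtain ⟨f, hf⟩ := A.exists_isLocAt t.unop.2 h.unop.le
  let := (Subalgebra.inclusion hf.le).toRingHom.toAlgebra
  have := hf.isLocalization
  exact IsOpenImmersion.of_isLocalization (R := A.ring t.unop.1) (S := A.ring s.unop.1)
    (⟨f, hf.mem⟩ : A.ring t.unop.1)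

instance : (A.functor ⋙ Scheme.forget).IsLocallyDirected where
  cond {s s' k} h h' x x' hx := by
    classical
    obtain ⟨f, hf⟩ := A.exists_isLocAt k.unop.2 h.unop.le
    obtain ⟨g, hg⟩ := A.exists_isLocAt k.unop.2 h'.unop.le
    let l : (Index ι)ᵒᵖ := .op ⟨s.unop.1 ∪ s'.unop.1, s.unop.2.mono Finset.subset_union_left⟩
    let a : l ⟶ s := (homOfLE (show s.unop.1 ≤ _ from Finset.subset_union_left)).op
    let b : l ⟶ s' := (homOfLE (show s'.unop.1 ≤ _ from Finset.subset_union_right)).op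
    have hD : IsLocAt (f * g) (A.ring k.unop.1) (A.ring (s.unop.1 ∪ s'.unop.1)) := by
      have := hf.sup hg
      rwa [show A.ring s.unop.1 ⊔ A.ring s'.unop.1 = A.ring (s.unop.1 ∪ s'.unop.1) from
        Finset.sup_union.symm] at this
    obtain ⟨z, hz, hz'⟩ := hf.exists_common hg hD (A.ring_mono Finset.subset_union_left)
      (A.ring_mono Finset.subset_union_right) x x' hx
    exact ⟨l, a, b, z, hz, hz'⟩

/-- The scheme obtained by gluing the charts along their overlaps. -/
abbrev scheme : Scheme.{0} := colimit A.functor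

/-- The inclusion of the open subscheme `Spec (chart i)`. -/
def chartMap (i : ι) : Spec (.of (A.ring {i})) ⟶ A.scheme :=
  colimit.ι A.functor (.op ⟨{i}, Finset.singleton_nonempty i⟩)

/-- The structure morphism to `Spec ℂ`. -/
def toSpec : A.scheme ⟶ Spec (.of ℂ) :=
  colimit.desc A.functor
    { pt := Spec (.of ℂ)
      ι :=
        { app := fun s => Spec.map (CommRingCat.ofHom (algebraMap ℂ (A.ring s.unop.1)))
          naturality := by
            intro s t h
            exact (Spec.map_comp _ _).symm.trans (Category.comp_id _).symm } }

/-- The generic point `Spec K ⟶ A.scheme`. -/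
def generic [Inhabited ι] : Spec (.of K) ⟶ A.scheme :=
  Spec.map (CommRingCat.ofHom (A.ring {(default : ι)}).val.toRingHom) ≫ A.chartMap default

section Map

variable {K' : Type} [Field K'] [Algebra ℂ K'] (B : Atlas K' ι) (φ : K →ₐ[ℂ] K')
  (h : ∀ i, (A.chart i).map φ ≤ B.chart i)

lemma ring_map_le (h : ∀ i, (A.chart i).map φ ≤ B.chart i) (s : Finset ι) : ∀ a ∈ A.ring s, φ a ∈ B.ring s := by
  suffices A.ring s ≤ (B.ring s).comap φ from fun a ha => this ha
  refine Finset.sup_le fun i hi a ha => ?_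
  exact (Finset.le_sup hi : B.chart i ≤ B.ring s) (h i ⟨a, ha, rfl⟩)

/-- The map of coordinate rings of the intersection of the charts in `s` induced by `φ`. -/
def ringMap (s : Finset ι) : A.ring s →+* B.ring s :=
  φ.toRingHom.restrict (A.ring s) (B.ring s) (A.ring_map_le B φ h s)

/-- The morphism of glued schemes that is given on the `i`-th charts by a homomorphism
`φ` of function fields. -/
def map : B.scheme ⟶ A.scheme :=
  colimMap
    { app := fun s => Spec.map (CommRingCat.ofHom (A.ringMap B φ h s.unop.1))
      naturality := by
        intro s t f
        refine (Spec.map_comp (CommRingCat.ofHom (A.ringMap B φ h t.unop.1))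
          (B.ringFunctor.map f.unop)).symm.trans ?_
        exact (Spec.map_comp (A.ringFunctor.map f.unop)
          (CommRingCat.ofHom (A.ringMap B φ h s.unop.1))) }

lemma generic_map [Inhabited ι] :
    B.generic ≫ A.map B φ h = Spec.map (CommRingCat.ofHom φ.toRingHom) ≫ A.generic := by
  have h1 : B.chartMap default ≫ A.map B φ h =
      Spec.map (CommRingCat.ofHom (A.ringMap B φ h {default})) ≫ A.chartMap default :=
    ι_colimMap _ _
  rw [generic, generic, Category.assoc, h1, ← Category.assoc, ← Category.assoc, ← Spec.map_comp,
    ← Spec.map_comp]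
  rfl

end Map

end Atlas

/-! ### Projective spaces and rational ruled surfaces -/

/-- The rational function field `ℂ(t₁, …, tₙ)`. -/
abbrev RatField (n : ℕ) : Type := FractionRing (MvPolynomial (Fin n) ℂ)

/-- The `i`-th variable of `ℂ(t₁, …, tₙ)`. -/
def var {n : ℕ} (i : Fin n) : RatField n := algebraMap (MvPolynomial (Fin n) ℂ) _ (.X i)

lemma var_ne_zero {n : ℕ} (i : Fin n) : var i ≠ 0 := by
  simp [var]

/-- The homogeneous coordinates `(1 : t₁ : … : tₙ)` of the generic point of `ℙⁿ`. -/
def homCoord (n : ℕ) : Fin (n + 1) → RatField n := Fin.cons 1 var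

lemma homCoord_ne_zero {n : ℕ} (i : Fin (n + 1)) : homCoord n i ≠ 0 := by
  refine Fin.cases ?_ (fun i => ?_) i
  · simp [homCoord]
  · simpa [homCoord] using var_ne_zero i

/-- The projective space `ℙⁿ` over `ℂ`, with its standard charts, whose coordinate rings are
`ℂ[X₀/Xᵢ, …, Xₙ/Xᵢ]`. -/
def projAtlas (n : ℕ) : Atlas (RatField n) (Fin (n + 1)) where
  chart i := Algebra.adjoin ℂ (Set.range fun j => homCoord n j / homCoord n i)
  overlap i j := by
    have h := @homCoord_ne_zero n
    refine ⟨homCoord n j / homCoord n i, isLocAt_adjoin (Algebra.subset_adjoin ⟨j, rfl⟩)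
      (div_ne_zero (h j) (h i)) ?_ ?_⟩
    · rw [inv_div]
      exact (le_sup_right : Algebra.adjoin ℂ (Set.range fun k => homCoord n k / homCoord n j) ≤ _)
        (Algebra.subset_adjoin ⟨i, rfl⟩)
    · rintro _ ⟨k, rfl⟩
      refine ⟨1, ?_⟩
      have h1 := h i
      have h2 := h j
      rw [pow_one, show homCoord n j / homCoord n i * (homCoord n k / homCoord n j) =
        homCoord n k / homCoord n i by field_simp]
      exact Algebra.subset_adjoin ⟨k, rfl⟩

/-- The coordinate `x = X₁/X₀` of the base of a ruled surface over `ℙ¹`. -/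
def xVar : RatField 2 := var 0

/-- The fibre coordinate `u = y₂/y₁` of a ruled surface over the chart `X₀ ≠ 0`. -/
def uVar : RatField 2 := var 1

/-- The coordinate `x` or `x⁻¹` on the two charts of the base `ℙ¹`. -/
def baseCoord (a : Bool) : RatField 2 := if a then xVar⁻¹ else xVar

/-- The fibre coordinate over the two charts of the base: `u` where `x` is regular and `x⁻ⁿ u`
where `x⁻¹` is regular. -/
def fibCoord (n : ℕ) (a : Bool) : RatField 2 := if a then uVar * (xVar ^ n)⁻¹ else uVar

/-- The fibre coordinate `y₂/y₁` or its inverse `y₁/y₂` on the chart `(a, b)`. -/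
def fibChart (n : ℕ) (a b : Bool) : RatField 2 :=
  if b then (fibCoord n a)⁻¹ else fibCoord n a

lemma baseCoord_ne_zero (a : Bool) : baseCoord a ≠ 0 := by
  have : xVar ≠ 0 := var_ne_zero 0
  cases a <;> simp [baseCoord, this]

lemma fibChart_ne_zero (n : ℕ) (a b : Bool) : fibChart n a b ≠ 0 := by
  have : xVar ≠ 0 := var_ne_zero 0
  have : uVar ≠ 0 := var_ne_zero 1
  cases a <;> cases b <;> simp [fibChart, fibCoord, *]

lemma baseCoord_not (a : Bool) : baseCoord (!a) = (baseCoord a)⁻¹ := by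
  cases a <;> simp [baseCoord]

lemma fibChart_not_right (n : ℕ) (a b : Bool) : fibChart n a (!b) = (fibChart n a b)⁻¹ := by
  cases b <;> simp [fibChart]

lemma fibCoord_not (n : ℕ) (a : Bool) :
    fibCoord n (!a) = fibCoord n a * (baseCoord a ^ n)⁻¹ := by
  have : xVar ≠ 0 := var_ne_zero 0
  cases a <;> simp [fibCoord, baseCoord, this]

lemma fibChart_not_left (n : ℕ) (a b : Bool) :
    fibChart n (!a) b =
      fibChart n a b * (if b then baseCoord a ^ n else (baseCoord a ^ n)⁻¹) := by
  cases b <;> simp [fibChart, fibCoord_not, mul_comm]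

/-- The rational ruled surface `ℙₙ = ℙ(𝒪 ⊕ 𝒪(n))` over `ℙ¹`, glued from four affine planes:
over each of the two charts of `ℙ¹` it is `Proj` of `𝒪[y₁, y₂]`, with fibre coordinate
`u = y₂/y₁` transforming like a section of `𝒪(n)`.  The section `E₀` is `u = 0`, the section
`E_∞` is `u = ∞`, and a form `σ` of degree `n` gives the section `E_σ : u = σ(1, x)`. -/
def hirzebruch (n : ℕ) : Atlas (RatField 2) (Bool × Bool) where
  chart i := Algebra.adjoin ℂ {baseCoord i.1, fibChart n i.1 i.2}
  overlap := by
    rintro ⟨a, b⟩ ⟨a', b'⟩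
    have hX := baseCoord_ne_zero a
    have hY := fibChart_ne_zero n a b
    have hXm : baseCoord a ∈ Algebra.adjoin ℂ {baseCoord a, fibChart n a b} :=
      Algebra.subset_adjoin (by simp)
    have hYm : fibChart n a b ∈ Algebra.adjoin ℂ {baseCoord a, fibChart n a b} :=
      Algebra.subset_adjoin (by simp)
    have hXi : (baseCoord a)⁻¹ ∈
        Algebra.adjoin ℂ {baseCoord (!a), fibChart n (!a) b'} :=
      Algebra.subset_adjoin (by simp [baseCoord_not])
    have hYi : fibChart n (!a) (!b) ∈
        Algebra.adjoin ℂ {baseCoord (!a), fibChart n (!a) (!b)} :=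
      Algebra.subset_adjoin (by simp)
    have hYi' : (fibChart n a b)⁻¹ ∈ Algebra.adjoin ℂ {baseCoord a, fibChart n a (!b)} :=
      Algebra.subset_adjoin (by simp [fibChart_not_right])
    have ha : a' = a ∨ a' = !a := by cases a <;> cases a' <;> simp
    have hb : b' = b ∨ b' = !b := by cases b <;> cases b' <;> simp
    rcases ha with rfl | rfl <;> rcases hb with rfl | rfl
    · exact ⟨1, by simpa using IsLocAt.refl _⟩
    · refine ⟨_, isLocAt_adjoin hYm hY (le_sup_right (a := Algebra.adjoin ℂ _) hYi') ?_⟩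
      rintro t (rfl | rfl)
      · exact ⟨0, by simpa using hXm⟩
      · exact ⟨1, by simp [fibChart_not_right, hY]⟩
    · refine ⟨_, isLocAt_adjoin hXm hX (le_sup_right (a := Algebra.adjoin ℂ _) hXi) ?_⟩
      rintro t (rfl | rfl)
      · exact ⟨1, by simp [baseCoord_not, hX]⟩
      · refine ⟨n, ?_⟩
        rw [fibChart_not_left]
        cases b'
        · convert! hYm using 1
          simp only [Bool.false_eq_true, if_false]
          field_simp
        · convert! mul_mem hYm (pow_mem hXm (n + n)) using 1
          simp only [if_true]
          ring
    · refine ⟨_, isLocAt_adjoin (mul_mem hXm hYm) (mul_ne_zero hX hY) ?_ ?_⟩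
      · have h1 := le_sup_right (a := Algebra.adjoin ℂ {baseCoord a, fibChart n a b}) hXi
        have h2 := le_sup_right (a := Algebra.adjoin ℂ {baseCoord a, fibChart n a b}) hYi
        have h3 := le_sup_left
          (b := Algebra.adjoin ℂ {baseCoord (!a), fibChart n (!a) (!b)}) hXm
        rw [mul_inv]
        refine mul_mem h1 ?_
        cases b
        · convert! mul_mem h2 (pow_mem h1 n) using 1
          rw [fibChart_not_left, fibChart_not_right]
          simp only [Bool.not_false, if_true, inv_pow]
          field_simp
        · convert! mul_mem h2 (pow_mem h3 n) using 1
          rw [fibChart_not_left, fibChart_not_right]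
          simp only [Bool.not_true, Bool.false_eq_true, if_false]
          field_simp
      · rintro t (rfl | rfl)
        · refine ⟨1, ?_⟩
          convert! hYm using 1
          rw [baseCoord_not]
          field_simp
        · refine ⟨n + 1, ?_⟩
          rw [fibChart_not_left, fibChart_not_right]
          cases b
          · convert! mul_mem (pow_mem hXm (2 * n + 1)) (pow_mem hYm n) using 1
            simp only [Bool.not_false, if_true]
            field_simp
            ring
          · convert! mul_mem hXm (pow_mem hYm n) using 1
            simp only [Bool.not_true, Bool.false_eq_true, if_false]
            field_simp
            ring

/-- The homomorphism `x ↦ x`, `u ↦ u⁶` of function fields. -/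
def muField : RatField 2 →ₐ[ℂ] RatField 2 :=
  IsFractionRing.liftAlgHom (g := MvPolynomial.aeval ![xVar, uVar ^ 6])
    (by
      have h : AlgebraicIndependent ℂ (var : Fin 2 → RatField 2) := by
        have := (MvPolynomial.algebraicIndependent_X (Fin 2) ℂ).map'
          (f := IsScalarTower.toAlgHom ℂ (MvPolynomial (Fin 2) ℂ) (RatField 2))
          (IsFractionRing.injective _ _)
        exact this
      have h2 := h.polynomial_aeval_of_transcendental
        (f := ![(Polynomial.X : Polynomial ℂ), Polynomial.X ^ 6])
        (by
          intro i
          fin_cases i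
          · exact Polynomial.transcendental_X ℂ
          · exact (Polynomial.transcendental_X ℂ).pow (by norm_num))
      have h3 : (fun i => Polynomial.aeval (var i : RatField 2)
          ((![(Polynomial.X : Polynomial ℂ), Polynomial.X ^ 6] : Fin 2 → _) i)) =
          ![xVar, uVar ^ 6] := by
        funext i
        fin_cases i <;> simp [xVar, uVar]
      rw [h3] at h2
      exact h2)

lemma muField_xVar : muField xVar = xVar := by
  simp [muField, xVar, var]

lemma muField_uVar : muField uVar = uVar ^ 6 := by
  simp [muField, uVar, var]

/-- The morphism `μ : ℙ₁ ⟶ ℙ₆` over `ℙ¹`, given on the charts by `y₁ ↦ y₁⁶`, `y₂ ↦ y₂⁶`. -/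
def mu : (hirzebruch 1).scheme ⟶ (hirzebruch 6).scheme :=
  (hirzebruch 6).map (hirzebruch 1) muField (by
    rintro ⟨a, b⟩
    have hX : muField (baseCoord a) = baseCoord a := by
      cases a <;> simp [baseCoord, muField_xVar]
    have hY : muField (fibChart 6 a b) = fibChart 1 a b ^ 6 := by
      cases a <;> cases b <;>
        simp [fibChart, fibCoord, muField_xVar, muField_uVar, mul_pow]
    rw [hirzebruch, hirzebruch, AlgHom.map_adjoin]
    refine Algebra.adjoin_le ?_
    rintro _ ⟨t, rfl | rfl, rfl⟩
    · rw [hX]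
      exact Algebra.subset_adjoin (by simp)
    · rw [hY]
      exact pow_mem (Algebra.subset_adjoin (by simp)) 6)

/-- `muField` is the pullback of rational functions along `μ`. -/
lemma generic_mu : (hirzebruch 1).generic ≫ mu =
    Spec.map (CommRingCat.ofHom muField.toRingHom) ≫ (hirzebruch 6).generic :=
  (hirzebruch 6).generic_map (hirzebruch 1) muField _

/-! ### Kummer coverings -/

section Kummer

variable {K : Type} [Field K] {X : Scheme.{0}} (η : Spec (.of K) ⟶ X) (n : ℕ) (h : K)

/-- The function field `K(ⁿ√h) = K[T]/(Tⁿ - h)` of a Kummer covering. -/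
abbrev KummerField : Type := AdjoinRoot (Polynomial.X ^ n - Polynomial.C h : Polynomial K)

/-- The morphism `Spec K(ⁿ√h) ⟶ Spec K ⟶ X`. -/
def kummerMap : Spec (.of (KummerField n h)) ⟶ X :=
  Spec.map (CommRingCat.ofHom (AdjoinRoot.of _)) ≫ η

instance : QuasiCompact (kummerMap η n h) := by
  have : IsNoetherianRing (KummerField n h) := inferInstance
  infer_instance

/-- The Kummer covering of `X` given by `ⁿ√h`, for a rational function `h` on `X`: the
normalization of `X` in `K(ⁿ√h)`, where `η : Spec K ⟶ X` is the generic point. -/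
abbrev kummerCover : Scheme.{0} := (kummerMap η n h).normalization

/-- The covering morphism. -/
abbrev kummerCoverMap : kummerCover η n h ⟶ X := (kummerMap η n h).fromNormalization

variable {n}

/-- The automorphism `T ↦ ξ T` of `K(ⁿ√h)`, for `ξⁿ = 1`. -/
def deckField (ξ : K) (hξ : ξ ^ n = 1) : KummerField n h →ₐ[K] KummerField n h :=
  AdjoinRoot.liftAlgHom _ (Algebra.ofId K _)
    (algebraMap K (KummerField n h) ξ * AdjoinRoot.root _) (by
      have := AdjoinRoot.eval₂_root (Polynomial.X ^ n - Polynomial.C h : Polynomial K)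
      rw [Polynomial.eval₂_sub, Polynomial.eval₂_pow, Polynomial.eval₂_X,
        Polynomial.eval₂_C] at this
      change Polynomial.eval₂ (algebraMap K (KummerField n h)) _ _ = 0
      rw [Polynomial.eval₂_sub, Polynomial.eval₂_pow, Polynomial.eval₂_X, Polynomial.eval₂_C,
        mul_pow, ← map_pow, hξ, map_one, one_mul]
      exact this)

/-- The covering transformation of the Kummer covering whose pullback is `ⁿ√h ↦ ξ ⁿ√h`. -/
def deck (ξ : K) (hξ : ξ ^ n = 1) : kummerCover η n h ⟶ kummerCover η n h :=
  (kummerMap η n h).normalizationDesc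
    (Spec.map (CommRingCat.ofHom (deckField h ξ hξ).toRingHom) ≫
      (kummerMap η n h).toNormalization)
    (kummerMap η n h).fromNormalization (by
      rw [Category.assoc, Scheme.Hom.toNormalization_fromNormalization, kummerMap,
        ← Category.assoc, ← Spec.map_comp, ← CommRingCat.ofHom_comp]
      congr 3
      exact (deckField h ξ hξ).comp_algebraMap.symm)

lemma deck_comp (ξ : K) (hξ : ξ ^ n = 1) :
    deck η h ξ hξ ≫ kummerCoverMap η n h = kummerCoverMap η n h :=
  Scheme.Hom.normalizationDesc_comp ..

end Kummer

/-! ### The curves and surfaces -/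

/-- The curve given by `yⁿ = h(x)`: the smooth projective model, as a cyclic covering of `ℙ¹`. -/
abbrev cyclicCurve (n : ℕ) (h : RatField 1) : Scheme.{0} :=
  kummerCover (projAtlas 1).generic n h

/-- The structure morphism of `yⁿ = h(x)` over `ℂ`. -/
def cyclicCurveToSpec (n : ℕ) (h : RatField 1) : cyclicCurve n h ⟶ Spec (.of ℂ) :=
  kummerCoverMap (projAtlas 1).generic n h ≫ (projAtlas 1).toSpec

/-- The automorphism `(x, y) ↦ (x, ξ y)` of the curve `yⁿ = h(x)`. -/
def cyclicCurveAut {n : ℕ} (h : RatField 1) (ξ : ℂ) (hξ : ξ ^ n = 1) :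
    cyclicCurve n h ⟶ cyclicCurve n h :=
  deck (projAtlas 1).generic h (algebraMap ℂ _ ξ) (by rw [← map_pow, hξ, map_one])

lemma cyclicCurveAut_comp {n : ℕ} (h : RatField 1) (ξ : ℂ) (hξ : ξ ^ n = 1) :
    cyclicCurveAut h ξ hξ ≫ cyclicCurveToSpec n h = cyclicCurveToSpec n h := by
  rw [cyclicCurveAut, cyclicCurveToSpec, ← Category.assoc, deck_comp]

/-- The product `C₁ × C₂` over `ℂ` of the curves `C₁ : yⁿ = h₁(x)` and `C₂ : yⁿ = h₂(x)`. -/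
abbrev curveProd (n : ℕ) (h₁ h₂ : RatField 1) : Scheme.{0} :=
  pullback (cyclicCurveToSpec n h₁) (cyclicCurveToSpec n h₂)

/-- The automorphism `(γ₁, γ₂)` of `C₁ × C₂`, where `γᵢ` is `(x, y) ↦ (x, ξ y)`. -/
def diagAut {n : ℕ} (h₁ h₂ : RatField 1) (ξ : ℂ) (hξ : ξ ^ n = 1) :
    curveProd n h₁ h₂ ⟶ curveProd n h₁ h₂ :=
  pullback.map _ _ _ _ (cyclicCurveAut h₁ ξ hξ) (cyclicCurveAut h₂ ξ hξ) (𝟙 _)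
    (by rw [cyclicCurveAut_comp, Category.comp_id]) (by rw [cyclicCurveAut_comp, Category.comp_id])

/-- The quotient `C₁ × C₂/⟨(1, 1)⟩` by the group generated by `(γ₁, γ₂)`: the coequalizer of
`(γ₁, γ₂)` and the identity in locally ringed spaces, that is the topological quotient with the
sheaf of invariant functions. -/
def quotProd {n : ℕ} (h₁ h₂ : RatField 1) (ξ : ℂ) (hξ : ξ ^ n = 1) : LocallyRingedSpace.{0} :=
  coequalizer (diagAut h₁ h₂ ξ hξ).toLRSHom (𝟙 (curveProd n h₁ h₂).toLocallyRingedSpace)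

/-- The structure morphism of `C₁ × C₂` over `ℂ`. -/
def curveProdToSpec (n : ℕ) (h₁ h₂ : RatField 1) : curveProd n h₁ h₂ ⟶ Spec (.of ℂ) :=
  pullback.fst _ _ ≫ cyclicCurveToSpec n h₁

lemma diagAut_comp {n : ℕ} (h₁ h₂ : RatField 1) (ξ : ℂ) (hξ : ξ ^ n = 1) :
    diagAut h₁ h₂ ξ hξ ≫ curveProdToSpec n h₁ h₂ = curveProdToSpec n h₁ h₂ := by
  rw [diagAut, curveProdToSpec, ← Category.assoc, pullback.lift_fst, Category.assoc,
    cyclicCurveAut_comp]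

/-- The structure morphism of `C₁ × C₂/⟨(1, 1)⟩` over `ℂ`. -/
def quotProdToSpec {n : ℕ} (h₁ h₂ : RatField 1) (ξ : ℂ) (hξ : ξ ^ n = 1) :
    quotProd h₁ h₂ ξ hξ ⟶ (Spec (.of ℂ)).toLocallyRingedSpace :=
  coequalizer.desc (curveProdToSpec n h₁ h₂).toLRSHom (by
    rw [Category.id_comp]
    exact congrArg Scheme.Hom.toLRSHom (diagAut_comp h₁ h₂ ξ hξ))

/-- Birational equivalence over a base: there are dense open subspaces that are isomorphic over
the base.  For schemes this is `AlgebraicGeometry.Scheme.BirationalOver`. -/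
def LRSBirationalOver {X Y S : LocallyRingedSpace.{0}} (sX : X ⟶ S) (sY : Y ⟶ S) : Prop :=
  ∃ (U : TopologicalSpace.Opens X) (V : TopologicalSpace.Opens Y),
    Dense (U : Set X) ∧ Dense (V : Set Y) ∧
    ∃ e : X.restrict U.isOpenEmbedding ≅ Y.restrict V.isOpenEmbedding,
      e.hom ≫ Y.ofRestrict V.isOpenEmbedding ≫ sY = X.ofRestrict U.isOpenEmbedding ≫ sX

/-- The coordinate `x = X₁/X₀` of `ℙ¹`. -/
def pVar : RatField 1 := var 0

/-- The value `σ(1, x)` of a binary form `σ(X₀, X₁)`; for `x = X₁/X₀` and `σ` of degree `6` it is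
the rational function `σ/X₀⁶`. -/
def formValue {K : Type} [Field K] [Algebra ℂ K] (σ : MvPolynomial (Fin 2) ℂ) (x : K) : K :=
  MvPolynomial.aeval ![1, x] σ

/-- The rational function on `ℙ₆` with divisor `E_σ - E₀`. -/
def sectionRatio (σ : MvPolynomial (Fin 2) ℂ) : RatField 2 :=
  (uVar - formValue σ xVar) / uVar

/-- The surface `𝒴`: the Kummer covering of `ℙ₁` of degree `2` given by the square root of the
rational function with divisor `μ^*E_σ - μ^*E₀` (the pullback along `μ` of the one with divisor
`E_σ - E₀`; it is determined up to a constant, which has a square root in `ℂ`). -/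
abbrev surfaceY (σ : MvPolynomial (Fin 2) ℂ) : Scheme.{0} :=
  kummerCover (hirzebruch 1).generic 2 (muField (sectionRatio σ))

/-- The structure morphism of `𝒴` over `ℂ`. -/
def surfaceYToSpec (σ : MvPolynomial (Fin 2) ℂ) : surfaceY σ ⟶ Spec (.of ℂ) :=
  kummerCoverMap (hirzebruch 1).generic 2 (muField (sectionRatio σ)) ≫ (hirzebruch 1).toSpec

/-- The double covering of `ℙ²`, with homogeneous coordinates `(X₀ : X₁ : Y)`, branched along the
sextic curve `C : Y⁶ = σ(X₀, X₁)`: the Kummer covering given by the square root of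
`(Y⁶ - σ(X₀, X₁))/X₀⁶`. -/
abbrev doublePlane (σ : MvPolynomial (Fin 2) ℂ) : Scheme.{0} :=
  kummerCover (projAtlas 2).generic 2 (var 1 ^ 6 - formValue σ (var 0))

/-- The structure morphism of the double plane over `ℂ`. -/
def doublePlaneToSpec (σ : MvPolynomial (Fin 2) ℂ) : doublePlane σ ⟶ Spec (.of ℂ) :=
  kummerCoverMap (projAtlas 2).generic 2 (var 1 ^ 6 - formValue σ (var 0)) ≫ (projAtlas 2).toSpec

end KummerSurface

end

/-!
`C × C' / ⟨(1, 1)⟩`, `𝒴` and the double plane each contain a dense affine open subscheme, and any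
two of these have the same function field up to isomorphism. For `𝒴` and the double plane this
holds because the two radicands differ by the square `u ^ 6 = (u ^ 3) ^ 2`.

On invariant affine open sets the quotient of `C × C'` is the spectrum of the ring of invariants, so
its function field is the field of invariants of `ℂ(C × C')`. Averaging over the group, using that
`y₁` and `y₂` are multiplied by the same root of unity `ξ`, shows that this field is generated by
`x₁`, `x₂` and `y₁ / y₂`. Put `u = c⁻¹ y₁ / y₂` with `c ^ 6 = -4` and `t = 2 x₂ - 1`. Then
`t ^ 2 = 1 + 4 x₂ (x₂ - 1) = 1 + 4 y₂ ^ 6 = (u ^ 6 - σ(1, x₁)) / u ^ 6`, the equation of `𝒴`.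
-/

noncomputable section

namespace KummerSurface

open TopologicalSpace Opposite

open scoped TensorProduct

universe u

/-! ### Coequalizers of locally ringed spaces -/

section ParallelPairLimit

open WalkingParallelPair WalkingParallelPairHom

variable {C : Type*} [Category* C] {FC : C → C → Type*} {CC : C → Type*}
  [∀ X Y, FunLike (FC X Y) (CC X) (CC Y)] [ConcreteCategory C FC]
  (D : WalkingParallelPairᵒᵖ ⥤ C) [HasLimit D] [PreservesLimit D (forget C)]

lemma limit_π_one_injective : Function.Injective (limit.π D (op one)) := by
  refine fun a b hab => Concrete.limit_ext D a b ?_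
  rintro ⟨_ | _⟩
  · rw [← limit.w D (Quiver.Hom.op (V := WalkingParallelPair) left), ConcreteCategory.comp_apply,
      ConcreteCategory.comp_apply, hab]
  · exact hab

lemma exists_limit_π_one_eq (s : ToType (D.obj (op one)))
    (hs : D.map (Quiver.Hom.op (V := WalkingParallelPair) left) s =
      D.map (Quiver.Hom.op (V := WalkingParallelPair) right) s) :
    ∃ t, limit.π D (op one) t = s := by
  let family : ∀ j, (D ⋙ forget C).obj j
    | op one => s
    | op zero => D.map (Quiver.Hom.op (V := WalkingParallelPair) left) s
  have hfamily : family ∈ (D ⋙ forget C).sections := by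
    rintro ⟨j⟩ ⟨k⟩ ⟨h⟩
    change WalkingParallelPairHom k j at h
    cases h
    · rfl
    · exact hs.symm
    · exact congrArg (fun φ => φ (family (op j))) ((D ⋙ forget C).map_id (op j))
  let e := Types.isLimitEquivSections (isLimitOfPreserves (forget C) (limit.isLimit D))
  exact ⟨e.symm ⟨family, hfamily⟩,
    congrFun (congrArg Subtype.val (e.apply_symm_apply ⟨family, hfamily⟩)) (op one)⟩

end ParallelPairLimit

section SectionEqualizer

/-- The sections over `U` of the target of `q : Y ⟶ Z` are, through `q`, exactly the sections of
`Y` over `q⁻¹ U` on which `f, g : X ⟶ Y` agree. The two pullbacks of a section live over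
`f⁻¹ q⁻¹ U` and `g⁻¹ q⁻¹ U`, which coincide when `f ≫ q = g ≫ q`; the morphism `i` stands for
this equality. -/
structure IsSectionEqualizer {X Y Z : PresheafedSpace.{_, _, u} CommRingCat.{u}} (f g : X ⟶ Y)
    (q : Y ⟶ Z) (U : Opens Z) : Prop where
  injective : Function.Injective (q.c.app (op U))
  exists_eq (s : Y.presheaf.obj (op ((Opens.map q.base).obj U)))
    (hs : ∀ i : (Opens.map f.base).obj ((Opens.map q.base).obj U) ⟶
        (Opens.map g.base).obj ((Opens.map q.base).obj U),
      f.c.app (op _) s = X.presheaf.map i.op (g.c.app (op _) s)) :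
    ∃ t, q.c.app (op U) t = s

lemma isSectionEqualizer_coequalizer {X Y : PresheafedSpace.{_, _, u} CommRingCat.{u}}
    (f g : X ⟶ Y) (U : Opens (coequalizer f g : PresheafedSpace.{_, _, u} CommRingCat.{u})) :
    IsSectionEqualizer f g (coequalizer.π f g) U := by
  let D := PresheafedSpace.componentwiseDiagram (parallelPair f g) U
  let e := PresheafedSpace.colimitPresheafObjIsoComponentwiseLimit (parallelPair f g) U
  have he : e.hom ≫ limit.π D (op .one) = (coequalizer.π f g).c.app (op U) :=
    PresheafedSpace.colimitPresheafObjIsoComponentwiseLimit_hom_π (parallelPair f g) U .one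
  have he_bij := ConcreteCategory.bijective_of_isIso e.hom
  refine ⟨?_, fun s hs => ?_⟩
  · rw [← he]
    exact (limit_π_one_injective D).comp he_bij.1
  have hfg : (Opens.map f.base).obj ((Opens.map (coequalizer.π f g).base).obj U) =
      (Opens.map g.base).obj ((Opens.map (coequalizer.π f g).base).obj U) :=
    congrArg (fun k => (Opens.map k).obj U)
      (congrArg PresheafedSpace.Hom.base (coequalizer.condition f g))
  have hzero : (Opens.map (colimit.ι (parallelPair f g) .zero).base).obj U =
      (Opens.map f.base).obj ((Opens.map (coequalizer.π f g).base).obj U) := by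
    rw [← colimit.w (parallelPair f g) WalkingParallelPairHom.left]
    rfl
  have hs' : D.map (Quiver.Hom.op (V := WalkingParallelPair) .left) s =
      D.map (Quiver.Hom.op (V := WalkingParallelPair) .right) s := by
    refine (congrArg (X.presheaf.map (eqToHom (congrArg op hzero.symm)))
      (hs (eqToHom hfg))).trans ?_
    change (g.c.app (op _) ≫ X.presheaf.map (eqToHom hfg).op ≫
      X.presheaf.map (eqToHom (congrArg op hzero.symm))) s = _
    rw [← X.presheaf.map_comp]
    rfl
  obtain ⟨t, ht⟩ := exists_limit_π_one_eq D s hs'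
  obtain ⟨t, rfl⟩ := he_bij.2 t
  exact ⟨t, by rw [← he]; exact ht⟩

lemma IsSectionEqualizer.comp_iso {X Y Z Z' : PresheafedSpace.{_, _, u} CommRingCat.{u}}
    {f g : X ⟶ Y} {q : Y ⟶ Z} {e : Z ⟶ Z'} [IsIso e] {U : Opens Z'}
    (H : IsSectionEqualizer f g q ((Opens.map e.base).obj U)) :
    IsSectionEqualizer f g (q ≫ e) U := by
  have := PresheafedSpace.c_isIso_of_iso e
  have he := ConcreteCategory.bijective_of_isIso (e.c.app (op U))
  have hc : (q ≫ e).c.app (op U) = e.c.app (op U) ≫ q.c.app (op ((Opens.map e.base).obj U)) :=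
    PresheafedSpace.comp_c_app ..
  refine ⟨?_, fun s hs => ?_⟩
  · rw [hc]
    exact H.injective.comp he.1
  · obtain ⟨t, ht⟩ := H.exists_eq s hs
    obtain ⟨t', rfl⟩ := he.2 t
    exact ⟨t', by rw [hc]; exact ht⟩

/-- The forgetful functor from locally ringed spaces to presheafed spaces. -/
abbrev toPresheafedSpace : LocallyRingedSpace.{u} ⥤ PresheafedSpace.{_, _, u} CommRingCat.{u} :=
  LocallyRingedSpace.forgetToSheafedSpace ⋙ SheafedSpace.forgetToPresheafedSpace

lemma isSectionEqualizer_map_coequalizer {X Y : LocallyRingedSpace.{u}} (f g : X ⟶ Y)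
    (U : Opens (coequalizer f g : LocallyRingedSpace.{u})) :
    IsSectionEqualizer (toPresheafedSpace.map f) (toPresheafedSpace.map g)
      (toPresheafedSpace.map (coequalizer.π f g)) U := by
  have : PreservesColimitsOfShape WalkingParallelPair
    (SheafedSpace.forgetToPresheafedSpace (C := CommRingCat.{u})) := inferInstance
  have : PreservesColimitsOfShape WalkingParallelPair toPresheafedSpace.{u} := inferInstance
  have : IsIso (coequalizerComparison f g toPresheafedSpace) := by
    rw [← PreservesCoequalizer.iso_hom]
    infer_instance
  rw [← ι_comp_coequalizerComparison f g toPresheafedSpace]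
  exact (isSectionEqualizer_coequalizer _ _ _).comp_iso

end SectionEqualizer

section CompareSections

variable {X Y : PresheafedSpace.{_, _, u} CommRingCat.{u}}

/-! Sections over open sets that are equal, but not definitionally so, are compared by `HEq`. -/

lemma heq_app_of_eq {f g : X ⟶ Y} (hfg : f = g) (U : Opens Y) (s : Y.presheaf.obj (op U)) :
    f.c.app (op U) s ≍ g.c.app (op U) s := by
  rw [hfg]

lemma heq_app_of_heq (f : X ⟶ Y) {U V : Opens Y} (hUV : U = V) {s : Y.presheaf.obj (op U)}
    {t : Y.presheaf.obj (op V)} (hst : s ≍ t) : f.c.app (op U) s ≍ f.c.app (op V) t := by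
  subst hUV
  rw [eq_of_heq hst]

lemma presheaf_map_heq {U V : Opens X} (i : U ⟶ V) (hUV : U = V) (s : X.presheaf.obj (op V)) :
    X.presheaf.map i.op s ≍ s := by
  subst hUV
  obtain rfl : i = 𝟙 _ := Subsingleton.elim _ _
  simp

lemma exists_section_heq {U V : Opens X} (hUV : U = V) (s : X.presheaf.obj (op V)) :
    ∃ t : X.presheaf.obj (op U), t ≍ s := by
  subst hUV
  exact ⟨s, HEq.rfl⟩

lemma map_obj_map_obj_of_comp_eq {Z : PresheafedSpace.{_, _, u} CommRingCat.{u}} {f : X ⟶ Y}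
    {g : Y ⟶ Z} {h : X ⟶ Z} (hfg : f ≫ g = h) (U : Opens Z) :
    (Opens.map f.base).obj ((Opens.map g.base).obj U) = (Opens.map h.base).obj U := by
  subst hfg
  rfl

variable {W Q₁ Q : PresheafedSpace.{_, _, u} CommRingCat.{u}} {f₁ : W ⟶ W} {f : X ⟶ X}
  {q₁ : W ⟶ Q₁} {q : X ⟶ Q} {w : W ⟶ X} {h : Q₁ ⟶ Q}

lemma app_eq_map_app_of_heq (hf : f₁ ≫ w = w ≫ f) (hq : q₁ ≫ h = w ≫ q) (hf₁ : f₁ ≫ q₁ = q₁)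
    (hfq : f ≫ q = q) {O : Opens Q} (hw : IsIso (w.c.app (op ((Opens.map q.base).obj O))))
    {s : Q₁.presheaf.obj (op ((Opens.map h.base).obj O))}
    {r : X.presheaf.obj (op ((Opens.map q.base).obj O))}
    (hr : w.c.app (op _) r ≍ q₁.c.app (op _) s)
    (i : (Opens.map f.base).obj ((Opens.map q.base).obj O) ⟶ (Opens.map q.base).obj O) :
    f.c.app (op _) r = X.presheaf.map i.op r := by
  have hO : (Opens.map q₁.base).obj ((Opens.map h.base).obj O) =
      (Opens.map w.base).obj ((Opens.map q.base).obj O) := map_obj_map_obj_of_comp_eq hq O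
  have hfO := map_obj_map_obj_of_comp_eq hfq O
  rw [← hfO] at hw
  refine (ConcreteCategory.bijective_of_isIso (w.c.app (op ((Opens.map f.base).obj
    ((Opens.map q.base).obj O))))).1 (eq_of_heq ?_)
  have hwf : w.c.app (op _) (f.c.app (op _) r) ≍ f₁.c.app (op _) (w.c.app (op _) r) :=
    (heq_app_of_eq hf _ r).symm
  have hfr : f₁.c.app (op _) (w.c.app (op _) r) ≍ f₁.c.app (op _) (q₁.c.app (op _) s) :=
    heq_app_of_heq f₁ hO.symm hr
  have hfs : f₁.c.app (op _) (q₁.c.app (op _) s) ≍ q₁.c.app (op _) s := heq_app_of_eq hf₁ _ s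
  have hwi : w.c.app (op _) (X.presheaf.map i.op r) ≍ w.c.app (op _) r :=
    heq_app_of_heq w hfO (presheaf_map_heq i hfO r)
  exact hwf.trans (hfr.trans (hfs.trans (hr.symm.trans hwi.symm)))

lemma isIso_app_of_isSectionEqualizer (hf : f₁ ≫ w = w ≫ f) (hq : q₁ ≫ h = w ≫ q)
    (hf₁ : f₁ ≫ q₁ = q₁) (hfq : f ≫ q = q) {O : Opens Q}
    (H₁ : IsSectionEqualizer f₁ (𝟙 W) q₁ ((Opens.map h.base).obj O))
    (H : IsSectionEqualizer f (𝟙 X) q O)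
    (hw : IsIso (w.c.app (op ((Opens.map q.base).obj O)))) : IsIso (h.c.app (op O)) := by
  have hw_bij := ConcreteCategory.bijective_of_isIso (w.c.app (op ((Opens.map q.base).obj O)))
  have hO : (Opens.map q₁.base).obj ((Opens.map h.base).obj O) =
      (Opens.map w.base).obj ((Opens.map q.base).obj O) := map_obj_map_obj_of_comp_eq hq O
  have hcomm (t) : q₁.c.app (op _) (h.c.app (op O) t) ≍ w.c.app (op _) (q.c.app (op O) t) :=
    heq_app_of_eq hq O t
  rw [ConcreteCategory.isIso_iff_bijective]
  refine ⟨fun a b hab => ?_, fun s => ?_⟩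
  · have ha := hcomm a
    rw [hab] at ha
    exact H.injective (hw_bij.1 (eq_of_heq (ha.symm.trans (hcomm b))))
  · obtain ⟨r', hr⟩ := exists_section_heq hO.symm (q₁.c.app (op _) s)
    obtain ⟨r, rfl⟩ := hw_bij.2 r'
    obtain ⟨t, rfl⟩ := H.exists_eq r fun i => app_eq_map_app_of_heq hf hq hf₁ hfq hw hr i
    exact ⟨t, H₁.injective (eq_of_heq ((hcomm t).trans hr))⟩

end CompareSections

section GeometricQuotient

/-- `q : X ⟶ Y` is, on underlying spaces, the quotient of `X` by the equivalence relation
generated by `x ∼ f x`. -/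
structure IsTopologicalQuotient {X Y : LocallyRingedSpace.{u}} (f : X ⟶ X) (q : X ⟶ Y) : Prop where
  comp_eq : f ≫ q = q
  isQuotientMap : Topology.IsQuotientMap q.base
  eqvGen_of_eq {x y : X} : q.base x = q.base y → Relation.EqvGen (fun a b => f.base a = b) x y

/-- A topological quotient whose sections are the `f`-invariant sections of `X`: up to isomorphism,
the quotient of the locally ringed space `X` by the endomorphism `f`. -/
structure IsGeometricQuotient {X Y : LocallyRingedSpace.{u}} (f : X ⟶ X) (q : X ⟶ Y) : Prop
    extends IsTopologicalQuotient f q where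
  isSectionEqualizer (U : Opens Y) :
    IsSectionEqualizer (toPresheafedSpace.map f) (𝟙 _) (toPresheafedSpace.map q) U

lemma isTopologicalQuotient_coequalizer {X : LocallyRingedSpace.{u}} (f : X ⟶ X) :
    IsTopologicalQuotient f (coequalizer.π f (𝟙 X)) := by
  have hTop := isColimitCoforkMapOfIsColimit
    (LocallyRingedSpace.forgetToSheafedSpace ⋙ SheafedSpace.forget CommRingCat) _
    (coequalizerIsCoequalizer f (𝟙 X))
  refine ⟨by rw [coequalizer.condition, Category.id_comp],
    TopCat.isQuotientMap_of_isColimit_cofork _ hTop, fun {x y} hxy => ?_⟩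
  obtain ⟨l, hl⟩ := Cofork.IsColimit.desc' (isColimitCoforkMapOfIsColimit (forget TopCat) _ hTop)
    (W := Quot fun a b => f.base a = b) (TypeCat.ofHom (Quot.mk _)) (by
      ext a
      exact (Quot.sound (r := fun a b => f.base a = b) (a := a) (b := f.base a) rfl).symm)
  have hl' (a) : l ((coequalizer.π f (𝟙 X)).base a) = Quot.mk _ a := congrArg (fun k => k a) hl
  exact Quot.eqvGen_exact (by rw [← hl', ← hl', hxy])

lemma isGeometricQuotient_coequalizer {X : LocallyRingedSpace.{u}} (f : X ⟶ X) :
    IsGeometricQuotient f (coequalizer.π f (𝟙 X)) where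
  __ := isTopologicalQuotient_coequalizer f
  isSectionEqualizer U := by
    rw [← toPresheafedSpace.map_id]
    exact isSectionEqualizer_map_coequalizer f (𝟙 X) U

namespace IsTopologicalQuotient

variable {W X Q₁ Q : LocallyRingedSpace.{u}} {f₁ : W ⟶ W} {f : X ⟶ X} {q₁ : W ⟶ Q₁} {q : X ⟶ Q}
  {w : W ⟶ X} {h : Q₁ ⟶ Q}

lemma exists_of_apply_eq (H₁ : f₁ ≫ q₁ = q₁) (H : IsTopologicalQuotient f q)
    (hf : f₁ ≫ w = w ≫ f) (hw : Function.Injective w.base)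
    (hr : f.base ⁻¹' Set.range w.base = Set.range w.base) {x : X} {a : W}
    (hx : q.base (w.base a) = q.base x) : ∃ b, w.base b = x ∧ q₁.base b = q₁.base a := by
  have hwf (b) : w.base (f₁.base b) = f.base (w.base b) := congrArg (fun k : W ⟶ X => k.base b) hf
  have hqf (b) : q₁.base (f₁.base b) = q₁.base b := congrArg (fun k : W ⟶ Q₁ => k.base b) H₁
  suffices ∀ x y, Relation.EqvGen (fun b c => f.base b = c) x y →
      ∀ c, (∃ b, w.base b = x ∧ q₁.base b = c) ↔ ∃ b, w.base b = y ∧ q₁.base b = c from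
    (this _ _ (H.eqvGen_of_eq hx) _).1 ⟨a, rfl, rfl⟩
  intro x y hxy c
  induction hxy with
  | rel x y hxy =>
    subst hxy
    constructor
    · rintro ⟨b, rfl, rfl⟩
      exact ⟨f₁.base b, hwf b, hqf b⟩
    · rintro ⟨b, hb, rfl⟩
      obtain ⟨b', rfl⟩ : x ∈ Set.range w.base := hr ▸ (⟨b, hb⟩ : f.base x ∈ Set.range w.base)
      obtain rfl : b = f₁.base b' := hw (by rw [hb, hwf])
      exact ⟨b', rfl, (hqf b').symm⟩
  | refl => rfl
  | symm _ _ _ ih => exact ih.symm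
  | trans _ _ _ _ _ ih ih' => exact ih.trans ih'

lemma preimage_image (H₁ : IsTopologicalQuotient f₁ q₁) (H : IsTopologicalQuotient f q)
    (hf : f₁ ≫ w = w ≫ f) (hq : q₁ ≫ h = w ≫ q) (hw : Function.Injective w.base)
    (hr : f.base ⁻¹' Set.range w.base = Set.range w.base) (U : Set Q₁) :
    q.base ⁻¹' (h.base '' U) = w.base '' (q₁.base ⁻¹' U) := by
  have hq' (a) : h.base (q₁.base a) = q.base (w.base a) := congrArg (fun k : W ⟶ Q => k.base a) hq
  ext x
  constructor
  · rintro ⟨b, hb, hbx⟩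
    obtain ⟨a, rfl⟩ := H₁.isQuotientMap.surjective b
    rw [hq'] at hbx
    obtain ⟨a', rfl, ha'⟩ := exists_of_apply_eq H₁.comp_eq H hf hw hr hbx
    exact ⟨a', by rwa [Set.mem_preimage, ha'], rfl⟩
  · rintro ⟨a, ha, rfl⟩
    exact ⟨_, ha, hq' a⟩

lemma isOpenEmbedding (H₁ : IsTopologicalQuotient f₁ q₁) (H : IsTopologicalQuotient f q)
    (hf : f₁ ≫ w = w ≫ f) (hq : q₁ ≫ h = w ≫ q) (hw : Topology.IsOpenEmbedding w.base)
    (hr : f.base ⁻¹' Set.range w.base = Set.range w.base) : Topology.IsOpenEmbedding h.base := by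
  have hq' (a) : h.base (q₁.base a) = q.base (w.base a) := congrArg (fun k : W ⟶ Q => k.base a) hq
  refine .of_continuous_injective_isOpenMap h.base.hom.continuous (fun b b' hbb => ?_)
    fun U hU => ?_
  · obtain ⟨a, rfl⟩ := H₁.isQuotientMap.surjective b
    obtain ⟨a', rfl⟩ := H₁.isQuotientMap.surjective b'
    rw [hq', hq'] at hbb
    obtain ⟨c, hc, hc'⟩ := exists_of_apply_eq H₁.comp_eq H hf hw.injective hr hbb
    rw [← hc', hw.injective hc]
  · rw [← H.isQuotientMap.isOpen_preimage, preimage_image H₁ H hf hq hw.injective hr]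
    exact hw.isOpenMap _ (hU.preimage q₁.base.hom.continuous)

lemma isIso_base {q : W ⟶ Q} (H₁ : IsTopologicalQuotient f₁ q₁) (H : IsTopologicalQuotient f₁ q)
    (hq : q₁ ≫ h = q) : IsIso h.base := by
  have hb : Topology.IsOpenEmbedding h.base := isOpenEmbedding (w := 𝟙 W) H₁ H (by simp)
    (by simpa using hq) Topology.IsOpenEmbedding.id (by
      ext x
      simp)
  have hsurj : Function.Surjective h.base := fun b => by
    obtain ⟨a, rfl⟩ := H.isQuotientMap.surjective b
    exact ⟨q₁.base a, congrArg (fun k : W ⟶ Q => k.base a) hq⟩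
  exact (TopCat.isIso_iff_isHomeomorph _).2
    ⟨hb.continuous, hb.isOpenMap, hb.injective, hsurj⟩

end IsTopologicalQuotient

namespace IsGeometricQuotient

variable {W X Q₁ Q : LocallyRingedSpace.{u}} {f₁ : W ⟶ W} {f : X ⟶ X} {q₁ : W ⟶ Q₁}

lemma isOpenImmersion {q : X ⟶ Q} {w : W ⟶ X} {h : Q₁ ⟶ Q} (H₁ : IsGeometricQuotient f₁ q₁)
    (H : IsGeometricQuotient f q) (hf : f₁ ≫ w = w ≫ f) (hq : q₁ ≫ h = w ≫ q)
    [hw : LocallyRingedSpace.IsOpenImmersion w]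
    (hr : f.base ⁻¹' Set.range w.base = Set.range w.base) :
    LocallyRingedSpace.IsOpenImmersion h := by
  have H₁' := H₁.toIsTopologicalQuotient
  have H' := H.toIsTopologicalQuotient
  refine ⟨H₁'.isOpenEmbedding H' hf hq hw.base_open hr, fun U => ?_⟩
  refine isIso_app_of_isSectionEqualizer (f₁ := toPresheafedSpace.map f₁)
    (f := toPresheafedSpace.map f) (q₁ := toPresheafedSpace.map q₁) (q := toPresheafedSpace.map q)
    (w := toPresheafedSpace.map w) (h := toPresheafedSpace.map h) ?_ ?_ ?_ ?_
    (H₁.isSectionEqualizer _) (H.isSectionEqualizer _) ?_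
  · rw [← Functor.map_comp, ← Functor.map_comp, hf]
  · rw [← Functor.map_comp, ← Functor.map_comp, hq]
  · rw [← Functor.map_comp, H₁.comp_eq]
  · rw [← Functor.map_comp, H.comp_eq]
  · exact PresheafedSpace.IsOpenImmersion.c_iso' (f := w.toHom) ((Opens.map q₁.base).obj U)
      (Opens.ext (H₁'.preimage_image H' hf hq hw.base_open.injective hr U.1))

lemma isIso_of_isBasis {q : W ⟶ Q} {h : Q₁ ⟶ Q} (H₁ : IsGeometricQuotient f₁ q₁)
    (H : IsTopologicalQuotient f₁ q) (hq : q₁ ≫ h = q) {ι : Type*} {B : ι → Opens Q}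
    (hB : Opens.IsBasis (Set.range B))
    (hqB : ∀ i, IsSectionEqualizer (toPresheafedSpace.map f₁) (𝟙 _) (toPresheafedSpace.map q)
      (B i)) : IsIso h := by
  have hbase : IsIso (toPresheafedSpace.map h).base := H₁.toIsTopologicalQuotient.isIso_base H hq
  let φ : Q.toSheafedSpace.sheaf ⟶ (TopCat.Sheaf.pushforward _ h.base).obj
    Q₁.toSheafedSpace.sheaf := ⟨h.c⟩
  have hφ : IsIso φ := by
    refine TopCat.Sheaf.isIso_iff_isIso_basis hB fun i => ?_
    refine isIso_app_of_isSectionEqualizer (f₁ := toPresheafedSpace.map f₁)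
      (f := toPresheafedSpace.map f₁) (q₁ := toPresheafedSpace.map q₁)
      (q := toPresheafedSpace.map q) (w := 𝟙 _) (h := toPresheafedSpace.map h) ?_ ?_ ?_ ?_
      (H₁.isSectionEqualizer _) (hqB i) ?_
    · rw [Category.comp_id, Category.id_comp]
    · rw [← Functor.map_comp, hq, Category.id_comp]
    · rw [← Functor.map_comp, H₁.comp_eq]
    · rw [← Functor.map_comp, H.comp_eq]
    · have := PresheafedSpace.c_isIso_of_iso (𝟙 (toPresheafedSpace.obj W))
      exact NatIso.isIso_app_of_isIso _ _
  have hsections : IsIso (toPresheafedSpace.map h).c :=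
    inferInstanceAs (IsIso ((TopCat.Sheaf.forget _ _).map φ))
  have : IsIso (toPresheafedSpace.map h) := PresheafedSpace.isIso_of_components _
  exact isIso_of_reflects_iso h toPresheafedSpace

end IsGeometricQuotient

end GeometricQuotient

/-! ### Quotients of schemes by finite cyclic groups -/

section FixedSubalgebra

variable {k R : Type*} [CommRing k] [CommRing R] [Algebra k R]

/-- The subalgebra of elements fixed by an endomorphism. -/
abbrev fixedSubalgebra (γ : R →ₐ[k] R) : Subalgebra k R := AlgHom.equalizer γ (AlgHom.id k R)

lemma exists_algEquiv_of_isOfFinOrder {γ : R →ₐ[k] R} (hγ : IsOfFinOrder γ) :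
    ∃ g : R ≃ₐ[k] R, IsOfFinOrder g ∧ (g : R →ₐ[k] R) = γ := by
  let e := AlgEquiv.algHomUnitsEquiv k R
  have hunit : IsOfFinOrder hγ.unit := Units.isOfFinOrder_val.1 hγ
  exact ⟨e hγ.unit, e.toMonoidHom.isOfFinOrder hunit, rfl⟩

instance smulCommClass_zpowers (g : R ≃ₐ[k] R) :
    SMulCommClass (Subgroup.zpowers g) (fixedSubalgebra (g : R →ₐ[k] R)) R := by
  refine ⟨fun h r x => ?_⟩
  have hfix : Subgroup.zpowers g ≤ MulAction.stabilizer _ (r : R) := by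
    rw [Subgroup.zpowers_le]
    exact r.2
  change h.1 ((r : R) * x) = r * h.1 x
  rw [map_mul, show h.1 (r : R) = r from hfix h.2]

instance isInvariant_zpowers (g : R ≃ₐ[k] R) :
    Algebra.IsInvariant (fixedSubalgebra (g : R →ₐ[k] R)) R (Subgroup.zpowers g) :=
  ⟨fun b hb => ⟨⟨b, hb ⟨g, Subgroup.mem_zpowers g⟩⟩, rfl⟩⟩

lemma isIntegral_fixedSubalgebra {γ : R →ₐ[k] R} (hγ : IsOfFinOrder γ) :
    Algebra.IsIntegral (fixedSubalgebra γ) R := by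
  obtain ⟨g, hg, rfl⟩ := exists_algEquiv_of_isOfFinOrder hγ
  have : Finite (Subgroup.zpowers g) := hg.finite_zpowers
  exact Algebra.IsInvariant.isIntegral _ R (Subgroup.zpowers g)

lemma finiteType_fixedSubalgebra [IsNoetherianRing k] [Algebra.FiniteType k R] {γ : R →ₐ[k] R}
    (hγ : IsOfFinOrder γ) : Algebra.FiniteType k (fixedSubalgebra γ) := by
  have := isIntegral_fixedSubalgebra hγ
  have : Algebra.FiniteType (fixedSubalgebra γ) R := .of_restrictScalars_finiteType k _ _
  have : Module.Finite (fixedSubalgebra γ) R := Algebra.IsIntegral.finite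
  exact ⟨fg_of_fg_of_fg k (fixedSubalgebra γ) R Algebra.FiniteType.out Module.Finite.fg_top
    Subtype.val_injective⟩

lemma exists_comap_pow_eq {γ : R →ₐ[k] R} (hγ : IsOfFinOrder γ) {x y : PrimeSpectrum R}
    (hxy : PrimeSpectrum.comap (algebraMap (fixedSubalgebra γ) R) x =
      PrimeSpectrum.comap (algebraMap (fixedSubalgebra γ) R) y) :
    ∃ m : ℕ, PrimeSpectrum.comap (γ ^ m).toRingHom x = y := by
  obtain ⟨g, hg, rfl⟩ := exists_algEquiv_of_isOfFinOrder hγ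
  have : Finite (Subgroup.zpowers g) := hg.finite_zpowers
  obtain ⟨h, hh⟩ := Algebra.IsInvariant.exists_smul_of_under_eq
    (fixedSubalgebra (g : R →ₐ[k] R)) R (Subgroup.zpowers g) x.asIdeal y.asIdeal
    (congrArg PrimeSpectrum.asIdeal hxy)
  obtain ⟨m, hm⟩ := hg.mem_powers_iff_mem_zpowers.2 (h⁻¹).2
  have hgm (r : R) : (h⁻¹).1 r = ((g : R →ₐ[k] R) ^ m) r := by
    rw [← hm]
    exact congrArg (fun φ : R →ₐ[k] R => φ r) (map_pow (AlgEquiv.toAlgHomHom k R) g m)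
  refine ⟨m, PrimeSpectrum.ext (Ideal.ext fun r => ?_)⟩
  rw [hh, Ideal.mem_pointwise_smul_iff_inv_smul_mem]
  change _ ↔ (h⁻¹).1 r ∈ x.asIdeal
  rw [hgm]
  rfl

variable {γ : R →ₐ[k] R} {A₀ A₁ : Type*} [CommRing A₀] [CommRing A₁]
  [Algebra (fixedSubalgebra γ) A₀] [Algebra R A₁] {q : A₀ →+* A₁}

lemma injective_of_isLocalizationAway_fixedSubalgebra (a : fixedSubalgebra γ)
    [IsLocalization.Away a A₀] [IsLocalization.Away (a : R) A₁]
    (hq : ∀ r, q (algebraMap (fixedSubalgebra γ) A₀ r) = algebraMap R A₁ r) :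
    Function.Injective q := by
  rw [injective_iff_map_eq_zero]
  intro t ht
  obtain ⟨n, r, hr⟩ := IsLocalization.Away.surj a t
  have hr₁ : algebraMap R A₁ r = algebraMap R A₁ 0 := by
    rw [← hq, ← hr, map_mul, ht, zero_mul, map_zero]
  obtain ⟨m, hm⟩ := IsLocalization.Away.exists_of_eq (a : R) hr₁
  have har : a ^ m * r = 0 := Subtype.ext (by simpa using hm)
  have ha : IsUnit (algebraMap (fixedSubalgebra γ) A₀ a ^ (n + m)) :=
    (IsLocalization.Away.algebraMap_isUnit a).pow _
  refine ha.mul_left_eq_zero.1 ?_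
  rw [pow_add, ← mul_assoc, hr, ← map_pow, ← map_mul, mul_comm r, har, map_zero]

lemma exists_eq_of_isLocalizationAway_fixedSubalgebra (a : fixedSubalgebra γ)
    [IsLocalization.Away a A₀] [IsLocalization.Away (a : R) A₁]
    {A₂ : Type*} [CommRing A₂] [Algebra R A₂] [IsLocalization.Away (a : R) A₂] {f i : A₁ →+* A₂}
    (hq : ∀ r, q (algebraMap (fixedSubalgebra γ) A₀ r) = algebraMap R A₁ r)
    (hf : ∀ r, f (algebraMap R A₁ r) = algebraMap R A₂ (γ r))
    (hi : ∀ r, i (algebraMap R A₁ r) = algebraMap R A₂ r) {s : A₁} (hs : f s = i s) :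
    ∃ t, q t = s := by
  have haγ : γ a = a := a.2
  obtain ⟨n, r, hr⟩ := IsLocalization.Away.surj (a : R) s
  have hr₂ : algebraMap R A₂ (γ r) = algebraMap R A₂ r := by
    rw [← hf, ← hi, ← hr, map_mul, map_mul, hs, map_pow, map_pow, hf, hi, haγ]
  obtain ⟨m, hm⟩ := IsLocalization.Away.exists_of_eq (a : R) hr₂
  let b : fixedSubalgebra γ := ⟨a ^ m * r, by
    change γ (a ^ m * r) = a ^ m * r
    rw [map_mul, map_pow, haγ, hm]⟩
  obtain ⟨v, hv⟩ := ((IsLocalization.Away.algebraMap_isUnit (S := A₀) a).pow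
    (n + m)).exists_left_inv
  have hqv := congrArg q hv
  rw [map_mul, map_one, map_pow, hq] at hqv
  refine ⟨algebraMap _ A₀ b * v,
    ((IsLocalization.Away.algebraMap_isUnit (S := A₁) (a : R)).pow (n + m)).mul_right_cancel ?_⟩
  rw [map_mul, mul_assoc, hqv, mul_one, hq, pow_add, ← mul_assoc, hr]
  change algebraMap R A₁ (a ^ m * r) = _
  rw [map_mul, map_pow, mul_comm]

end FixedSubalgebra

section SpecQuotient

/-- The morphism of locally ringed spaces `Spec S' ⟶ Spec S` given by a ring homomorphism. -/
abbrev specHom {S S' : Type u} [CommRing S] [CommRing S'] (φ : S →+* S') :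
    (Spec (.of S')).toLocallyRingedSpace ⟶ (Spec (.of S)).toLocallyRingedSpace :=
  (Spec.map (CommRingCat.ofHom φ)).toLRSHom

lemma specHom_comp {A B C : Type u} [CommRing A] [CommRing B] [CommRing C] (φ : A →+* B)
    (ψ : B →+* C) : specHom ψ ≫ specHom φ = specHom (ψ.comp φ) := by
  change _ = (Spec.map (CommRingCat.ofHom φ ≫ CommRingCat.ofHom ψ)).toLRSHom
  rw [Spec.map_comp]
  rfl

/-- The algebra structure on the sections over an open subset of `Spec S`, for a plain ring `S`
in place of an object of `CommRingCat`. -/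
abbrev specSectionsAlgebra (S : Type u) [CommRing S] (U : Opens (PrimeSpectrum S)) :
    Algebra S Γ(Spec (.of S), U) :=
  StructureSheaf.openAlgebra S (op U)

attribute [local instance] specSectionsAlgebra

lemma specHom_app_algebraMap {S S' : Type u} [CommRing S] [CommRing S'] (φ : S →+* S')
    (U : Opens (PrimeSpectrum S)) (s : S) :
    ((toPresheafedSpace.map (specHom φ)).c.app (op U)).hom (algebraMap S Γ(Spec (.of S), U) s) =
      algebraMap S'
        Γ(Spec (.of S'), Opens.comap ⟨_, PrimeSpectrum.continuous_comap φ⟩ U) (φ s) :=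
  congrArg (fun k => k.hom s) (StructureSheaf.toOpen_comp_comap φ U)

lemma isLocalizationAway_basicOpen {S : Type u} [CommRing S] (a : S) :
    IsLocalization.Away a Γ(Spec (.of S), PrimeSpectrum.basicOpen a) :=
  StructureSheaf.IsLocalization.to_basicOpen S a

variable {k R : Type u} [CommRing k] [CommRing R] [Algebra k R]

lemma isSectionEqualizer_fixedSubalgebra (γ : R →ₐ[k] R) (a : fixedSubalgebra γ) :
    IsSectionEqualizer (toPresheafedSpace.map (specHom γ.toRingHom)) (𝟙 _)
      (toPresheafedSpace.map (specHom (fixedSubalgebra γ).val.toRingHom))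
      (PrimeSpectrum.basicOpen a) := by
  have hγa : PrimeSpectrum.basicOpen (γ a) = PrimeSpectrum.basicOpen (a : R) := by
    rw [show γ a = a from a.2]
  have := isLocalizationAway_basicOpen a
  have := isLocalizationAway_basicOpen (a : R)
  have : IsLocalization.Away (a : R) Γ(Spec (.of R), PrimeSpectrum.basicOpen (γ a)) := by
    rw [show γ a = a from a.2]
    exact isLocalizationAway_basicOpen (a : R)
  let q : Γ(Spec (.of (fixedSubalgebra γ)), PrimeSpectrum.basicOpen a) →+*
      Γ(Spec (.of R), PrimeSpectrum.basicOpen (a : R)) :=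
    ((toPresheafedSpace.map (specHom (fixedSubalgebra γ).val.toRingHom)).c.app (op _)).hom
  let f : Γ(Spec (.of R), PrimeSpectrum.basicOpen (a : R)) →+*
      Γ(Spec (.of R), PrimeSpectrum.basicOpen (γ a)) :=
    ((toPresheafedSpace.map (specHom γ.toRingHom)).c.app (op _)).hom
  let i : Γ(Spec (.of R), PrimeSpectrum.basicOpen (a : R)) →+*
      Γ(Spec (.of R), PrimeSpectrum.basicOpen (γ a)) :=
    ((Spec (.of R)).presheaf.map (eqToHom hγa).op).hom
  have hq (r : fixedSubalgebra γ) : q (algebraMap _ _ r) = algebraMap R _ (r : R) :=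
    specHom_app_algebraMap (fixedSubalgebra γ).val.toRingHom _ r
  have hf (r : R) : f (algebraMap R _ r) = algebraMap R _ (γ r) :=
    specHom_app_algebraMap γ.toRingHom _ r
  have hi (r : R) : i (algebraMap R _ r) = algebraMap R _ r :=
    congrArg (fun k => k.hom r) (StructureSheaf.algebraMap_self_map R _ _ (eqToHom hγa).op)
  have hinj := injective_of_isLocalizationAway_fixedSubalgebra a hq
  have hsurj (s) := exists_eq_of_isLocalizationAway_fixedSubalgebra a (s := s) hq hf hi
  exact ⟨hinj, fun s hs => hsurj s (hs (eqToHom hγa))⟩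

lemma isTopologicalQuotient_fixedSubalgebra {γ : R →ₐ[k] R} (hγ : IsOfFinOrder γ) :
    IsTopologicalQuotient (specHom γ.toRingHom) (specHom (fixedSubalgebra γ).val.toRingHom) := by
  have hint : (algebraMap (fixedSubalgebra γ) R).IsIntegral :=
    (isIntegral_fixedSubalgebra hγ).isIntegral
  refine ⟨?_, ?_, fun {x y} hxy => ?_⟩
  · rw [specHom_comp]
    congr 1
    ext r
    exact r.2
  · exact (PrimeSpectrum.isClosedMap_comap_of_isIntegral _ hint).isQuotientMap
      (PrimeSpectrum.continuous_comap _) (hint.comap_surjective Subtype.val_injective)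
  · obtain ⟨m, rfl⟩ := exists_comap_pow_eq hγ hxy
    clear hxy
    induction m with
    | zero => exact .refl _
    | succ m ih =>
      refine ih.trans _ _ _ (.rel _ _ ?_)
      rw [pow_succ]
      rfl

end SpecQuotient

section Normalization

lemma isIntegral_iff_of_ringEquiv {A B R L : Type*} [CommRing A] [CommRing B] [CommRing R]
    [CommRing L] [Algebra A B] [Algebra R L] (ρ : A ≃+* R) (τ : B ≃+* L)
    (h : ∀ a, τ (algebraMap A B a) = algebraMap R L (ρ a)) (z : B) :
    _root_.IsIntegral A z ↔ _root_.IsIntegral R (τ z) := by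
  refine ⟨fun hz => hz.map_of_comp_eq (ρ : A →+* R) (τ : B →+* L)
    (RingHom.ext fun a => (h a).symm), fun hz => ?_⟩
  rw [← τ.symm_apply_apply z]
  refine hz.map_of_comp_eq (ρ.symm : R →+* A) (τ.symm : L →+* B) (RingHom.ext fun r => ?_)
  rw [RingHom.comp_apply, RingHom.comp_apply, RingEquiv.coe_toRingHom, RingEquiv.coe_toRingHom,
    ← ρ.apply_symm_apply r, ← h, τ.symm_apply_apply, ρ.apply_symm_apply]

lemma exists_isIso_specMap_fromSpec {R : CommRingCat.{u}} {Y : Scheme.{u}} (c : Spec R ⟶ Y)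
    [IsOpenImmersion c] {U : Y.Opens} (hU : IsAffineOpen U) (hcU : c.opensRange = U) :
    ∃ ρ : Γ(Y, U) ⟶ R, IsIso ρ ∧ Spec.map ρ ≫ hU.fromSpec = c := by
  have hrange : Set.range c = Set.range hU.fromSpec := by
    rw [hU.range_fromSpec, ← hcU, Scheme.Hom.coe_opensRange]
  let e := IsOpenImmersion.isoOfRangeEq c hU.fromSpec hrange
  refine ⟨Spec.preimage e.hom, ?_, ?_⟩
  · have : IsIso (Spec.map (Spec.preimage e.hom)) := by rw [Spec.map_preimage]; infer_instance
    exact (ConcreteCategory.isIso_iff_bijective _).2 (isIso_SpecMap_iff.1 this)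
  · rw [Spec.map_preimage, IsOpenImmersion.isoOfRangeEq_hom_fac]

lemma fromSpec_toNormalization {X Y : Scheme.{u}} (f : X ⟶ Y) [QuasiCompact f] [QuasiSeparated f]
    {U : Y.Opens} (hU : IsAffineOpen U) (hW : IsAffineOpen (f ⁻¹ᵁ U)) :
    letI := (f.app U).hom.toAlgebra
    hW.fromSpec ≫ f.toNormalization =
      Spec.map (CommRingCat.ofHom (integralClosure Γ(Y, U) Γ(X, f ⁻¹ᵁ U)).val.toRingHom) ≫
        Spec.map (f.normalizationObjIso hU).hom ≫
          (hU.preimage f.fromNormalization).fromSpec := by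
  rw [← Spec.map_comp_assoc, f.normalizationObjIso_hom_val hU,
    (hU.preimage f.fromNormalization).SpecMap_appLE_fromSpec f.toNormalization hW]

lemma normalizationObjIso_fromSpec {X Y : Scheme.{u}} (f : X ⟶ Y) [QuasiCompact f]
    [QuasiSeparated f] {U : Y.Opens} (hU : IsAffineOpen U) :
    letI := (f.app U).hom.toAlgebra
    Spec.map (f.normalizationObjIso hU).hom ≫
        (hU.preimage f.fromNormalization).fromSpec ≫ f.fromNormalization =
      Spec.map (CommRingCat.ofHom
        (algebraMap Γ(Y, U) (integralClosure Γ(Y, U) Γ(X, f ⁻¹ᵁ U)))) ≫ hU.fromSpec := by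
  rw [← hU.SpecMap_appLE_fromSpec f.fromNormalization (hU.preimage _) le_rfl,
    ← Scheme.Hom.app_eq_appLE, f.fromNormalization_app hU, ← Spec.map_comp_assoc, Category.assoc,
    Iso.inv_hom_id, Category.comp_id]

lemma exists_isIso_app_opensRange {R L : CommRingCat.{u}} {Y : Scheme.{u}} (φ : R ⟶ L)
    (c : Spec R ⟶ Y) [IsOpenImmersion c] {f : Spec L ⟶ Y} (hf : f = Spec.map φ ≫ c)
    (hW : IsAffineOpen (f ⁻¹ᵁ c.opensRange)) :
    ∃ (ρ : Γ(Y, c.opensRange) ⟶ R) (τ : Γ(Spec L, f ⁻¹ᵁ c.opensRange) ⟶ L),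
      IsIso ρ ∧ IsIso τ ∧ Spec.map ρ ≫ (isAffineOpen_opensRange c).fromSpec = c ∧
        Spec.map τ ≫ hW.fromSpec = 𝟙 (Spec L) ∧ f.app c.opensRange ≫ τ = ρ ≫ φ := by
  have hU : IsAffineOpen c.opensRange := isAffineOpen_opensRange c
  have hfU : (𝟙 (Spec L) : Spec L ⟶ Spec L).opensRange = f ⁻¹ᵁ c.opensRange := by
    rw [hf, Scheme.Hom.comp_preimage, Scheme.Hom.preimage_opensRange,
      Scheme.Hom.opensRange_of_isIso]
    rfl
  obtain ⟨ρ, hρ, hρc⟩ := exists_isIso_specMap_fromSpec c hU rfl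
  obtain ⟨τ, hτ, hτ1⟩ := exists_isIso_specMap_fromSpec (𝟙 (Spec L)) hW hfU
  refine ⟨ρ, τ, hρ, hτ, hρc, hτ1, Spec.map_injective ?_⟩
  rw [← cancel_mono hU.fromSpec, Spec.map_comp_assoc, Spec.map_comp_assoc, hρc, ← hf,
    Scheme.Hom.app_eq_appLE, hU.SpecMap_appLE_fromSpec f hW, reassoc_of% hτ1]

lemma exists_integralClosure_chart {R L : Type u} [CommRing R] [CommRing L] [Algebra R L]
    {Y : Scheme.{u}} (c : Spec (.of R) ⟶ Y) [IsOpenImmersion c] (f : Spec (.of L) ⟶ Y)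
    [QuasiCompact f] [QuasiSeparated f]
    (hf : f = Spec.map (CommRingCat.ofHom (algebraMap R L)) ≫ c) :
    ∃ (κ : Spec (.of (integralClosure R L)) ⟶ f.normalization) (_ : IsOpenImmersion κ),
      Spec.map (CommRingCat.ofHom (algebraMap (integralClosure R L) L)) ≫ κ = f.toNormalization ∧
      κ ≫ f.fromNormalization =
        Spec.map (CommRingCat.ofHom (algebraMap R (integralClosure R L))) ≫ c ∧
      κ.opensRange = f.fromNormalization ⁻¹ᵁ c.opensRange := by
  have hU : IsAffineOpen c.opensRange := isAffineOpen_opensRange c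
  have hW : IsAffineOpen (f ⁻¹ᵁ c.opensRange) := by
    rw [hf, Scheme.Hom.comp_preimage, Scheme.Hom.preimage_opensRange]
    exact isAffineOpen_top _
  obtain ⟨ρ, τ, hρ, hτ, hρc, hτ1, hcomp⟩ := exists_isIso_app_opensRange _ c hf hW
  have hcomp_apply := fun a => congrArg (fun k => k.hom a) hcomp
  let := (f.app c.opensRange).hom.toAlgebra
  let e : integralClosure Γ(Y, c.opensRange) Γ(Spec (.of L), f ⁻¹ᵁ c.opensRange) ≃+*
      integralClosure R L :=
    (asIso τ).commRingCatIsoToRingEquiv.restrict _ _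
      (isIntegral_iff_of_ringEquiv (asIso ρ).commRingCatIsoToRingEquiv _ hcomp_apply)
  have he : IsIso (CommRingCat.ofHom e.toRingHom) :=
    (ConcreteCategory.isIso_iff_bijective _).2 e.bijective
  have hρe : CommRingCat.ofHom (algebraMap Γ(Y, c.opensRange) (integralClosure
        Γ(Y, c.opensRange) Γ(Spec (.of L), f ⁻¹ᵁ c.opensRange))) ≫ CommRingCat.ofHom e.toRingHom =
      ρ ≫ CommRingCat.ofHom (algebraMap R (integralClosure R L)) :=
    CommRingCat.hom_ext (RingHom.ext fun a => Subtype.ext (hcomp_apply a))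
  refine ⟨Spec.map (CommRingCat.ofHom e.toRingHom) ≫ Spec.map (f.normalizationObjIso hU).hom ≫
    (hU.preimage f.fromNormalization).fromSpec, inferInstance, ?_, ?_, ?_⟩
  · rw [← Category.id_comp f.toNormalization, ← hτ1, Category.assoc,
      fromSpec_toNormalization f hU hW, ← Spec.map_comp_assoc (CommRingCat.ofHom e.toRingHom),
      ← Spec.map_comp_assoc _ τ]
    rfl
  · rw [Category.assoc, Category.assoc, normalizationObjIso_fromSpec f hU,
      ← Spec.map_comp_assoc, hρe, Spec.map_comp_assoc, hρc]
  · rw [Scheme.Hom.opensRange_comp_of_isIso, Scheme.Hom.opensRange_comp_of_isIso,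
      IsAffineOpen.opensRange_fromSpec]

end Normalization

/-! ### Affine models of function fields -/

section HasFractions

variable {k F : Type*} [CommRing k] [Field F] [Algebra k F]

/-- `F` is the field of fractions of its subalgebra `B`, stated elementwise to avoid carrying the
`Algebra B F` structure of `IsFractionRing`. -/
def HasFractions (B : Subalgebra k F) : Prop := ∀ z : F, ∃ b ∈ B, b ≠ 0 ∧ b * z ∈ B

lemma HasFractions.exists_denom {B : Subalgebra k F} (hB : HasFractions B) (S : Finset F) :
    ∃ b ∈ B, b ≠ 0 ∧ ∀ z ∈ S, b * z ∈ B := by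
  classical
  induction S using Finset.induction_on with
  | empty => exact ⟨1, B.one_mem, one_ne_zero, by simp⟩
  | insert z S _ ih =>
    obtain ⟨b, hb, hb0, hS⟩ := ih
    obtain ⟨c, hc, hc0, hz⟩ := hB z
    refine ⟨b * c, B.mul_mem hb hc, mul_ne_zero hb0 hc0, fun w hw => ?_⟩
    rcases Finset.mem_insert.1 hw with rfl | hw
    · rw [mul_assoc]; exact B.mul_mem hb hz
    · rw [mul_right_comm]; exact B.mul_mem (hS w hw) hc

end HasFractions

section CommonLocalization

variable {F : Type} [Field F] [Algebra ℂ F]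

lemma HasFractions.exists_le_denomAlg {B B' : Subalgebra ℂ F} (hB : HasFractions B) (hB' : B'.FG) :
    ∃ c, ∃ hc : c ∈ B, c ≠ 0 ∧ B' ≤ denomAlg hc := by
  obtain ⟨S, hS⟩ := hB'
  obtain ⟨c, hc, hc0, h⟩ := hB.exists_denom S
  refine ⟨c, hc, hc0, ?_⟩
  rw [← hS]
  exact Algebra.adjoin_le fun z hz => ⟨1, by simpa using h z hz⟩

lemma exists_isLocAt_sup_sup_adjoin_inv {B B' : Subalgebra ℂ F} {c d : F}
    (hc : c ∈ B) (hc0 : c ≠ 0)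
    (h : B' ≤ denomAlg hc) (hd : d ∈ B') (hd0 : d ≠ 0) :
    ∃ f, IsLocAt f B (B ⊔ B' ⊔ Algebra.adjoin ℂ {c⁻¹, d⁻¹}) := by
  obtain ⟨m, hm⟩ := h hd
  have hf : c * (c ^ m * d) ∈ B := B.mul_mem hc hm
  refine ⟨c * (c ^ m * d), ?_, hf, by positivity, ?_, ?_⟩
  · exact le_sup_left.trans le_sup_left
  · have hle : Algebra.adjoin ℂ {c⁻¹, d⁻¹} ≤ B ⊔ B' ⊔ Algebra.adjoin ℂ {c⁻¹, d⁻¹} := le_sup_right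
    have h1 := hle (Algebra.subset_adjoin (show c⁻¹ ∈ ({c⁻¹, d⁻¹} : Set F) by simp))
    have h2 := hle (Algebra.subset_adjoin (show d⁻¹ ∈ ({c⁻¹, d⁻¹} : Set F) by simp))
    rw [mul_inv, mul_inv, ← inv_pow]
    exact mul_mem h1 (mul_mem (pow_mem h1 m) h2)
  · suffices B ⊔ B' ⊔ Algebra.adjoin ℂ {c⁻¹, d⁻¹} ≤ denomAlg hf from fun b hb => this hb
    refine sup_le (sup_le (fun b hb => ⟨0, by simpa using hb⟩) fun b hb => ?_)
      (Algebra.adjoin_le ?_)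
    · obtain ⟨n, hn⟩ := h hb
      refine ⟨n, ?_⟩
      rw [mul_pow, mul_right_comm]
      exact mul_mem hn (pow_mem hm n)
    · rintro _ (rfl | rfl)
      · exact ⟨1, by rwa [pow_one, mul_right_comm, mul_inv_cancel₀ hc0, one_mul]⟩
      · refine ⟨1, ?_⟩
        rw [pow_one, mul_assoc, mul_assoc, mul_inv_cancel₀ hd0, mul_one]
        exact mul_mem hc (pow_mem hc m)

lemma exists_common_localization {B B' : Subalgebra ℂ F} (hB : HasFractions B)
    (hB' : HasFractions B') (hfg : B.FG) (hfg' : B'.FG) :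
    ∃ (T : Subalgebra ℂ F) (f f' : F), IsLocAt f B T ∧ IsLocAt f' B' T := by
  obtain ⟨c, hc, hc0, h⟩ := hB.exists_le_denomAlg hfg'
  obtain ⟨d, hd, hd0, h'⟩ := hB'.exists_le_denomAlg hfg
  obtain ⟨f, hf⟩ := exists_isLocAt_sup_sup_adjoin_inv hc hc0 h hd hd0
  obtain ⟨f', hf'⟩ := exists_isLocAt_sup_sup_adjoin_inv hd hd0 h' hc hc0
  rw [sup_comm B', Set.pair_comm] at hf'
  exact ⟨_, f, f', hf, hf'⟩

end CommonLocalization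

section OpenImmersion

lemma isIso_specHom_ringEquiv {A B : Type u} [CommRing A] [CommRing B] (e : A ≃+* B) :
    IsIso (specHom e.toRingHom) :=
  inferInstanceAs (IsIso (Spec.map e.toCommRingCatIso.hom).toLRSHom)

lemma exists_iso_restrict {X T : LocallyRingedSpace.{u}} (i : T ⟶ X)
    [LocallyRingedSpace.IsOpenImmersion i] :
    ∃ (U : Opens X), (U : Set X) = Set.range i.base ∧
      ∃ e : T ≅ X.restrict U.isOpenEmbedding, e.hom ≫ X.ofRestrict U.isOpenEmbedding = i := by
  have hi : Topology.IsOpenEmbedding i.base :=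
    PresheafedSpace.IsOpenImmersion.base_open (f := i.toHom)
  let U : Opens X := ⟨Set.range i.base, hi.isOpen_range⟩
  let r := X.ofRestrict U.isOpenEmbedding
  have hr : Set.range r.base = Set.range i.base := Subtype.range_val
  refine ⟨U, rfl, ⟨LocallyRingedSpace.IsOpenImmersion.lift r i hr.ge,
    LocallyRingedSpace.IsOpenImmersion.lift i r hr.le, ?_, ?_⟩, ?_⟩
  · rw [← cancel_mono i, Category.assoc, LocallyRingedSpace.IsOpenImmersion.lift_fac,
      LocallyRingedSpace.IsOpenImmersion.lift_fac, Category.id_comp]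
  · rw [← cancel_mono r, Category.assoc, LocallyRingedSpace.IsOpenImmersion.lift_fac,
      LocallyRingedSpace.IsOpenImmersion.lift_fac, Category.id_comp]
  · exact LocallyRingedSpace.IsOpenImmersion.lift_fac _ _ hr.ge

variable {L : Type} [Field L] [Algebra ℂ L] {f : L} {A B : Subalgebra ℂ L}

lemma IsLocAt.isOpenImmersion (h : IsLocAt f A B) :
    LocallyRingedSpace.IsOpenImmersion (specHom (Subalgebra.inclusion h.le).toRingHom) := by
  let := (Subalgebra.inclusion h.le).toRingHom.toAlgebra
  have := h.isLocalization
  exact IsOpenImmersion.of_isLocalization (R := A) (S := B) (⟨f, h.mem⟩ : A)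

lemma IsLocAt.denseRange (h : IsLocAt f A B) :
    DenseRange (specHom (Subalgebra.inclusion h.le).toRingHom).base := by
  have hopen : IsOpen (Set.range (PrimeSpectrum.comap (Subalgebra.inclusion h.le).toRingHom)) := by
    rw [h.range_comap]
    exact (PrimeSpectrum.basicOpen (⟨f, h.mem⟩ : A)).2
  exact hopen.dense (Set.range_nonempty _)

end OpenImmersion

section Model

/-- The structure morphism of `Spec B` for a `ℂ`-algebra `B`. -/
abbrev specStr (B : Type) [CommRing B] [Algebra ℂ B] :
    (Spec (.of B)).toLocallyRingedSpace ⟶ (Spec (.of ℂ)).toLocallyRingedSpace :=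
  specHom (algebraMap ℂ B)

/-- The space `X` over `ℂ` contains, as a dense open subspace over `ℂ`, the spectrum of a finitely
generated algebra with fraction field `L`. -/
def HasModel {X : LocallyRingedSpace.{0}} (s : X ⟶ (Spec (.of ℂ)).toLocallyRingedSpace)
    (L : Type) [Field L] [Algebra ℂ L] : Prop :=
  ∃ (B : Subalgebra ℂ L) (κ : (Spec (.of B)).toLocallyRingedSpace ⟶ X), B.FG ∧ HasFractions B ∧
    LocallyRingedSpace.IsOpenImmersion κ ∧ DenseRange κ.base ∧ κ ≫ s = specStr B

variable {X Y : LocallyRingedSpace.{0}} {sX : X ⟶ (Spec (.of ℂ)).toLocallyRingedSpace}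
  {sY : Y ⟶ (Spec (.of ℂ)).toLocallyRingedSpace}
  {L : Type} [Field L] [Algebra ℂ L]

lemma hasModel_of_algHom {B : Type} [CommRing B] [Algebra ℂ B] [Algebra.FiniteType ℂ B]
    (ψ : B →ₐ[ℂ] L) (hψ : Function.Injective ψ) (hfr : ∀ z, ∃ a b, ψ b ≠ 0 ∧ ψ b * z = ψ a)
    (κ : (Spec (.of B)).toLocallyRingedSpace ⟶ X) [LocallyRingedSpace.IsOpenImmersion κ]
    (hd : DenseRange κ.base) (hs : κ ≫ sX = specStr B) : HasModel sX L := by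
  let e : B ≃ₐ[ℂ] ψ.range := AlgEquiv.ofInjective ψ hψ
  have := isIso_specHom_ringEquiv e.toRingEquiv
  refine ⟨ψ.range, specHom e.toRingEquiv.toRingHom ≫ κ, ?_, ?_, inferInstance, ?_, ?_⟩
  · rw [← Algebra.map_top]
    exact Subalgebra.FG.map _ Algebra.FiniteType.out
  · intro z
    obtain ⟨a, b, hb, h⟩ := hfr z
    exact ⟨ψ b, ⟨b, rfl⟩, hb, ⟨a, h.symm⟩⟩
  · rw [LocallyRingedSpace.comp_base, TopCat.coe_comp]
    refine hd.comp ?_ κ.base.hom.continuous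
    exact (TopCat.homeoOfIso (LocallyRingedSpace.forgetToTop.mapIso
      (asIso (specHom e.toRingEquiv.toRingHom)))).surjective.denseRange
  · rw [Category.assoc, hs, specHom_comp]
    congr 1
    exact e.toAlgHom.comp_algebraMap

lemma HasModel.exists_span (hX : HasModel sX L) (hY : HasModel sY L) :
    ∃ (T : Subalgebra ℂ L) (i : (Spec (.of T)).toLocallyRingedSpace ⟶ X)
      (j : (Spec (.of T)).toLocallyRingedSpace ⟶ Y),
      LocallyRingedSpace.IsOpenImmersion i ∧ LocallyRingedSpace.IsOpenImmersion j ∧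
      DenseRange i.base ∧ DenseRange j.base ∧ i ≫ sX = specStr T ∧ j ≫ sY = specStr T := by
  obtain ⟨B, κ, hfg, hfr, hκ, hd, hs⟩ := hX
  obtain ⟨B', κ', hfg', hfr', hκ', hd', hs'⟩ := hY
  obtain ⟨T, f, f', h, h'⟩ := exists_common_localization hfr hfr' hfg hfg'
  have := h.isOpenImmersion
  have := h'.isOpenImmersion
  refine ⟨T, specHom (Subalgebra.inclusion h.le).toRingHom ≫ κ,
    specHom (Subalgebra.inclusion h'.le).toRingHom ≫ κ', inferInstance, inferInstance,
    ?_, ?_, ?_, ?_⟩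
  · rw [LocallyRingedSpace.comp_base, TopCat.coe_comp]
    exact hd.comp h.denseRange κ.base.hom.continuous
  · rw [LocallyRingedSpace.comp_base, TopCat.coe_comp]
    exact hd'.comp h'.denseRange κ'.base.hom.continuous
  · rw [Category.assoc, hs, specHom_comp]; rfl
  · rw [Category.assoc, hs', specHom_comp]; rfl

lemma HasModel.lrsBirationalOver (hX : HasModel sX L) (hY : HasModel sY L) :
    LRSBirationalOver sX sY := by
  obtain ⟨T, i, j, hi, hj, hdi, hdj, hsi, hsj⟩ := hX.exists_span hY
  obtain ⟨U, hU, e, he⟩ := exists_iso_restrict i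
  obtain ⟨V, hV, e', he'⟩ := exists_iso_restrict j
  refine ⟨U, V, by rw [hU]; exact hdi, by rw [hV]; exact hdj, e.symm ≪≫ e', ?_⟩
  rw [Iso.trans_hom, Category.assoc, reassoc_of% he', hsj, Iso.symm_hom, Iso.inv_comp_eq,
    reassoc_of% he, hsi]

lemma HasModel.birationalOver {X Y : Scheme.{0}} {sX : X ⟶ Spec (.of ℂ)} {sY : Y ⟶ Spec (.of ℂ)}
    (hX : HasModel sX.toLRSHom L) (hY : HasModel sY.toLRSHom L) :
    Scheme.BirationalOver sX sY := by
  obtain ⟨T, i, j, hi, hj, hdi, hdj, hsi, hsj⟩ := hX.exists_span hY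
  let i' : Spec (.of T) ⟶ X := ⟨i⟩
  let j' : Spec (.of T) ⟶ Y := ⟨j⟩
  have : IsOpenImmersion i' := hi
  have : IsOpenImmersion j' := hj
  have : IsDominant i' := ⟨hdi⟩
  have : IsDominant j' := ⟨hdj⟩
  have h1 : i' ≫ sX = Spec.map (CommRingCat.ofHom (algebraMap ℂ T)) := Scheme.Hom.ext' hsi
  have h2 : j' ≫ sY = Spec.map (CommRingCat.ofHom (algebraMap ℂ T)) := Scheme.Hom.ext' hsj
  exact (Scheme.Hom.birationalOver i' _ _ h1).symm.trans (Scheme.Hom.birationalOver j' _ _ h2)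

end Model

/-! ### Models of Kummer coverings -/

section AffinePlane

/-- The polynomials among the rational functions. -/
abbrev polyAlg (m : ℕ) : Subalgebra ℂ (RatField m) :=
  (IsScalarTower.toAlgHom ℂ (MvPolynomial (Fin m) ℂ) (RatField m)).range

/-- The identification of `polyAlg m` with the polynomial ring. -/
def polyAlgEquiv (m : ℕ) : MvPolynomial (Fin m) ℂ ≃ₐ[ℂ] polyAlg m :=
  AlgEquiv.ofInjective _ (IsFractionRing.injective (MvPolynomial (Fin m) ℂ) (RatField m))

instance (m : ℕ) : IsIntegrallyClosed (polyAlg m) :=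
  IsIntegrallyClosed.of_equiv (polyAlgEquiv m).toRingEquiv

instance (m : ℕ) : Algebra.FiniteType ℂ (polyAlg m) :=
  Algebra.FiniteType.equiv inferInstance (polyAlgEquiv m)

instance (m : ℕ) : IsFractionRing (polyAlg m) (RatField m) := by
  refine IsFractionRing.of_field _ _ fun z => ?_
  obtain ⟨a, b, -, rfl⟩ := IsFractionRing.div_surjective (A := MvPolynomial (Fin m) ℂ) z
  exact ⟨polyAlgEquiv m a, polyAlgEquiv m b, rfl⟩

lemma polyAlg_eq_adjoin (m : ℕ) : polyAlg m = Algebra.adjoin ℂ (Set.range var) := by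
  rw [polyAlg, ← Algebra.map_top, ← MvPolynomial.adjoin_range_X, AlgHom.map_adjoin,
    ← Set.range_comp]
  rfl

lemma projAtlas_ring_default (m : ℕ) : (projAtlas m).ring {default} = polyAlg m := by
  rw [Atlas.ring, Finset.sup_singleton, polyAlg_eq_adjoin]
  have homCoord_default : homCoord m (default : Fin (m + 1)) = 1 := rfl
  refine le_antisymm (Algebra.adjoin_le ?_) (Algebra.adjoin_le ?_)
  · rintro _ ⟨j, rfl⟩
    simp only [homCoord_default, div_one]
    exact Fin.cases (Subalgebra.one_mem _) (fun i => Algebra.subset_adjoin ⟨i, rfl⟩) j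
  · rintro _ ⟨j, rfl⟩
    exact Algebra.subset_adjoin ⟨j.succ, div_one _⟩

lemma hirzebruch_ring_default (n : ℕ) : (hirzebruch n).ring {default} = polyAlg 2 := by
  rw [Atlas.ring, Finset.sup_singleton, polyAlg_eq_adjoin]
  change Algebra.adjoin ℂ {xVar, uVar} = _
  congr 1
  ext z
  simp [xVar, uVar, eq_comm]

instance (m : ℕ) : IsIntegrallyClosed ((projAtlas m).ring {default}) := by
  rw [projAtlas_ring_default]; infer_instance

instance (m : ℕ) : Algebra.FiniteType ℂ ((projAtlas m).ring {default}) := by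
  rw [projAtlas_ring_default]; infer_instance

instance (m : ℕ) : IsFractionRing ((projAtlas m).ring {default}) (RatField m) := by
  rw [projAtlas_ring_default]; infer_instance

instance (n : ℕ) : IsIntegrallyClosed ((hirzebruch n).ring {default}) := by
  rw [hirzebruch_ring_default]; infer_instance

instance (n : ℕ) : Algebra.FiniteType ℂ ((hirzebruch n).ring {default}) := by
  rw [hirzebruch_ring_default]; infer_instance

instance (n : ℕ) : IsFractionRing ((hirzebruch n).ring {default}) (RatField 2) := by
  rw [hirzebruch_ring_default]; infer_instance

end AffinePlane

section IntegralClosure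

section

variable (k R L : Type*) [CommRing k] [CommRing R] [CommRing L] [Algebra k R] [Algebra R L]
  [Algebra k L] [IsScalarTower k R L]

/-- The integral closure of `R` in `L`, as a `k`-algebra. -/
def intClosure : Subalgebra k L :=
  (integralClosure R L).restrictScalars k

/-- The inclusion of `R` into its integral closure. -/
def intClosureIncl : R →+* intClosure k R L :=
  algebraMap R (integralClosure R L)

end

section

variable {k R L : Type*} [Field k] [CommRing R] [IsDomain R] [Field L] [Algebra k R] [Algebra k L]
  [Algebra R L] [IsScalarTower k R L]

lemma hasFractions_intClosure (K : Type*) [Field K] [Algebra R K] [Algebra K L]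
    [IsScalarTower R K L] [IsFractionRing R K] [FiniteDimensional K L] :
    HasFractions (intClosure k R L) := by
  have := integralClosure.isFractionRing_of_finite_extension (A := R) K L
  intro z
  obtain ⟨a, b, hb, rfl⟩ := IsFractionRing.div_surjective (A := integralClosure R L) z
  have hb' : (b : L) ≠ 0 := by
    simpa using nonZeroDivisors.ne_zero hb
  refine ⟨b, b.2, hb', ?_⟩
  change (b : L) * (a / b) ∈ _
  rw [mul_div_cancel₀ _ hb']
  exact a.2

lemma fg_intClosure (K : Type*) [Field K] [Algebra R K] [Algebra K L] [IsScalarTower R K L]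
    [IsFractionRing R K] [FiniteDimensional K L] [IsIntegrallyClosed R] [Algebra.FiniteType k R]
    [Algebra.IsSeparable K L] :
    (intClosure k R L).FG := by
  have : IsNoetherianRing R := Algebra.FiniteType.isNoetherianRing k R
  have : Module.Finite R (integralClosure R L) := IsIntegralClosure.finite R K L _
  have : Algebra.FiniteType k (integralClosure R L) :=
    Algebra.FiniteType.trans (S := R) inferInstance inferInstance
  exact (intClosure k R L).fg_iff_finiteType.2 this

end

variable {R : Type} [CommRing R] [Algebra ℂ R] {Y : Scheme.{0}} (c : Spec (.of R) ⟶ Y)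
  [IsOpenImmersion c] (s : Y ⟶ Spec (.of ℂ))

lemma exists_intClosure_chart
    (hs : c ≫ s = Spec.map (CommRingCat.ofHom (algebraMap ℂ R))) {L : Type} [CommRing L]
    [Algebra R L] [Algebra ℂ L] [IsScalarTower ℂ R L]
    (f : Spec (.of L) ⟶ Y) [QuasiCompact f] [QuasiSeparated f]
    (hf : f = Spec.map (CommRingCat.ofHom (algebraMap R L)) ≫ c) :
    ∃ (κ : Spec (.of (intClosure ℂ R L)) ⟶ f.normalization) (_ : IsOpenImmersion κ),
      IsDominant κ ∧
      Spec.map (CommRingCat.ofHom (intClosure ℂ R L).val.toRingHom) ≫ κ = f.toNormalization ∧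
      κ ≫ f.fromNormalization = Spec.map (CommRingCat.ofHom (intClosureIncl ℂ R L)) ≫ c ∧
      κ ≫ f.fromNormalization ≫ s =
        Spec.map (CommRingCat.ofHom (algebraMap ℂ (intClosure ℂ R L))) ∧
      κ.opensRange = f.fromNormalization ⁻¹ᵁ c.opensRange := by
  obtain ⟨κ, hκ, hgen, hfrom, hrange⟩ := exists_integralClosure_chart c f hf
  refine ⟨κ, hκ, ?_, hgen, hfrom, ?_, hrange⟩
  · have : IsDominant
        (Spec.map (CommRingCat.ofHom (algebraMap (integralClosure R L) L)) ≫ κ) := by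
      rw [hgen]; infer_instance
    exact IsDominant.of_comp (Spec.map (CommRingCat.ofHom (algebraMap (integralClosure R L) L))) κ
  · have hstr : κ ≫ f.fromNormalization ≫ s = Spec.map (CommRingCat.ofHom
        ((algebraMap R (integralClosure R L)).comp (algebraMap ℂ R))) := by
      rw [← Category.assoc, hfrom, Category.assoc, hs, ← Spec.map_comp, ← CommRingCat.ofHom_comp]
    refine hstr.trans (congrArg (fun φ => Spec.map (CommRingCat.ofHom φ)) (RingHom.ext fun z => ?_))
    exact Subtype.ext (IsScalarTower.algebraMap_apply ℂ R L z).symm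

lemma hasModel_normalization
    (hs : c ≫ s = Spec.map (CommRingCat.ofHom (algebraMap ℂ R))) (K : Type) {L : Type}
    [Field K] [Field L] [Algebra R K] [Algebra R L] [Algebra K L] [Algebra ℂ L]
    [IsScalarTower R K L] [IsScalarTower ℂ R L] [FiniteDimensional K L] [IsFractionRing R K]
    [IsIntegrallyClosed R] [IsDomain R] [Algebra.FiniteType ℂ R]
    (f : Spec (.of L) ⟶ Y) [QuasiCompact f] [QuasiSeparated f]
    (hf : f = Spec.map (CommRingCat.ofHom (algebraMap R L)) ≫ c) :
    HasModel (f.fromNormalization ≫ s).toLRSHom L := by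
  have : CharZero L := charZero_of_injective_algebraMap (algebraMap ℂ L).injective
  have : CharZero K := (RingHom.charZero_iff (algebraMap K L).injective).2 inferInstance
  obtain ⟨κ, hκ, hd, -, -, hstr, -⟩ := exists_intClosure_chart c s hs f hf
  exact ⟨intClosure ℂ R L, κ.toLRSHom, fg_intClosure K, hasFractions_intClosure K, hκ,
    κ.denseRange, congrArg Scheme.Hom.toLRSHom hstr⟩

end IntegralClosure

section KummerCover

lemma finiteDimensional_kummerField {K : Type} [Field K] {n : ℕ} (h : K) (hn : 0 < n) :
    FiniteDimensional K (KummerField n h) :=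
  (Polynomial.monic_X_pow_sub_C h hn.ne').finite_adjoinRoot

variable {K : Type} [Field K] [Algebra ℂ K] {ι : Type} (A : Atlas K ι)

instance (i : ι) : IsOpenImmersion (A.chartMap i) :=
  inferInstanceAs (IsOpenImmersion (colimit.ι A.functor _))

lemma chartMap_toSpec (i : ι) :
    A.chartMap i ≫ A.toSpec = Spec.map (CommRingCat.ofHom (algebraMap ℂ (A.ring {i}))) :=
  colimit.ι_desc _ _

variable [Inhabited ι]

lemma kummerMap_generic (n : ℕ) (h : K) : kummerMap A.generic n h =
    Spec.map (CommRingCat.ofHom (algebraMap (A.ring {default}) (KummerField n h))) ≫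
      A.chartMap default := by
  rw [kummerMap, Atlas.generic, ← Spec.map_comp_assoc, ← CommRingCat.ofHom_comp]
  rfl

lemma hasModel_kummerCover {n : ℕ} {h : K} [Fact (Irreducible (Polynomial.X ^ n - Polynomial.C h))]
    (hn : 0 < n) [IsIntegrallyClosed (A.ring {default})] [Algebra.FiniteType ℂ (A.ring {default})]
    [IsFractionRing (A.ring {default}) K] :
    HasModel (kummerCoverMap A.generic n h ≫ A.toSpec).toLRSHom (KummerField n h) := by
  have := finiteDimensional_kummerField h hn
  exact hasModel_normalization (R := A.ring {default}) (A.chartMap default) A.toSpec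
    (chartMap_toSpec A default) K _ (kummerMap_generic A n h)

end KummerCover

/-! ### Models of the quotient -/

section EquivariantChart

/-- The morphism `κ` is a dense affine open subscheme of `X`, stable under the endomorphism `D` of
`X` over `k`, which restricts to the endomorphism of `Spec B` given by `δ`. -/
structure IsEquivariantChart {k : Type u} [CommRing k] {X : Scheme.{u}} (s : X ⟶ Spec (.of k))
    (D : X ⟶ X) {B : Type u} [CommRing B] [Algebra k B] (δ : B →ₐ[k] B)
    (κ : Spec (.of B) ⟶ X) : Prop where
  isOpenImmersion : IsOpenImmersion κ
  isDominant : IsDominant κ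
  comp_str : κ ≫ s = Spec.map (CommRingCat.ofHom (algebraMap k B))
  comp_aut : Spec.map (CommRingCat.ofHom δ.toRingHom) ≫ κ = κ ≫ D
  preimage_range : D ⁻¹' Set.range κ = Set.range κ

section Product

variable {k : Type u} {X₁ X₂ : Scheme.{u}} {B₁ B₂ : Type u} [CommRing B₁] [CommRing B₂]

section Chart

variable [CommRing k] [Algebra k B₁] [Algebra k B₂] {s₁ : X₁ ⟶ Spec (.of k)}
  {s₂ : X₂ ⟶ Spec (.of k)} {κ₁ : Spec (.of B₁) ⟶ X₁} {κ₂ : Spec (.of B₂) ⟶ X₂}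
  (h₁ : κ₁ ≫ s₁ = Spec.map (CommRingCat.ofHom (algebraMap k B₁)))
  (h₂ : κ₂ ≫ s₂ = Spec.map (CommRingCat.ofHom (algebraMap k B₂)))

/-- The chart `Spec (B₁ ⊗ B₂)` of `X₁ × X₂` given by charts `Spec Bᵢ` of the factors. -/
def prodChart : Spec (.of (B₁ ⊗[k] B₂)) ⟶ pullback s₁ s₂ :=
  (pullbackSpecIso k B₁ B₂).inv ≫ pullback.map _ _ s₁ s₂ κ₁ κ₂ (𝟙 _)
    (by rw [Category.comp_id, h₁]) (by rw [Category.comp_id, h₂])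

instance [IsOpenImmersion κ₁] [IsOpenImmersion κ₂] : IsOpenImmersion (prodChart h₁ h₂) := by
  unfold prodChart; infer_instance

lemma prodChart_fst : prodChart h₁ h₂ ≫ pullback.fst s₁ s₂ =
    Spec.map (CommRingCat.ofHom Algebra.TensorProduct.includeLeftRingHom) ≫ κ₁ := by
  simp only [prodChart, Category.assoc, pullback.lift_fst, pullbackSpecIso_inv_fst_assoc]

lemma prodChart_snd : prodChart h₁ h₂ ≫ pullback.snd s₁ s₂ =
    Spec.map (CommRingCat.ofHom
      (Algebra.TensorProduct.includeRight (R := k) (A := B₁) (B := B₂)).toRingHom) ≫ κ₂ := by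
  simp only [prodChart, Category.assoc, pullback.lift_snd, pullbackSpecIso_inv_snd_assoc]
  rfl

lemma range_prodChart : Set.range (prodChart h₁ h₂) =
    pullback.fst s₁ s₂ ⁻¹' Set.range κ₁ ∩ pullback.snd s₁ s₂ ⁻¹' Set.range κ₂ := by
  rw [← Scheme.Pullback.range_map (Spec.map (CommRingCat.ofHom (algebraMap k B₁)))
    (Spec.map (CommRingCat.ofHom (algebraMap k B₂))) s₁ s₂ κ₁ κ₂ (𝟙 _)
    (by rw [Category.comp_id, h₁]) (by rw [Category.comp_id, h₂])]
  simp only [prodChart, Scheme.Hom.comp_base, TopCat.coe_comp]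
  exact (Scheme.Hom.surjective _).range_comp _

end Chart

variable [Field k] [Algebra k B₁] [Algebra k B₂] {s₁ : X₁ ⟶ Spec (.of k)}
  {s₂ : X₂ ⟶ Spec (.of k)} {κ₁ : Spec (.of B₁) ⟶ X₁} {κ₂ : Spec (.of B₂) ⟶ X₂}

lemma universallyOpen_of_field {X : Scheme.{u}} (s : X ⟶ Spec (.of k)) : UniversallyOpen s := by
  have : Subsingleton (Spec (.of k)) := inferInstanceAs (Subsingleton (PrimeSpectrum k))
  infer_instance

lemma isDominant_prodChart (h₁ : κ₁ ≫ s₁ = Spec.map (CommRingCat.ofHom (algebraMap k B₁)))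
    (h₂ : κ₂ ≫ s₂ = Spec.map (CommRingCat.ofHom (algebraMap k B₂))) [IsOpenImmersion κ₁]
    [IsDominant κ₁] [IsDominant κ₂] : IsDominant (prodChart h₁ h₂) := by
  have := universallyOpen_of_field s₁
  have := universallyOpen_of_field s₂
  refine ⟨?_⟩
  rw [DenseRange, range_prodChart]
  exact (κ₁.denseRange.preimage (pullback.fst s₁ s₂).isOpenMap).inter_of_isOpen_left
    (κ₂.denseRange.preimage (pullback.snd s₁ s₂).isOpenMap)
    (κ₁.isOpenEmbedding.isOpen_range.preimage (pullback.fst s₁ s₂).continuous)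

lemma IsEquivariantChart.prod {D₁ : X₁ ⟶ X₁} {D₂ : X₂ ⟶ X₂} {δ₁ : B₁ →ₐ[k] B₁}
    {δ₂ : B₂ →ₐ[k] B₂} (H₁ : IsEquivariantChart s₁ D₁ δ₁ κ₁) (H₂ : IsEquivariantChart s₂ D₂ δ₂ κ₂)
    (h₁ : s₁ ≫ 𝟙 _ = D₁ ≫ s₁) (h₂ : s₂ ≫ 𝟙 _ = D₂ ≫ s₂) :
    IsEquivariantChart (pullback.fst s₁ s₂ ≫ s₁) (pullback.map s₁ s₂ s₁ s₂ D₁ D₂ (𝟙 _) h₁ h₂)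
      (Algebra.TensorProduct.map δ₁ δ₂) (prodChart H₁.comp_str H₂.comp_str) := by
  have := H₁.isOpenImmersion
  have := H₂.isOpenImmersion
  have := H₁.isDominant
  have := H₂.isDominant
  refine ⟨inferInstance, isDominant_prodChart _ _, ?_, pullback.hom_ext ?_ ?_, ?_⟩
  · rw [← Category.assoc, prodChart_fst, Category.assoc, H₁.comp_str, ← Spec.map_comp]
    rfl
  · rw [Category.assoc, prodChart_fst, Category.assoc, pullback.lift_fst,
      ← Category.assoc (prodChart _ _), prodChart_fst, Category.assoc,
      ← H₁.comp_aut, ← Spec.map_comp_assoc, ← Spec.map_comp_assoc]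
    congr 2
    ext b
    simp
  · rw [Category.assoc, prodChart_snd, Category.assoc, pullback.lift_snd,
      ← Category.assoc (prodChart _ _), prodChart_snd, Category.assoc,
      ← H₂.comp_aut, ← Spec.map_comp_assoc, ← Spec.map_comp_assoc]
    congr 2
    ext b
    simp
  · rw [range_prodChart]
    conv_rhs => rw [← H₁.preimage_range, ← H₂.preimage_range]
    rw [Set.preimage_inter]
    simp only [← Set.preimage_comp, ← TopCat.coe_comp, ← Scheme.Hom.comp_base]
    rw [pullback.lift_fst, pullback.lift_snd]

end Product

section Quotient

variable {k B : Type u} [CommRing k] [CommRing B] [Algebra k B] {γ : B →ₐ[k] B}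

lemma exists_coequalizer_specHom_iso (hγ : IsOfFinOrder γ) :
    ∃ e : coequalizer (specHom γ.toRingHom) (𝟙 _) ≅
        (Spec (.of (fixedSubalgebra γ))).toLocallyRingedSpace,
      coequalizer.π _ _ ≫ e.hom = specHom (fixedSubalgebra γ).val.toRingHom := by
  have hp := isTopologicalQuotient_fixedSubalgebra hγ
  let h : coequalizer (specHom γ.toRingHom) (𝟙 _) ⟶
      (Spec (.of (fixedSubalgebra γ))).toLocallyRingedSpace :=
    coequalizer.desc (specHom (fixedSubalgebra γ).val.toRingHom)
      (by rw [Category.id_comp]; exact hp.comp_eq)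
  have hh : coequalizer.π _ _ ≫ h = specHom (fixedSubalgebra γ).val.toRingHom :=
    coequalizer.π_desc _ _
  have : IsIso h := (isGeometricQuotient_coequalizer _).isIso_of_isBasis hp hh
    PrimeSpectrum.isBasis_basic_opens (isSectionEqualizer_fixedSubalgebra γ)
  exact ⟨asIso h, hh⟩

variable {X : Scheme.{u}} {s : X ⟶ Spec (.of k)} {D : X ⟶ X} {w : Spec (.of B) ⟶ X}

namespace IsEquivariantChart

lemma exists_coequalizer_isOpenImmersion (H : IsEquivariantChart s D γ w) :
    ∃ h : coequalizer (specHom γ.toRingHom) (𝟙 _) ⟶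
        coequalizer D.toLRSHom (𝟙 X.toLocallyRingedSpace),
      LocallyRingedSpace.IsOpenImmersion h ∧ DenseRange h.base ∧
      coequalizer.π _ _ ≫ h = w.toLRSHom ≫ coequalizer.π _ _ := by
  have : LocallyRingedSpace.IsOpenImmersion w.toLRSHom := H.isOpenImmersion
  have := H.isDominant
  let q := coequalizer.π D.toLRSHom (𝟙 X.toLocallyRingedSpace)
  have hf : specHom γ.toRingHom ≫ w.toLRSHom = w.toLRSHom ≫ D.toLRSHom :=
    congrArg Scheme.Hom.toLRSHom H.comp_aut
  let h : coequalizer (specHom γ.toRingHom) (𝟙 _) ⟶ coequalizer D.toLRSHom (𝟙 _) :=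
    coequalizer.desc (w.toLRSHom ≫ q) (by
      rw [← Category.assoc, hf, Category.assoc, coequalizer.condition, Category.id_comp,
        Category.id_comp])
  have hq : coequalizer.π _ _ ≫ h = w.toLRSHom ≫ q := coequalizer.π_desc _ _
  have hd : DenseRange (w.toLRSHom ≫ q).base := by
    rw [LocallyRingedSpace.comp_base, TopCat.coe_comp]
    exact (isTopologicalQuotient_coequalizer D.toLRSHom).isQuotientMap.surjective.denseRange.comp
      w.denseRange q.base.hom.continuous
  rw [← hq, LocallyRingedSpace.comp_base, TopCat.coe_comp] at hd
  exact ⟨h, (isGeometricQuotient_coequalizer _).isOpenImmersion (isGeometricQuotient_coequalizer _)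
    hf hq H.preimage_range, hd.of_comp, hq⟩

lemma exists_coequalizer_chart (H : IsEquivariantChart s D γ w) (hγ : IsOfFinOrder γ)
    (hD : D.toLRSHom ≫ s.toLRSHom = 𝟙 X.toLocallyRingedSpace ≫ s.toLRSHom) :
    ∃ j : (Spec (.of (fixedSubalgebra γ))).toLocallyRingedSpace ⟶
        coequalizer D.toLRSHom (𝟙 X.toLocallyRingedSpace),
      LocallyRingedSpace.IsOpenImmersion j ∧ DenseRange j.base ∧
      j ≫ coequalizer.desc s.toLRSHom hD = specHom (algebraMap k (fixedSubalgebra γ)) := by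
  obtain ⟨e, he⟩ := exists_coequalizer_specHom_iso hγ
  obtain ⟨h, hopen, hdense, hh⟩ := H.exists_coequalizer_isOpenImmersion
  refine ⟨e.inv ≫ h, inferInstance, ?_, ?_⟩
  · rw [LocallyRingedSpace.comp_base, TopCat.coe_comp]
    exact hdense.comp (TopCat.homeoOfIso
      (LocallyRingedSpace.forgetToTop.mapIso e.symm)).surjective.denseRange h.base.hom.continuous
  · rw [Category.assoc, Iso.inv_comp_eq]
    refine coequalizer.hom_ext ?_
    rw [reassoc_of% hh, coequalizer.π_desc, reassoc_of% he, specHom_comp]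
    exact congrArg Scheme.Hom.toLRSHom H.comp_str

end IsEquivariantChart

end Quotient

end EquivariantChart

section CyclicCurve

section

variable {k R L : Type*} [CommRing k] [CommRing R] [CommRing L] [Algebra k R] [Algebra R L]
  [Algebra k L] [IsScalarTower k R L]

/-- The restriction of an endomorphism of `L` over `R` to the integral closure of `R`. -/
def intClosureMap (δ : L →ₐ[k] L) (hδ : ∀ r, δ (algebraMap R L r) = algebraMap R L r) :
    intClosure k R L →ₐ[k] intClosure k R L :=
  (δ.comp (intClosure k R L).val).codRestrict _ fun z =>
    z.2.map_of_comp_eq (RingHom.id R) δ.toRingHom (RingHom.ext fun r => (hδ r).symm)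

end

lemma exists_isEquivariantChart_normalization {R L : Type} [CommRing R] [CommRing L] [Algebra ℂ R]
    [Algebra ℂ L] [Algebra R L] [IsScalarTower ℂ R L] [_root_.IsReduced L] {Y : Scheme.{0}}
    (c : Spec (.of R) ⟶ Y) [IsOpenImmersion c] (s : Y ⟶ Spec (.of ℂ))
    (hs : c ≫ s = Spec.map (CommRingCat.ofHom (algebraMap ℂ R))) (f : Spec (.of L) ⟶ Y)
    [QuasiCompact f] [QuasiSeparated f]
    (hf : f = Spec.map (CommRingCat.ofHom (algebraMap R L)) ≫ c)
    (δ : L →ₐ[ℂ] L) (hδ : ∀ r, δ (algebraMap R L r) = algebraMap R L r)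
    (D : f.normalization ⟶ f.normalization)
    (hD : f.toNormalization ≫ D =
      Spec.map (CommRingCat.ofHom δ.toRingHom) ≫ f.toNormalization)
    (hD' : D ≫ f.fromNormalization = f.fromNormalization) :
    ∃ κ, IsEquivariantChart (f.fromNormalization ≫ s) D (intClosureMap (R := R) δ hδ) κ := by
  obtain ⟨κ, hκ, hd, hgen, hfrom, hstr, hrange⟩ := exists_intClosure_chart c s hs f hf
  have hDrange : D ⁻¹' Set.range κ = Set.range κ := by
    rw [← Scheme.Hom.coe_opensRange, hrange]
    exact congrArg SetLike.coe
      (show D ⁻¹ᵁ f.fromNormalization ⁻¹ᵁ c.opensRange = _ by rw [← Scheme.Hom.comp_preimage, hD'])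
  refine ⟨κ, hκ, hd, hstr, ?_, hDrange⟩
  have : IsDominant (Spec.map (CommRingCat.ofHom (intClosure ℂ R L).val.toRingHom)) := by
    refine ⟨(PrimeSpectrum.denseRange_comap_iff_ker_le_nilRadical _).2 ?_⟩
    rw [(RingHom.injective_iff_ker_eq_bot _).1 Subtype.val_injective]
    exact bot_le
  have : _root_.IsReduced (intClosure ℂ R L) :=
    isReduced_of_injective (intClosure ℂ R L).val Subtype.val_injective
  refine ext_of_isDominant_of_isSeparated f.fromNormalization ?_
    (Spec.map (CommRingCat.ofHom (intClosure ℂ R L).val.toRingHom)) ?_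
  · rw [Category.assoc, Category.assoc, hD', hfrom, ← Spec.map_comp_assoc, ← CommRingCat.ofHom_comp]
    congr 3
    ext r
    exact hδ r
  · rw [← Spec.map_comp_assoc, ← Category.assoc _ κ, hgen, hD, ← hgen, ← Spec.map_comp_assoc]
    rfl

lemma toNormalization_deck {K : Type} [Field K] {X : Scheme.{0}} (η : Spec (.of K) ⟶ X) {n : ℕ}
    (h ξ : K) (hξ : ξ ^ n = 1) : (kummerMap η n h).toNormalization ≫ deck η h ξ hξ =
      Spec.map (CommRingCat.ofHom (deckField h ξ hξ).toRingHom) ≫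
        (kummerMap η n h).toNormalization := by
  rw [deck, Scheme.Hom.toNormalization_normalizationDesc]

variable {n : ℕ} (h : RatField 1) (ξ : ℂ) (hξ : ξ ^ n = 1)

/-- The automorphism `y ↦ ξ y` of the function field of the curve `yⁿ = h(x)`. -/
def curveDeck : KummerField n h →ₐ[ℂ] KummerField n h :=
  (deckField h (algebraMap ℂ _ ξ) (by rw [← map_pow, hξ, map_one])).restrictScalars ℂ

lemma curveDeck_algebraMap (r : RatField 1) :
    curveDeck h ξ hξ (algebraMap _ _ r) = algebraMap (RatField 1) (KummerField n h) r :=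
  (deckField h (algebraMap ℂ _ ξ) (by rw [← map_pow, hξ, map_one])).commutes r

/-- The coordinate ring of the affine part of the curve `yⁿ = h(x)`. -/
abbrev curveRing (n : ℕ) (h : RatField 1) : Subalgebra ℂ (KummerField n h) :=
  intClosure ℂ ((projAtlas 1).ring {default}) (KummerField n h)

/-- The automorphism `y ↦ ξ y` of the coordinate ring of the affine part of `yⁿ = h(x)`. -/
def curveRingDeck : curveRing n h →ₐ[ℂ] curveRing n h :=
  intClosureMap (R := (projAtlas 1).ring {default}) (curveDeck h ξ hξ)
    fun r => curveDeck_algebraMap h ξ hξ r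

lemma exists_isEquivariantChart_cyclicCurve [_root_.IsReduced (KummerField n h)] :
    ∃ κ, IsEquivariantChart (cyclicCurveToSpec n h) (cyclicCurveAut h ξ hξ)
      (curveRingDeck h ξ hξ) κ :=
  exists_isEquivariantChart_normalization (L := KummerField n h) ((projAtlas 1).chartMap default)
    (projAtlas 1).toSpec (chartMap_toSpec _ _) (kummerMap (projAtlas 1).generic n h)
    (kummerMap_generic _ n h) (curveDeck h ξ hξ) _ (cyclicCurveAut h ξ hξ)
    (toNormalization_deck ..) (deck_comp ..)

lemma exists_quotProd_chart {h₁ h₂ : RatField 1} [_root_.IsReduced (KummerField n h₁)]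
    [_root_.IsReduced (KummerField n h₂)]
    (hγ : IsOfFinOrder
      (Algebra.TensorProduct.map (curveRingDeck h₁ ξ hξ) (curveRingDeck h₂ ξ hξ))) :
    ∃ j : (Spec (.of (fixedSubalgebra (Algebra.TensorProduct.map (curveRingDeck h₁ ξ hξ)
        (curveRingDeck h₂ ξ hξ))))).toLocallyRingedSpace ⟶ quotProd h₁ h₂ ξ hξ,
      LocallyRingedSpace.IsOpenImmersion j ∧ DenseRange j.base ∧
      j ≫ quotProdToSpec h₁ h₂ ξ hξ = specStr _ := by
  have chart₁ := exists_isEquivariantChart_cyclicCurve h₁ ξ hξ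
  have chart₂ := exists_isEquivariantChart_cyclicCurve h₂ ξ hξ
  obtain ⟨κ₁, H₁⟩ := chart₁
  obtain ⟨κ₂, H₂⟩ := chart₂
  have H : IsEquivariantChart (curveProdToSpec n h₁ h₂) (diagAut h₁ h₂ ξ hξ) _ _ :=
    IsEquivariantChart.prod H₁ H₂ (by rw [cyclicCurveAut_comp, Category.comp_id])
      (by rw [cyclicCurveAut_comp, Category.comp_id])
  exact H.exists_coequalizer_chart hγ _

end CyclicCurve

/-! ### Tensor products over an algebraically closed field -/

section TensorProduct

section FreeFibre

variable {k A B : Type*} [CommRing k] [CommRing A] [Algebra k A] [CommRing B] [Algebra k B]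

/-- The specialization `A ⊗ B → B` along a rational point `e` of `A`. -/
def specialize (B : Type*) [CommRing B] [Algebra k B] (e : A →ₐ[k] k) : A ⊗[k] B →ₐ[k] B :=
  Algebra.TensorProduct.lift ((Algebra.ofId k B).comp e) (AlgHom.id k B) fun _ _ => Commute.all _ _

lemma specialize_tmul (e : A →ₐ[k] k) (a : A) (b : B) : specialize B e (a ⊗ₜ b) = e a • b := by
  simp [specialize, Algebra.smul_def, Algebra.ofId_apply]

-- A coordinate of `z` in the `A`-basis coming from a basis of `B` is compatible with `specialize`.
lemma exists_forall_specialize_ne_zero [Module.Free k B] {z : A ⊗[k] B} (hz : z ≠ 0) :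
    ∃ a : A, a ≠ 0 ∧ ∀ e : A →ₐ[k] k, e a ≠ 0 → specialize B e z ≠ 0 := by
  let b := Module.Free.chooseBasis k B
  let bA := Algebra.TensorProduct.basis A b
  obtain ⟨i, hi⟩ := Finsupp.ne_iff.1 ((map_ne_zero_iff bA.repr bA.repr.injective).2 hz)
  have repr_specialize : ∀ (e : A →ₐ[k] k) (w : A ⊗[k] B),
      b.repr (specialize B e w) i = e (bA.repr w i) := fun e w => by
    induction w with
    | zero => simp
    | add x y hx hy => simp [hx, hy]
    | tmul x y => simp [specialize_tmul, bA]
  refine ⟨bA.repr z i, hi, fun e he h0 => he ?_⟩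
  rw [← repr_specialize, h0, map_zero, Finsupp.zero_apply]

lemma transcendental_iff_linearIndependent_pow {x : A} :
    Transcendental k x ↔ LinearIndependent k fun n : ℕ => x ^ n := by
  have h := Polynomial.linearIndependent_powers_iff_aeval (Algebra.lmul k A x) 1
  simp only [← map_pow, Polynomial.aeval_algHom_apply] at h
  simpa [transcendental_iff] using h.symm

lemma transcendental_one_tmul [Module.Flat k A] {x : B} (hx : Transcendental k x) :
    Transcendental A ((1 : A) ⊗ₜ[k] x) := by
  rw [transcendental_iff_linearIndependent_pow] at hx ⊢
  simpa only [Algebra.TensorProduct.tmul_pow, one_pow] using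
    Module.Flat.linearIndependent_one_tmul (S := A) hx

end FreeFibre

variable {k A B : Type*} [Field k] [IsAlgClosed k] [CommRing A] [Algebra k A]
  [Algebra.FiniteType k A]

lemma exists_algHom_ne_zero [_root_.IsReduced A] {a : A} (ha : a ≠ 0) :
    ∃ e : A →ₐ[k] k, e a ≠ 0 := by
  have : IsJacobsonRing A := isJacobsonRing_of_finiteType (A := k)
  have ha' : a ∉ (⊥ : Ideal A).jacobson := by
    rwa [← Ideal.radical_eq_jacobson, Ideal.radical_bot_of_isReduced]
  simp only [Ideal.jacobson, Ideal.mem_sInf, not_forall] at ha'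
  obtain ⟨m, ⟨-, hm⟩, ham⟩ := ha'
  let : Field (A ⧸ m) := Ideal.Quotient.field m
  have : Module.Finite k (A ⧸ m) := finite_of_finite_type_of_isJacobsonRing k (A ⧸ m)
  let f : (A ⧸ m) →ₐ[k] k := IsAlgClosed.lift
  refine ⟨f.comp (Ideal.Quotient.mkₐ k m), ?_⟩
  rw [AlgHom.comp_apply, map_ne_zero_iff f f.injective]
  exact mt Ideal.Quotient.eq_zero_iff_mem.1 ham

-- If `z w = 0`, then `z` or `w` vanishes at each rational point of a suitable open subset of `A`.
lemma isDomain_tensorProduct [IsDomain A] [CommRing B] [Algebra k B] [IsDomain B] :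
    IsDomain (A ⊗[k] B) := by
  have : Nontrivial (A ⊗[k] B) := by
    obtain ⟨e, -⟩ := exists_algHom_ne_zero (k := k) (one_ne_zero (α := A))
    exact (specialize B e).toRingHom.domain_nontrivial
  have : NoZeroDivisors (A ⊗[k] B) := by
    refine ⟨fun {z w} hzw => ?_⟩
    by_contra! hne
    obtain ⟨a, ha, hz⟩ := exists_forall_specialize_ne_zero hne.1
    obtain ⟨b, hb, hw⟩ := exists_forall_specialize_ne_zero hne.2
    obtain ⟨e, he⟩ := exists_algHom_ne_zero (k := k) (mul_ne_zero ha hb)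
    rw [map_mul] at he
    refine mul_ne_zero (hz e (left_ne_zero_of_mul he)) (hw e (right_ne_zero_of_mul he)) ?_
    rw [← map_mul, hzw, map_zero]
  exact NoZeroDivisors.to_isDomain _

lemma finiteType_tensorProduct (k A B : Type*) [CommRing k] [CommRing A] [Algebra k A]
    [CommRing B] [Algebra k B] [Algebra.FiniteType k A] [Algebra.FiniteType k B] :
    Algebra.FiniteType k (A ⊗[k] B) :=
  .trans (S := A) inferInstance inferInstance

lemma isOfFinOrder_tensorProductMap {k A B : Type*} [CommSemiring k] [Semiring A] [Algebra k A]
    [Semiring B] [Algebra k B] {γ : A →ₐ[k] A} {δ : B →ₐ[k] B} (hγ : IsOfFinOrder γ)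
    (hδ : IsOfFinOrder δ) : IsOfFinOrder (Algebra.TensorProduct.map γ δ) := by
  let tensorHom : (A →ₐ[k] A) × (B →ₐ[k] B) →* (A ⊗[k] B →ₐ[k] A ⊗[k] B) :=
    { toFun p := Algebra.TensorProduct.map p.1 p.2
      map_one' := Algebra.TensorProduct.map_id
      map_mul' p q := Algebra.TensorProduct.map_comp p.1 q.1 p.2 q.2 }
  exact tensorHom.isOfFinOrder (x := (γ, δ)) (hγ.prod_mk hδ)

end TensorProduct

/-! ### Invariant subfields -/

section FixedField

variable {k F : Type*} [Field k] [Field F] [Algebra k F]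

/-- The subfield of elements fixed by an endomorphism of a field. -/
def fixedField (g : F →ₐ[k] F) : IntermediateField k F :=
  (fixedSubalgebra g).toIntermediateField fun z hz => (map_inv₀ g z).trans (congrArg _ hz)

lemma mem_fixedField {g : F →ₐ[k] F} {z : F} : z ∈ fixedField g ↔ g z = z :=
  Iff.rfl

lemma sum_aeval_pow_smul_mem (M : IntermediateField k F) {n : ℕ} {ξ : k}
    (hξ : IsPrimitiveRoot ξ n) {y : F} (hyn : y ^ n ∈ M) (p : Polynomial M) :
    ∑ j ∈ Finset.range n, Polynomial.aeval (ξ ^ j • y) p ∈ M := by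
  induction p using Polynomial.induction_on' with
  | add p q hp hq => simpa only [map_add, Finset.sum_add_distrib] using M.add_mem hp hq
  | monomial i a =>
    have hsum : ∑ j ∈ Finset.range n, Polynomial.aeval (ξ ^ j • y) (Polynomial.monomial i a) =
        (∑ j ∈ Finset.range n, (ξ ^ i) ^ j) • (a * y ^ i : F) := by
      rw [Finset.sum_smul]
      refine Finset.sum_congr rfl fun j _ => ?_
      rw [Polynomial.aeval_monomial, smul_pow, ← pow_mul, ← pow_mul, mul_comm j, mul_smul_comm]
      rfl
    rw [hsum]
    by_cases hi : n ∣ i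
    · obtain ⟨m, rfl⟩ := hi
      rw [pow_mul y]
      exact M.smul_mem (M.mul_mem a.2 (pow_mem hyn m))
    · have hroot : ξ ^ i ≠ 1 := mt (hξ.pow_eq_one_iff_dvd i).1 hi
      rw [geom_sum_eq hroot, ← pow_mul, mul_comm i, pow_mul, hξ.pow_eq_one, one_pow, sub_self,
        zero_div, zero_smul]
      exact M.zero_mem

-- A fixed point `z` is its own average over the powers of `g`, and averaging lands in `M`.
lemma mem_of_mem_adjoin_of_mem_fixedField {M : IntermediateField k F} {g : F →ₐ[k] F}
    (hM : M ≤ fixedField g) {n : ℕ} [NeZero n] {ξ : k} (hξ : IsPrimitiveRoot ξ n) {y : F}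
    (hy : g y = ξ • y) (hyn : y ^ n ∈ M) {z : F} (hz : z ∈ IntermediateField.adjoin M {y})
    (hgz : z ∈ fixedField g) : z ∈ M := by
  have hint : _root_.IsIntegral M y :=
    .of_pow (NeZero.pos n) (isIntegral_algebraMap (R := M) (x := ⟨y ^ n, hyn⟩))
  rw [← IntermediateField.mem_toSubalgebra,
    IntermediateField.adjoin_simple_toSubalgebra_of_isAlgebraic hint.isAlgebraic,
    Algebra.adjoin_singleton_eq_range_aeval] at hz
  obtain ⟨p, rfl⟩ := hz
  let gM : F →ₐ[M] F := { g with commutes' := fun m => hM m.2 }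
  have aeval_eq (j : ℕ) : Polynomial.aeval (ξ ^ j • y) p = Polynomial.aeval y p := by
    induction j with
    | zero => rw [pow_zero, one_smul]
    | succ j ih =>
      have hgy : gM (ξ ^ j • y) = ξ ^ (j + 1) • y := by
        rw [pow_succ, mul_smul, ← hy]
        exact map_smul g _ _
      rw [← hgy, Polynomial.aeval_algHom_apply, ih]
      exact hgz
  have hn : (n : F) ≠ 0 := by
    rw [← map_natCast (algebraMap k F), map_ne_zero]
    exact hξ.neZero'.ne
  have hmem := sum_aeval_pow_smul_mem M hξ hyn p
  simp only [aeval_eq, Finset.sum_const, Finset.card_range, nsmul_eq_mul] at hmem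
  have hdiv := M.div_mem hmem (natCast_mem M n)
  rwa [mul_div_cancel_left₀ _ hn] at hdiv

section FractionField

variable {R : Type*} [CommRing R] [Algebra k R] [Algebra R F] [IsFractionRing R F]
  {γ : R →ₐ[k] R} {g : F →ₐ[k] F}

lemma exists_algHom_fractionField [IsScalarTower k R F] (hγ : IsOfFinOrder γ) :
    ∃ g : F →ₐ[k] F, ∀ r, g (algebraMap R F r) = algebraMap R F (γ r) := by
  obtain ⟨e, -, rfl⟩ := exists_algEquiv_of_isOfFinOrder hγ
  let ι : R →ₐ[k] F := (IsScalarTower.toAlgHom k R F).comp (e : R →ₐ[k] R)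
  have hι : Function.Injective ι := (IsFractionRing.injective R F).comp e.injective
  exact ⟨IsFractionRing.liftAlgHom hι, IsFractionRing.lift_algebraMap (g := ι.toRingHom) hι⟩

-- As `R` is integral over its fixed subalgebra, denominators can be chosen fixed.
lemma exists_fixedSubalgebra_mul_eq (hγ : IsOfFinOrder γ)
    (hg : ∀ r, g (algebraMap R F r) = algebraMap R F (γ r)) {z : F} (hz : z ∈ fixedField g) :
    ∃ a b : fixedSubalgebra γ, (b : R) ≠ 0 ∧ algebraMap R F b * z = algebraMap R F a := by
  obtain ⟨r, s, hs, rfl⟩ := IsFractionRing.div_surjective (A := R) z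
  have := (algebraMap R F).domain_nontrivial
  have := isIntegral_fixedSubalgebra hγ
  obtain ⟨b, hb, d, hd⟩ :=
    (Algebra.IsIntegral.isIntegral (R := fixedSubalgebra γ) s).isAlgebraic.exists_nonzero_dvd hs
  have hb' : (b : R) = s * d := hd
  have hs' : algebraMap R F s ≠ 0 := IsFractionRing.to_map_ne_zero_of_mem_nonZeroDivisors hs
  have hfrac : algebraMap R F b * (algebraMap R F r / algebraMap R F s) =
      algebraMap R F (r * d) := by
    rw [hb', map_mul, map_mul]
    field_simp
  refine ⟨⟨r * d, IsFractionRing.injective R F ?_⟩, b, fun h => hb (Subtype.ext h), hfrac⟩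
  change algebraMap R F (γ (r * d)) = algebraMap R F (r * d)
  rw [← hg, ← hfrac, map_mul, hg, show γ b = b from b.2, mem_fixedField.1 hz]

lemma exists_algHom_fixedSubalgebra [IsScalarTower k R F] {L : Type*} [Field L] [Algebra k L]
    (hγ : IsOfFinOrder γ) (hg : ∀ r, g (algebraMap R F r) = algebraMap R F (γ r))
    {φ : L →ₐ[k] F} (hφ : φ.fieldRange = fixedField g) :
    ∃ ψ : fixedSubalgebra γ →ₐ[k] L, Function.Injective ψ ∧
      ∀ z, ∃ a b, ψ b ≠ 0 ∧ ψ b * z = ψ a := by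
  let ι : fixedSubalgebra γ →ₐ[k] F :=
    (IsScalarTower.toAlgHom k R F).comp (fixedSubalgebra γ).val
  have hι : Function.Injective ι := (IsFractionRing.injective R F).comp Subtype.val_injective
  have hmem (r : fixedSubalgebra γ) : ι r ∈ φ.fieldRange := by
    rw [hφ, mem_fixedField]
    exact (hg r).trans (congrArg _ r.2)
  let e : L ≃ₐ[k] φ.fieldRange := AlgEquiv.ofInjectiveField φ
  let ψ : fixedSubalgebra γ →ₐ[k] L :=
    (e.symm : φ.fieldRange →ₐ[k] L).comp (ι.codRestrict φ.fieldRange.toSubalgebra hmem)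
  have hψ (r : fixedSubalgebra γ) : φ (ψ r) = ι r := congrArg Subtype.val (e.apply_symm_apply _)
  refine ⟨ψ, fun r s hrs => hι (by rw [← hψ, ← hψ, hrs]), fun z => ?_⟩
  obtain ⟨a, b, hb, hab⟩ := exists_fixedSubalgebra_mul_eq hγ hg (z := φ z) (hφ ▸ ⟨z, rfl⟩)
  refine ⟨a, b, fun h0 => hb ?_, φ.injective ?_⟩
  · refine IsFractionRing.injective R F ?_
    rw [map_zero, ← map_zero φ, ← h0, hψ]
    rfl
  · change φ (ψ b * z) = φ (ψ a)
    rw [map_mul, hψ, hψ]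
    exact hab

end FractionField

end FixedField

section KummerCoordinates

variable {k B : Type*} [Field k] [CommRing B] [Algebra k B]

/-- Coordinates `x`, `y` on a cyclic covering `yⁿ = f(x)` of the line with coordinate ring `B`, on
which the covering transformation `δ` acts by `y ↦ ξ y`. That they generate the function field is
expressed inside `B`: up to a nonzero factor in `k[x, y]`, every element lies in `k[x, y]`. -/
structure IsKummerCoordinates (δ : B →ₐ[k] B) (ξ : k) (n : ℕ) (f : Polynomial k) (x y : B) :
    Prop where
  transcendental : Transcendental k x
  pow_eq : y ^ n = Polynomial.aeval x f
  map_fst : δ x = x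
  map_snd : δ y = ξ • y
  exists_mul_mem : ∀ b, ∃ d ∈ Algebra.adjoin k {x, y}, d ≠ 0 ∧ d * b ∈ Algebra.adjoin k {x, y}

namespace IsKummerCoordinates

variable {δ : B →ₐ[k] B} {ξ : k} {n : ℕ} {f : Polynomial k} {x y : B}

lemma snd_ne_zero (h : IsKummerCoordinates δ ξ n f x y) (hn : n ≠ 0) (hf : f ≠ 0) : y ≠ 0 := by
  rintro rfl
  refine hf (transcendental_iff.1 h.transcendental f ?_)
  rw [← h.pow_eq, zero_pow hn]

lemma map_mem (h : IsKummerCoordinates δ ξ n f x y) {F : Type*} [Field F] [Algebra k F]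
    {i : B →ₐ[k] F} (hi : Function.Injective i) {E : IntermediateField k F} (hx : i x ∈ E)
    (hy : i y ∈ E) (b : B) : i b ∈ E := by
  have hadjoin : Algebra.adjoin k {x, y} ≤ E.toSubalgebra.comap i :=
    Algebra.adjoin_le (Set.pair_subset hx hy)
  obtain ⟨d, hd, hd0, hdb⟩ := h.exists_mul_mem b
  have hid : i d ≠ 0 := (map_ne_zero_iff i hi).2 hd0
  rw [← mul_div_cancel_left₀ (i b) hid, ← map_mul]
  exact E.div_mem (hadjoin hdb) (hadjoin hd)

end IsKummerCoordinates

end KummerCoordinates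

section Invariants

variable {k F : Type*} [Field k] [Field F] [Algebra k F]

lemma fixedField_eq_adjoin {n : ℕ} [NeZero n] {ξ : k} (hξ : IsPrimitiveRoot ξ n)
    {g : F →ₐ[k] F} {x₁ y₁ x₂ y₂ : F} (hx₁ : g x₁ = x₁) (hy₁ : g y₁ = ξ • y₁) (hx₂ : g x₂ = x₂)
    (hy₂ : g y₂ = ξ • y₂) (hy₂_ne : y₂ ≠ 0) (hpow : y₂ ^ n ∈ IntermediateField.adjoin k {x₂})
    (htop : IntermediateField.adjoin k {x₁, y₁, x₂, y₂} = ⊤) :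
    fixedField g = IntermediateField.adjoin k {x₁, x₂, y₁ / y₂} := by
  set M := IntermediateField.adjoin k {x₁, x₂, y₁ / y₂}
  have hM : {x₁, x₂, y₁ / y₂} ⊆ (M : Set F) := IntermediateField.subset_adjoin k _
  simp only [Set.insert_subset_iff, Set.singleton_subset_iff] at hM
  obtain ⟨hx₁M, hx₂M, hyM⟩ := hM
  have hM_le : M ≤ fixedField g := by
    refine IntermediateField.adjoin_le_iff.2 ?_
    rintro z (rfl | rfl | rfl)
    · exact hx₁
    · exact hx₂
    · have hξ0 : algebraMap k F ξ ≠ 0 := by simpa using hξ.ne_zero (NeZero.ne n)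
      change g (y₁ / y₂) = y₁ / y₂
      rw [map_div₀, hy₁, hy₂, Algebra.smul_def, Algebra.smul_def, mul_div_mul_left _ _ hξ0]
  have hM_adjoin : ∀ z, z ∈ IntermediateField.adjoin M {y₂} := by
    let N : IntermediateField M F := IntermediateField.adjoin M {y₂}
    have hMN : ∀ z ∈ M, z ∈ N := fun z hz => N.algebraMap_mem ⟨z, hz⟩
    have hy₂N : y₂ ∈ N := IntermediateField.mem_adjoin_simple_self M _
    have hN : (⊤ : IntermediateField k F) ≤ N.restrictScalars k := by
      rw [← htop]
      refine IntermediateField.adjoin_le_iff.2 ?_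
      rintro z (rfl | rfl | rfl | rfl)
      · exact hMN _ hx₁M
      · rw [← div_mul_cancel₀ z hy₂_ne]
        exact N.mul_mem (hMN _ hyM) hy₂N
      · exact hMN _ hx₂M
      · exact hy₂N
    exact fun z => hN trivial
  have hy₂M : y₂ ^ n ∈ M := IntermediateField.adjoin_simple_le_iff.2 hx₂M hpow
  exact le_antisymm (fun z hz =>
    mem_of_mem_adjoin_of_mem_fixedField hM_le hξ hy₂ hy₂M (hM_adjoin z) hz) hM_le

lemma adjoin_kummer_generators_eq (h2 : (2 : k) ≠ 0) {c : k} (hc : c ≠ 0) (x₁ x₂ z : F) :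
    IntermediateField.adjoin k {x₁, x₂, z} =
      IntermediateField.adjoin k {x₁, c⁻¹ • z, 2 * x₂ - 1} := by
  have h2F : (2 : F) ≠ 0 := by
    rw [← map_ofNat (algebraMap k F) 2]
    exact (map_ne_zero _).2 h2
  apply le_antisymm <;> rw [IntermediateField.adjoin_le_iff]
  · set M := IntermediateField.adjoin k {x₁, c⁻¹ • z, 2 * x₂ - 1}
    have hM : {x₁, c⁻¹ • z, 2 * x₂ - 1} ⊆ (M : Set F) := IntermediateField.subset_adjoin k _
    simp only [Set.insert_subset_iff, Set.singleton_subset_iff] at hM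
    refine Set.insert_subset hM.1 (Set.pair_subset ?_ ?_)
    · have hx₂ : x₂ = (2 * x₂ - 1 + 1) / 2 := by field_simp; ring
      rw [hx₂]
      exact M.div_mem (M.add_mem hM.2.2 M.one_mem) (ofNat_mem M 2)
    · rw [← smul_inv_smul₀ hc z]
      exact M.smul_mem hM.2.1
  · set M := IntermediateField.adjoin k {x₁, x₂, z}
    have hM : {x₁, x₂, z} ⊆ (M : Set F) := IntermediateField.subset_adjoin k _
    simp only [Set.insert_subset_iff, Set.singleton_subset_iff] at hM
    exact Set.insert_subset hM.1 (Set.pair_subset (M.smul_mem hM.2.2)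
      (M.sub_mem (M.mul_mem (ofNat_mem M 2) hM.2.1) M.one_mem))

lemma sq_two_mul_sub_one_eq {c y₁ x₂ y₂ : F} (hc : c ≠ 0) (hc6 : c ^ 6 = -4) (hy₁ : y₁ ≠ 0)
    (hy₂ : y₂ ≠ 0) (hpow : y₂ ^ 6 = x₂ * (x₂ - 1)) :
    (2 * x₂ - 1) ^ 2 = ((c⁻¹ * (y₁ / y₂)) ^ 6 - y₁ ^ 6) / (c⁻¹ * (y₁ / y₂)) ^ 6 := by
  have hquot : ((c⁻¹ * (y₁ / y₂)) ^ 6 - y₁ ^ 6) / (c⁻¹ * (y₁ / y₂)) ^ 6 =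
      1 - c ^ 6 * y₂ ^ 6 := by
    field_simp
  rw [hquot, hc6, hpow]
  ring

lemma transcendental_of_sq_eq {B : Type*} [CommRing B] [IsDomain B] [Algebra B F] {s : B} {u t : F}
    (ht : Transcendental B t) (h : t ^ 2 = (u ^ 6 - algebraMap B F s) / u ^ 6) :
    Transcendental B u := by
  refine fun hu => ht (IsAlgebraic.of_pow (n := 2) two_pos ?_)
  rw [h, div_eq_mul_inv]
  exact ((hu.pow 6).sub (isAlgebraic_algebraMap s)).mul (hu.pow 6).inv

lemma exists_ne_zero_pow_six_eq_neg_four [IsAlgClosed k] (h2 : (2 : k) ≠ 0) :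
    ∃ c : k, c ≠ 0 ∧ c ^ 6 = -4 := by
  obtain ⟨c, hc⟩ := IsAlgClosed.exists_pow_nat_eq (-4 : k) (n := 6) (by norm_num)
  refine ⟨c, ?_, hc⟩
  rintro rfl
  exact mul_ne_zero h2 h2 (by linear_combination hc)

lemma transcendental_two_mul_sub_one {B : Type*} [CommRing B] [Algebra k B] (h2 : (2 : k) ≠ 0)
    {x : B} (hx : Transcendental k x) : Transcendental k (2 * x - 1) := by
  let p : Polynomial k := Polynomial.C 2 * Polynomial.X + Polynomial.C (-1)
  have hdeg : p.natDegree = 1 := Polynomial.natDegree_linear h2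
  have hlead : p.leadingCoeff = 2 := Polynomial.leadingCoeff_linear h2
  have haeval : Polynomial.aeval x p = 2 * x - 1 := by
    simp [p, sub_eq_add_neg, map_ofNat (algebraMap k B) 2]
  exact haeval ▸ hx.aeval p (hdeg ▸ one_ne_zero) (mem_nonZeroDivisors_of_ne_zero (by rwa [hlead]))

lemma algebraicIndependent_pair {k B F : Type*} [CommRing k] [CommRing B] [CommRing F]
    [Algebra k B] [Algebra k F] [Algebra B F] [IsScalarTower k B F] {x : B} {u : F}
    (hx : Transcendental k x) (hu : Transcendental B u) :
    AlgebraicIndependent k ![algebraMap B F x, u] := by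
  have hx' := algebraicIndependent_unique_type_iff (ι := Unit) (x := fun _ => x).2 hx
  have hu' := algebraicIndependent_unique_type_iff (ι := Unit) (x := fun _ => u).2 hu
  let e : Fin 2 → Unit ⊕ Unit := ![Sum.inr (), Sum.inl ()]
  convert (hx'.sumElim_comp hu').comp e (by decide) using 1
  funext i
  fin_cases i <;> rfl

section TensorProduct

variable {B₁ B₂ : Type*} [CommRing B₁] [CommRing B₂] [IsDomain B₁] [Algebra k B₁] [Algebra k B₂]
  [Algebra (B₁ ⊗[k] B₂) F] [IsFractionRing (B₁ ⊗[k] B₂) F]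
  [IsScalarTower k (B₁ ⊗[k] B₂) F] {f₁ f₂ : Polynomial k} {ξ : k} {n : ℕ} {δ₁ : B₁ →ₐ[k] B₁}
  {δ₂ : B₂ →ₐ[k] B₂} {x₁ y₁ : B₁} {x₂ y₂ : B₂}

lemma algebraicIndependent_of_sq_eq {w : B₂} (hx₁ : Transcendental k x₁) (hw : Transcendental k w)
    {s : B₁} {u : F} (h : algebraMap (B₁ ⊗[k] B₂) F (1 ⊗ₜ w) ^ 2 =
      (u ^ 6 - algebraMap (B₁ ⊗[k] B₂) F (s ⊗ₜ 1)) / u ^ 6) :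
    AlgebraicIndependent k ![algebraMap (B₁ ⊗[k] B₂) F (x₁ ⊗ₜ 1), u] := by
  have hinj := IsFractionRing.injective (B₁ ⊗[k] B₂) F
  let i : B₁ →ₐ[k] F :=
    (IsScalarTower.toAlgHom k (B₁ ⊗[k] B₂) F).comp Algebra.TensorProduct.includeLeft
  let : Algebra B₁ F := i.toAlgebra
  have : IsScalarTower k B₁ F := .of_algebraMap_eq fun a => (i.commutes a).symm
  have : IsScalarTower B₁ (B₁ ⊗[k] B₂) F := .of_algebraMap_eq fun _ => rfl
  have hw' : Transcendental B₁ (algebraMap (B₁ ⊗[k] B₂) F (1 ⊗ₜ w)) :=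
    (transcendental_algebraMap_iff hinj).2 (transcendental_one_tmul hw)
  exact algebraicIndependent_pair (B := B₁) hx₁ (transcendental_of_sq_eq (s := s) hw' h)

variable [IsDomain B₂]

lemma adjoin_tensorProduct_coordinates_eq_top (h₁ : IsKummerCoordinates δ₁ ξ n f₁ x₁ y₁)
    (h₂ : IsKummerCoordinates δ₂ ξ n f₂ x₂ y₂) :
    IntermediateField.adjoin k {algebraMap (B₁ ⊗[k] B₂) F (x₁ ⊗ₜ 1),
      algebraMap (B₁ ⊗[k] B₂) F (y₁ ⊗ₜ 1), algebraMap (B₁ ⊗[k] B₂) F (1 ⊗ₜ x₂),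
      algebraMap (B₁ ⊗[k] B₂) F (1 ⊗ₜ y₂)} = ⊤ := by
  let ι : B₁ ⊗[k] B₂ →ₐ[k] F := IsScalarTower.toAlgHom k _ F
  have hι : Function.Injective ι := IsFractionRing.injective _ F
  let ι₁ : B₁ →ₐ[k] F := ι.comp Algebra.TensorProduct.includeLeft
  let ι₂ : B₂ →ₐ[k] F := ι.comp Algebra.TensorProduct.includeRight
  have hι₁ : Function.Injective ι₁ := hι.comp
    (Algebra.TensorProduct.includeLeft_injective (S := k) (algebraMap k B₂).injective)
  have hι₂ : Function.Injective ι₂ := hι.comp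
    (Algebra.TensorProduct.includeRight_injective (algebraMap k B₁).injective)
  change IntermediateField.adjoin k {ι₁ x₁, ι₁ y₁, ι₂ x₂, ι₂ y₂} = ⊤
  set E := IntermediateField.adjoin k {ι₁ x₁, ι₁ y₁, ι₂ x₂, ι₂ y₂}
  have hE : {ι₁ x₁, ι₁ y₁, ι₂ x₂, ι₂ y₂} ⊆ (E : Set F) := IntermediateField.subset_adjoin k _
  simp only [Set.insert_subset_iff, Set.singleton_subset_iff] at hE
  obtain ⟨hx₁, hy₁, hx₂, hy₂⟩ := hE
  have hmem (r : B₁ ⊗[k] B₂) : ι r ∈ E := by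
    induction r with
    | zero => simpa only [map_zero] using E.zero_mem
    | add r s hr hs => simpa only [map_add] using E.add_mem hr hs
    | tmul b₁ b₂ =>
      rw [← mul_one b₁, ← one_mul b₂, ← Algebra.TensorProduct.tmul_mul_tmul, map_mul]
      exact E.mul_mem (h₁.map_mem hι₁ hx₁ hy₁ b₁) (h₂.map_mem hι₂ hx₂ hy₂ b₂)
  refine eq_top_iff.2 fun z _ => ?_
  obtain ⟨r, s, -, rfl⟩ := IsFractionRing.div_surjective (A := B₁ ⊗[k] B₂) z
  exact E.div_mem (hmem r) (hmem s)

lemma exists_generators_fixedField [IsAlgClosed k] (h2 : (2 : k) ≠ 0) (hξ : IsPrimitiveRoot ξ 6)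
    (h₁ : IsKummerCoordinates δ₁ ξ 6 f₁ x₁ y₁) (hf₁ : f₁ ≠ 0)
    (h₂ : IsKummerCoordinates δ₂ ξ 6 (Polynomial.X * (Polynomial.X - 1)) x₂ y₂) {g : F →ₐ[k] F}
    (hg : ∀ r, g (algebraMap (B₁ ⊗[k] B₂) F r) =
      algebraMap (B₁ ⊗[k] B₂) F (Algebra.TensorProduct.map δ₁ δ₂ r)) :
    ∃ x u t : F, AlgebraicIndependent k ![x, u] ∧
      t ^ 2 = (u ^ 6 - Polynomial.aeval x f₁) / u ^ 6 ∧
      fixedField g = IntermediateField.adjoin k {x, u, t} := by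
  let ι : B₁ ⊗[k] B₂ →ₐ[k] F := IsScalarTower.toAlgHom k _ F
  have hι : Function.Injective ι := IsFractionRing.injective _ F
  let ι₁ : B₁ →ₐ[k] F := ι.comp Algebra.TensorProduct.includeLeft
  let ι₂ : B₂ →ₐ[k] F := ι.comp Algebra.TensorProduct.includeRight
  have hι₁ : Function.Injective ι₁ := hι.comp
    (Algebra.TensorProduct.includeLeft_injective (S := k) (algebraMap k B₂).injective)
  have hι₂ : Function.Injective ι₂ := hι.comp
    (Algebra.TensorProduct.includeRight_injective (algebraMap k B₁).injective)
  have hgι₁ (b : B₁) : g (ι₁ b) = ι₁ (δ₁ b) := (hg _).trans (congrArg ι (by simp))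
  have hgι₂ (b : B₂) : g (ι₂ b) = ι₂ (δ₂ b) := (hg _).trans (congrArg ι (by simp))
  have hgx₁ : g (ι₁ x₁) = ι₁ x₁ := by rw [hgι₁, h₁.map_fst]
  have hgy₁ : g (ι₁ y₁) = ξ • ι₁ y₁ := by rw [hgι₁, h₁.map_snd, map_smul]
  have hgx₂ : g (ι₂ x₂) = ι₂ x₂ := by rw [hgι₂, h₂.map_fst]
  have hgy₂ : g (ι₂ y₂) = ξ • ι₂ y₂ := by rw [hgι₂, h₂.map_snd, map_smul]
  have hy₁ : ι₁ y₁ ≠ 0 := (map_ne_zero_iff ι₁ hι₁).2 (h₁.snd_ne_zero (by norm_num) hf₁)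
  have hy₂ : ι₂ y₂ ≠ 0 := (map_ne_zero_iff ι₂ hι₂).2 (h₂.snd_ne_zero (by norm_num)
    (mul_ne_zero Polynomial.X_ne_zero (Polynomial.X_sub_C_ne_zero 1)))
  have hpow₂ : ι₂ y₂ ^ 6 = ι₂ x₂ * (ι₂ x₂ - 1) := by rw [← map_pow, h₂.pow_eq]; simp
  obtain ⟨c, hc0, hc⟩ := exists_ne_zero_pow_six_eq_neg_four h2
  have ht : ι₂ (2 * x₂ - 1) ^ 2 = ((c⁻¹ • (ι₁ y₁ / ι₂ y₂)) ^ 6 - ι₁ (Polynomial.aeval x₁ f₁)) /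
      (c⁻¹ • (ι₁ y₁ / ι₂ y₂)) ^ 6 := by
    rw [Algebra.smul_def, map_inv₀, ← h₁.pow_eq, map_pow ι₁, ← sq_two_mul_sub_one_eq
      ((map_ne_zero _).2 hc0) (by rw [← map_pow, hc, map_neg, map_ofNat]) hy₁ hy₂ hpow₂,
      map_sub, map_mul, map_ofNat, map_one]
  refine ⟨ι₁ x₁, c⁻¹ • (ι₁ y₁ / ι₂ y₂), ι₂ (2 * x₂ - 1),
    algebraicIndependent_of_sq_eq h₁.transcendental
      (transcendental_two_mul_sub_one h2 h₂.transcendental) ht, ?_, ?_⟩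
  · rw [ht, Polynomial.aeval_algHom_apply]
  · rw [fixedField_eq_adjoin hξ hgx₁ hgy₁ hgx₂ hgy₂ hy₂ ?_
      (adjoin_tensorProduct_coordinates_eq_top h₁ h₂), adjoin_kummer_generators_eq h2 hc0,
      map_sub, map_mul, map_ofNat, map_one]
    · rw [hpow₂]
      have := IntermediateField.mem_adjoin_simple_self k (ι₂ x₂)
      exact mul_mem this (sub_mem this (one_mem _))

end TensorProduct

end Invariants

/-! ### Irreducibility -/

section Irreducible

lemma irreducible_X_pow_sub_C_of_notMem_sq {R : Type*} [CommRing R] [IsDomain R]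
    [IsIntegrallyClosed R] (K : Type*) [Field K] [Algebra R K] [IsFractionRing R K] {P : Ideal R}
    [P.IsPrime] {p : R} (hp : p ∈ P) (hp2 : p ∉ P ^ 2) {n : ℕ} (hn : 0 < n) :
    Irreducible (Polynomial.X ^ n - Polynomial.C (algebraMap R K p)) := by
  have hmon : (Polynomial.X ^ n - Polynomial.C p).Monic := Polynomial.monic_X_pow_sub_C p hn.ne'
  have hdeg : (Polynomial.X ^ n - Polynomial.C p).natDegree = n := Polynomial.natDegree_X_pow_sub_C
  have heis : (Polynomial.X ^ n - Polynomial.C p).IsEisensteinAt P := by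
    refine hmon.isEisensteinAt_of_mem_of_notMem (Ideal.IsPrime.ne_top ‹_›) (fun {k} hk => ?_) ?_
    · rw [hdeg] at hk
      rw [Polynomial.coeff_sub, Polynomial.coeff_X_pow, if_neg hk.ne, zero_sub, Polynomial.coeff_C]
      split_ifs
      · exact P.neg_mem hp
      · simp
    · rw [Polynomial.coeff_sub, Polynomial.coeff_X_pow, if_neg hn.ne, zero_sub,
        Polynomial.coeff_C_zero]
      rwa [neg_mem_iff]
  have hirr := heis.irreducible ‹_› hmon.isPrimitive (by rwa [hdeg])
  rw [hmon.irreducible_iff_irreducible_map_fraction_map (K := K)] at hirr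
  simpa using hirr

variable {k : Type*} [Field k]

lemma notMem_ker_eval_sq {ι : Type*} {p : MvPolynomial ι k} {a : ι → k} {i : ι}
    (h : MvPolynomial.eval a (MvPolynomial.pderiv i p) ≠ 0) :
    p ∉ RingHom.ker (MvPolynomial.eval a) ^ 2 := by
  contrapose! h
  rw [pow_two] at h
  refine Submodule.mul_induction_on h (fun f hf g hg => ?_) (fun f g hf hg => ?_)
  · simp [Derivation.leibniz, RingHom.mem_ker.1 hf, RingHom.mem_ker.1 hg]
  · rw [map_add, map_add, hf, hg, add_zero]

lemma irreducible_X_pow_sub_C_of_eval_pderiv_ne_zero {ι : Type*} (K : Type*) [Field K]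
    [Algebra (MvPolynomial ι k) K] [IsFractionRing (MvPolynomial ι k) K] {p : MvPolynomial ι k}
    {a : ι → k} (h₀ : MvPolynomial.eval a p = 0) {i : ι}
    (h₁ : MvPolynomial.eval a (MvPolynomial.pderiv i p) ≠ 0) {n : ℕ} (hn : 0 < n) :
    Irreducible (Polynomial.X ^ n - Polynomial.C (algebraMap _ K p)) :=
  have : (RingHom.ker (MvPolynomial.eval a)).IsPrime := RingHom.ker_isPrime _
  irreducible_X_pow_sub_C_of_notMem_sq K h₀ (notMem_ker_eval_sq h₁) hn

lemma irreducible_X_pow_sub_C_mul_pow {K : Type*} [Field K] {p : ℕ} (hp : p.Prime) {h b : K}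
    (hirr : Irreducible (Polynomial.X ^ p - Polynomial.C (h * b ^ p))) :
    Irreducible (Polynomial.X ^ p - Polynomial.C h) := by
  rw [X_pow_sub_C_irreducible_iff_of_prime hp] at hirr ⊢
  exact fun c hc => hirr (c * b) (by rw [mul_pow, hc])

lemma eval_aeval_X {ι : Type*} (v : ι → k) (i : ι) (f : Polynomial k) :
    MvPolynomial.eval v (Polynomial.aeval (MvPolynomial.X i) f) = f.eval (v i) := by
  rw [Polynomial.aeval_def, Polynomial.hom_eval₂, MvPolynomial.eval_X, Polynomial.eval]
  congr 1
  ext c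
  simp

end Irreducible

section BinaryForm

/-- The polynomial `σ(1, T)` attached to a form `σ(X₀, X₁)`; its roots are the zeros of `σ` in the
chart `X₀ ≠ 0` of the projective line. -/
def dehomogenize {R : Type*} [CommSemiring R] (σ : MvPolynomial (Fin 2) R) : Polynomial R :=
  MvPolynomial.aeval ![1, Polynomial.X] σ

lemma aeval_dehomogenize {R A : Type*} [CommSemiring R] [CommSemiring A] [Algebra R A]
    (σ : MvPolynomial (Fin 2) R) (x : A) :
    Polynomial.aeval x (dehomogenize σ) = MvPolynomial.aeval ![1, x] σ := by
  rw [dehomogenize, ← AlgHom.comp_apply, MvPolynomial.comp_aeval]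
  congr 2
  funext i
  fin_cases i <;> simp

lemma dehomogenize_eq_sum {R : Type*} [CommSemiring R] (σ : MvPolynomial (Fin 2) R) :
    dehomogenize σ = ∑ d ∈ σ.support, Polynomial.C (σ.coeff d) * Polynomial.X ^ d 1 := by
  rw [dehomogenize, MvPolynomial.aeval_def, MvPolynomial.eval₂_eq']
  exact Finset.sum_congr rfl fun d _ => by simp

lemma isHomogeneous_fin_two_iff {R : Type*} [CommSemiring R] {σ : MvPolynomial (Fin 2) R} {n : ℕ} :
    σ.IsHomogeneous n ↔ ∀ d ∈ σ.support, d 0 + d 1 = n := by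
  refine forall_congr' fun d => ?_
  rw [MvPolynomial.mem_support_iff, Finsupp.weight_apply]
  simp [Finsupp.sum_fintype]

lemma natDegree_dehomogenize_le {R : Type*} [CommSemiring R] {σ : MvPolynomial (Fin 2) R} {n : ℕ}
    (hσ : σ.IsHomogeneous n) : (dehomogenize σ).natDegree ≤ n := by
  rw [dehomogenize_eq_sum]
  refine Polynomial.natDegree_sum_le_of_forall_le _ _ fun d hd =>
    (Polynomial.natDegree_C_mul_X_pow_le _ _).trans ?_
  have := isHomogeneous_fin_two_iff.1 hσ d hd
  omega

variable {k : Type*} [Field k] {σ : MvPolynomial (Fin 2) k} {n : ℕ}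

lemma eval_eq_mul_eval_dehomogenize (hσ : σ.IsHomogeneous n) {v : Fin 2 → k} (hv : v 0 ≠ 0) :
    MvPolynomial.eval v σ = v 0 ^ n * (dehomogenize σ).eval (v 1 / v 0) := by
  rw [dehomogenize_eq_sum, MvPolynomial.eval_eq', Polynomial.eval_finsetSum, Finset.mul_sum]
  refine Finset.sum_congr rfl fun d hd => ?_
  simp only [Fin.prod_univ_two, Polynomial.eval_mul, Polynomial.eval_C, Polynomial.eval_pow,
    Polynomial.eval_X, ← isHomogeneous_fin_two_iff.1 hσ d hd, pow_add, div_pow]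
  field_simp

lemma dehomogenize_ne_zero [Infinite k] (hσ : σ.IsHomogeneous n) (hσ0 : σ ≠ 0) :
    dehomogenize σ ≠ 0 := by
  intro h
  have hX : MvPolynomial.X 0 * σ = 0 := by
    refine MvPolynomial.funext fun v => ?_
    by_cases hv : v 0 = 0
    · simp [hv]
    · simp [eval_eq_mul_eval_dehomogenize hσ hv, h]
  exact hσ0 ((mul_eq_zero.1 hX).resolve_left (MvPolynomial.X_ne_zero 0))

lemma eq_of_rep_mul_rep_eq {p q : Projectivization k (Fin 2 → k)}
    (h : p.rep 0 * q.rep 1 = q.rep 0 * p.rep 1) : p = q := by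
  by_contra hpq
  have hind : LinearIndependent k (Matrix.of ![p.rep, q.rep]).row := by
    have hrow : (Matrix.of ![p.rep, q.rep]).row = Projectivization.rep ∘ ![p, q] := by
      funext i
      fin_cases i <;> rfl
    rw [hrow, ← Projectivization.independent_iff, Projectivization.independent_pair_iff_ne]
    exact hpq
  have hdet := (Matrix.isUnit_iff_isUnit_det _).1 (Matrix.linearIndependent_rows_iff_isUnit.1 hind)
  refine hdet.ne_zero ?_
  simp [Matrix.det_fin_two, h, mul_comm (p.rep 1)]

lemma card_le_card_filter_rep_ne_zero {ι : Type*} [Fintype ι]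
    (q : ι ↪ Projectivization k (Fin 2 → k)) [DecidablePred fun i => (q i).rep 0 ≠ 0] :
    Fintype.card ι ≤ (Finset.univ.filter fun i => (q i).rep 0 ≠ 0).card + 1 := by
  classical
  have hinf : (Finset.univ.filter fun i => ¬ (q i).rep 0 ≠ 0).card ≤ 1 := by
    refine Finset.card_le_one.2 fun i hi j hj => q.injective (eq_of_rep_mul_rep_eq ?_)
    simp only [ne_eq, not_not, Finset.mem_filter, Finset.mem_univ, true_and] at hi hj
    rw [hi, hj, zero_mul, zero_mul]
  have := Finset.card_filter_add_card_filter_not (s := Finset.univ) fun i => (q i).rep 0 ≠ 0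
  rw [Finset.card_univ] at this
  omega

lemma card_le_card_roots_dehomogenize [DecidableEq k] (hσ : σ.IsHomogeneous n)
    (hf : dehomogenize σ ≠ 0) {ι : Type*} [Fintype ι] (q : ι ↪ Projectivization k (Fin 2 → k))
    (hq : ∀ i, MvPolynomial.eval (q i).rep σ = 0) :
    Fintype.card ι ≤ (dehomogenize σ).roots.toFinset.card + 1 := by
  classical
  refine (card_le_card_filter_rep_ne_zero q).trans (Nat.add_le_add_right ?_ 1)
  refine Finset.card_le_card_of_injOn (fun i => (q i).rep 1 / (q i).rep 0) (fun i hi => ?_) ?_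
  · have hi : (q i).rep 0 ≠ 0 := (Finset.mem_filter.1 hi).2
    have heval := hq i
    rw [eval_eq_mul_eval_dehomogenize hσ hi] at heval
    simpa [hf] using (mul_eq_zero.1 heval).resolve_left (pow_ne_zero _ hi)
  · intro i hi j hj hij
    have hi : (q i).rep 0 ≠ 0 := (Finset.mem_filter.1 hi).2
    have hj : (q j).rep 0 ≠ 0 := (Finset.mem_filter.1 hj).2
    refine q.injective (eq_of_rep_mul_rep_eq ?_)
    linear_combination -(div_eq_div_iff hi hj).1 hij

lemma exists_simple_root_of_natDegree_lt [DecidableEq k] {f : Polynomial k} (hf : f ≠ 0)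
    (h : f.natDegree < 2 * f.roots.toFinset.card) :
    ∃ a, f.eval a = 0 ∧ f.derivative.eval a ≠ 0 := by
  by_contra! hmul
  have hcount (b : k) (hb : b ∈ f.roots.toFinset) : 2 ≤ f.roots.count b := by
    have hroot : f.eval b = 0 := (Polynomial.mem_roots'.1 (Multiset.mem_toFinset.1 hb)).2
    rw [Polynomial.count_roots]
    exact (Polynomial.one_lt_rootMultiplicity_iff_isRoot hf).2 ⟨hroot, hmul b hroot⟩
  refine h.not_ge ?_
  calc 2 * f.roots.toFinset.card = ∑ b ∈ f.roots.toFinset, 2 := by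
        rw [Finset.sum_const, smul_eq_mul, mul_comm]
    _ ≤ ∑ b ∈ f.roots.toFinset, f.roots.count b := Finset.sum_le_sum hcount
    _ = f.roots.card := Multiset.toFinset_sum_count_eq _
    _ ≤ f.natDegree := f.card_roots'

lemma exists_simple_root [Infinite k] (hσ : σ.IsHomogeneous n) (hσ0 : σ ≠ 0) {ι : Type*}
    [Fintype ι] (hn : n + 2 < 2 * Fintype.card ι) (q : ι ↪ Projectivization k (Fin 2 → k))
    (hq : ∀ i, MvPolynomial.eval (q i).rep σ = 0) :
    ∃ a, (dehomogenize σ).eval a = 0 ∧ (dehomogenize σ).derivative.eval a ≠ 0 := by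
  classical
  have hf := dehomogenize_ne_zero hσ hσ0
  refine exists_simple_root_of_natDegree_lt hf ?_
  have := natDegree_dehomogenize_le hσ
  have := card_le_card_roots_dehomogenize hσ hf q hq
  omega

end BinaryForm

section FunctionFields

lemma aeval_var {m : ℕ} (f : Polynomial ℂ) (i : Fin m) : Polynomial.aeval (var i : RatField m) f =
    algebraMap (MvPolynomial (Fin m) ℂ) _ (Polynomial.aeval (MvPolynomial.X i) f) := by
  rw [var, Polynomial.aeval_algebraMap_apply]

lemma irreducible_X_pow_sub_C_aeval_var {m : ℕ} {f : Polynomial ℂ} {a : ℂ} (h₀ : f.eval a = 0)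
    (h₁ : f.derivative.eval a ≠ 0) {n : ℕ} (hn : 0 < n) (i : Fin m) :
    Irreducible (Polynomial.X ^ n - Polynomial.C (Polynomial.aeval (var i : RatField m) f)) := by
  rw [aeval_var]
  refine irreducible_X_pow_sub_C_of_eval_pderiv_ne_zero (RatField m) (a := fun _ => a) (i := i)
    ?_ ?_ hn
  · rw [eval_aeval_X, h₀]
  · simpa [Derivation.map_aeval, eval_aeval_X] using h₁

lemma irreducible_X_pow_sub_C_var_pow_sub_aeval {f : Polynomial ℂ} (hf : f ≠ 0) {m n : ℕ}
    (hm : 0 < m) (hn : 0 < n) : Irreducible (Polynomial.X ^ n -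
      Polynomial.C (var 1 ^ m - Polynomial.aeval (var 0) f : RatField 2)) := by
  obtain ⟨a, ha⟩ : ∃ a, f.eval a ≠ 0 := by
    contrapose! hf
    exact Polynomial.funext fun a => by rw [hf, Polynomial.eval_zero]
  obtain ⟨b, hb⟩ := IsAlgClosed.exists_pow_nat_eq (f.eval a) hm
  have hb0 : b ≠ 0 := by
    rintro rfl
    exact ha (by rw [← hb, zero_pow hm.ne'])
  have hirr := irreducible_X_pow_sub_C_of_eval_pderiv_ne_zero (RatField 2)
    (p := MvPolynomial.X 1 ^ m - Polynomial.aeval (MvPolynomial.X (0 : Fin 2)) f)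
    (a := ![a, b]) (i := 1) (by simp [eval_aeval_X, hb])
    (by simp [Derivation.map_aeval, Derivation.leibniz_pow, hb0, hm.ne']) hn
  rwa [map_sub, map_pow, ← aeval_var] at hirr

lemma irreducible_X_pow_sub_C_mul_sub_one {n : ℕ} (hn : 0 < n) :
    Irreducible (Polynomial.X ^ n - Polynomial.C (pVar * (pVar - 1))) := by
  have := irreducible_X_pow_sub_C_aeval_var (f := Polynomial.X * (Polynomial.X - 1)) (a := 0)
    (by simp) (by simp) hn (0 : Fin 1)
  simpa [pVar] using this

lemma aeval_dehomogenize_eq_formValue {K : Type} [Field K] [Algebra ℂ K]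
    (σ : MvPolynomial (Fin 2) ℂ) (x : K) :
    Polynomial.aeval x (dehomogenize σ) = formValue σ x :=
  aeval_dehomogenize σ x

lemma map_formValue {K F : Type} [Field K] [Algebra ℂ K] [Field F] [Algebra ℂ F] (φ : K →ₐ[ℂ] F)
    (σ : MvPolynomial (Fin 2) ℂ) (x : K) : φ (formValue σ x) = formValue σ (φ x) := by
  rw [← aeval_dehomogenize_eq_formValue, ← aeval_dehomogenize_eq_formValue,
    Polynomial.aeval_algHom_apply]

lemma muField_sectionRatio (σ : MvPolynomial (Fin 2) ℂ) :
    muField (sectionRatio σ) = (uVar ^ 6 - formValue σ xVar) / uVar ^ 6 := by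
  rw [sectionRatio, map_div₀, map_sub, map_formValue, muField_xVar, muField_uVar]

lemma muField_sectionRatio_mul (σ : MvPolynomial (Fin 2) ℂ) :
    muField (sectionRatio σ) * (uVar ^ 3) ^ 2 = var 1 ^ 6 - formValue σ (var 0) := by
  have hu : uVar ≠ 0 := var_ne_zero 1
  rw [muField_sectionRatio, ← pow_mul, div_mul_cancel₀ _ (pow_ne_zero 6 hu)]
  rfl

lemma irreducible_doublePlane {σ : MvPolynomial (Fin 2) ℂ} (hσ : dehomogenize σ ≠ 0) :
    Irreducible (Polynomial.X ^ 2 -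
      Polynomial.C (var 1 ^ 6 - formValue σ (var 0) : RatField 2)) := by
  rw [← aeval_dehomogenize_eq_formValue]
  exact irreducible_X_pow_sub_C_var_pow_sub_aeval hσ (by norm_num) two_pos

lemma irreducible_surfaceY {σ : MvPolynomial (Fin 2) ℂ} (hσ : dehomogenize σ ≠ 0) :
    Irreducible (Polynomial.X ^ 2 - Polynomial.C (muField (sectionRatio σ))) := by
  refine irreducible_X_pow_sub_C_mul_pow Nat.prime_two (b := uVar ^ 3) ?_
  rw [muField_sectionRatio_mul]
  exact irreducible_doublePlane hσ

lemma dehomogenize_ne_zero_of_irreducible {σ : MvPolynomial (Fin 2) ℂ} {n : ℕ} (hn : 2 ≤ n)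
    (h : Irreducible (Polynomial.X ^ n - Polynomial.C (formValue σ pVar))) :
    dehomogenize σ ≠ 0 := by
  intro h0
  rw [← aeval_dehomogenize_eq_formValue, h0, map_zero, map_zero, sub_zero] at h
  exact not_irreducible_pow (by omega) h

end FunctionFields

/-! ### Function fields -/

section RatField

variable {m : ℕ} {F : Type} [Field F] [Algebra ℂ F]

lemma exists_algHom_ratField {x : Fin m → F} (hx : AlgebraicIndependent ℂ x) :
    ∃ φ : RatField m →ₐ[ℂ] F, φ ∘ var = x :=
  ⟨(IntermediateField.val _).comp hx.aevalEquivField.toAlgHom,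
    funext fun i => (hx.aevalEquivField_algebraMap_apply_coe _).trans (MvPolynomial.aeval_X x i)⟩

lemma fieldRange_ratField (φ : RatField m →ₐ[ℂ] F) :
    φ.fieldRange = IntermediateField.adjoin ℂ (Set.range (φ ∘ var)) := by
  have hφ : φ.comp (IsScalarTower.toAlgHom ℂ (MvPolynomial (Fin m) ℂ) _) =
      MvPolynomial.aeval (φ ∘ var) :=
    MvPolynomial.algHom_ext fun i => (MvPolynomial.aeval_X (φ ∘ var) i).symm
  exact IsFractionRing.algHom_fieldRange_eq_of_comp_eq_of_range_eq
    (congrArg AlgHom.toRingHom hφ) (Algebra.adjoin_range_eq_range_aeval ℂ _).symm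

lemma transcendental_var (i : Fin m) : Transcendental ℂ (var i : RatField m) :=
  (transcendental_algebraMap_iff (IsFractionRing.injective _ _)).2
    (MvPolynomial.transcendental_X ℂ i)

end RatField

section KummerField

lemma root_pow {K : Type} [Field K] (n : ℕ) (h : K) :
    AdjoinRoot.root (Polynomial.X ^ n - Polynomial.C h) ^ n = algebraMap K (KummerField n h) h := by
  have hroot := AdjoinRoot.eval₂_root (Polynomial.X ^ n - Polynomial.C h)
  rwa [Polynomial.eval₂_sub, Polynomial.eval₂_pow, Polynomial.eval₂_X, Polynomial.eval₂_C,
    sub_eq_zero] at hroot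

lemma exists_algHom_kummerField {k K A : Type} [Field k] [Field K] [Algebra k K] [CommRing A]
    [Algebra k A] {n : ℕ} {h : K} (φ₀ : K →ₐ[k] A) {t : A} (ht : t ^ n = φ₀ h) :
    ∃ φ : KummerField n h →ₐ[k] A,
      φ.comp (IsScalarTower.toAlgHom k K _) = φ₀ ∧ φ (AdjoinRoot.root _) = t :=
  have hroot : (Polynomial.X ^ n - Polynomial.C h).eval₂ φ₀ t = 0 := by simp [ht]
  ⟨AdjoinRoot.liftAlgHom _ φ₀ t hroot,
    AlgHom.ext fun a => AdjoinRoot.liftAlgHom_of _ φ₀ t hroot a, AdjoinRoot.liftAlgHom_root ..⟩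

lemma exists_algEquiv_kummerField_mul_pow {K : Type} [Field K] (n : ℕ) (h : K) {b : K}
    (hb : b ≠ 0) : Nonempty (KummerField n h ≃ₐ[K] KummerField n (h * b ^ n)) := by
  obtain ⟨φ, -, hφ⟩ := exists_algHom_kummerField (n := n) (h := h)
    (t := b⁻¹ • AdjoinRoot.root (Polynomial.X ^ n - Polynomial.C (h * b ^ n)))
    (Algebra.ofId K (KummerField n (h * b ^ n))) (by
      rw [smul_pow, root_pow, Algebra.ofId_apply, Algebra.smul_def, ← map_mul, mul_left_comm,
        ← mul_pow, inv_mul_cancel₀ hb, one_pow, mul_one])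
  obtain ⟨ψ, -, hψ⟩ := exists_algHom_kummerField (n := n) (h := h * b ^ n)
    (t := b • AdjoinRoot.root (Polynomial.X ^ n - Polynomial.C h))
    (Algebra.ofId K (KummerField n h)) (by
      rw [smul_pow, root_pow, Algebra.ofId_apply, Algebra.smul_def, ← map_mul, mul_comm])
  refine ⟨AlgEquiv.ofAlgHom φ ψ (AdjoinRoot.algHom_ext ?_) (AdjoinRoot.algHom_ext ?_)⟩
  · rw [AlgHom.comp_apply, hψ, map_smul, hφ, smul_inv_smul₀ hb, AlgHom.id_apply]
  · rw [AlgHom.comp_apply, hφ, map_smul, hψ, inv_smul_smul₀ hb, AlgHom.id_apply]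

variable {k K F : Type} [Field k] [Field K] [Algebra k K] [Field F] [Algebra k F] {n : ℕ} {h : K}

lemma fieldRange_kummerField [Fact (Irreducible (Polynomial.X ^ n - Polynomial.C h))]
    (φ : KummerField n h →ₐ[k] F) {S : Set F}
    (hS : (φ.comp (IsScalarTower.toAlgHom k K _)).fieldRange = IntermediateField.adjoin k S) :
    φ.fieldRange = IntermediateField.adjoin k (insert (φ (AdjoinRoot.root _)) S) := by
  have hbase (a : K) : φ (algebraMap K _ a) ∈ IntermediateField.adjoin k S :=
    hS ▸ ⟨a, rfl⟩
  refine le_antisymm ?_ (IntermediateField.adjoin_le_iff.2 (Set.insert_subset ⟨_, rfl⟩ ?_))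
  · rintro _ ⟨z, rfl⟩
    have hle := IntermediateField.adjoin.mono k S _ (Set.subset_insert (φ (AdjoinRoot.root _)) S)
    obtain ⟨p, rfl⟩ := AdjoinRoot.mk_surjective z
    induction p using Polynomial.induction_on' with
    | add p q hp hq => simpa only [map_add] using add_mem hp hq
    | monomial i a =>
      rw [← Polynomial.C_mul_X_pow_eq_monomial]
      simp only [map_mul, map_pow, AdjoinRoot.mk_C, AdjoinRoot.mk_X]
      exact mul_mem (hle (hbase a))
        (pow_mem (IntermediateField.subset_adjoin k _ (Set.mem_insert _ S)) i)
  · intro s hs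
    obtain ⟨a, rfl⟩ : s ∈ (φ.comp (IsScalarTower.toAlgHom k K _)).fieldRange :=
      hS ▸ IntermediateField.subset_adjoin k S hs
    exact ⟨_, rfl⟩

lemma exists_algHom_surfaceY (σ : MvPolynomial (Fin 2) ℂ)
    [Fact (Irreducible (Polynomial.X ^ 2 - Polynomial.C (muField (sectionRatio σ))))]
    {F : Type} [Field F] [Algebra ℂ F] {x u t : F} (hxu : AlgebraicIndependent ℂ ![x, u])
    (ht : t ^ 2 = (u ^ 6 - formValue σ x) / u ^ 6) :
    ∃ φ : KummerField 2 (muField (sectionRatio σ)) →ₐ[ℂ] F,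
      φ.fieldRange = IntermediateField.adjoin ℂ {x, u, t} := by
  obtain ⟨φ₀, hφ₀⟩ := exists_algHom_ratField hxu
  have hx : φ₀ xVar = x := congrFun hφ₀ 0
  have hu : φ₀ uVar = u := congrFun hφ₀ 1
  obtain ⟨φ, rfl, rfl⟩ := exists_algHom_kummerField (h := muField (sectionRatio σ)) φ₀ <| show _ by
    rw [ht, muField_sectionRatio, map_div₀, map_sub, map_pow, map_formValue, hx, hu]
  refine ⟨φ, ?_⟩
  rw [fieldRange_kummerField φ (fieldRange_ratField _), hφ₀]
  congr 1
  ext z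
  simp [or_comm, or_assoc, eq_comm]

lemma exists_algEquiv_doublePlane (σ : MvPolynomial (Fin 2) ℂ) :
    Nonempty (KummerField 2 (muField (sectionRatio σ)) ≃ₐ[ℂ]
      KummerField 2 (var 1 ^ 6 - formValue σ (var 0) : RatField 2)) := by
  have hu : uVar ^ 3 ≠ 0 := pow_ne_zero 3 (var_ne_zero 1)
  obtain ⟨e⟩ := exists_algEquiv_kummerField_mul_pow 2 (muField (sectionRatio σ)) hu
  rw [muField_sectionRatio_mul] at e
  exact ⟨e.restrictScalars ℂ⟩

end KummerField

section Deck

variable {n : ℕ}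

lemma deckField_root {K : Type} [Field K] (h ξ : K) (hξ : ξ ^ n = 1) :
    deckField h ξ hξ (AdjoinRoot.root _) =
      ξ • AdjoinRoot.root (Polynomial.X ^ n - Polynomial.C h) := by
  rw [deckField, AdjoinRoot.liftAlgHom_root, Algebra.smul_def]

lemma deckField_pow {K : Type} [Field K] (h ξ : K) (hξ : ξ ^ n = 1) :
    deckField h ξ hξ ^ n = 1 := by
  have hpow (i : ℕ) : (deckField h ξ hξ ^ i) (AdjoinRoot.root _) =
      ξ ^ i • AdjoinRoot.root (Polynomial.X ^ n - Polynomial.C h) := by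
    induction i with
    | zero => simp
    | succ i ih =>
      rw [pow_succ, AlgHom.mul_apply, deckField_root, map_smul, ih, smul_smul, pow_succ']
  refine AdjoinRoot.algHom_ext ?_
  rw [hpow, hξ, one_smul, AlgHom.one_apply]

variable (h : RatField 1) {ξ : ℂ} (hξ : ξ ^ n = 1)

lemma curveDeck_root : curveDeck h ξ hξ (AdjoinRoot.root _) =
    ξ • AdjoinRoot.root (Polynomial.X ^ n - Polynomial.C h) :=
  (deckField_root h _ (by rw [← map_pow, hξ, map_one])).trans (algebraMap_smul ..)

lemma curveRingDeck_pow : curveRingDeck h ξ hξ ^ n = 1 := by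
  have hsemi : Function.Semiconj ((↑) : curveRing n h → KummerField n h)
      (curveRingDeck h ξ hξ) (deckField h (algebraMap ℂ _ ξ) (by rw [← map_pow, hξ, map_one])) :=
    fun _ => rfl
  refine AlgHom.ext fun b => Subtype.ext ?_
  rw [AlgHom.coe_pow, (hsemi.iterate_right n).eq, ← AlgHom.coe_pow, deckField_pow]
  rfl

lemma isOfFinOrder_curveRingDeck (hn : 0 < n) : IsOfFinOrder (curveRingDeck h ξ hξ) :=
  isOfFinOrder_iff_pow_eq_one.2 ⟨n, hn, curveRingDeck_pow h hξ⟩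

end Deck

section Curve

lemma exists_mul_mem_adjoin {k L : Type*} [Field k] [Field L] [Algebra k L] {B : Subalgebra k L}
    {S : Set B} (hS : IntermediateField.adjoin k (B.val '' S) = ⊤) (b : B) :
    ∃ d ∈ Algebra.adjoin k S, d ≠ 0 ∧ d * b ∈ Algebra.adjoin k S := by
  have hb : (b : L) ∈ IntermediateField.adjoin k (B.val '' S) := hS ▸ IntermediateField.mem_top
  obtain ⟨r, hr, s, hs, hrs⟩ := (IntermediateField.mem_adjoin_iff_div ..).1 hb
  rw [← AlgHom.map_adjoin] at hr hs
  obtain ⟨r, hr, rfl⟩ := hr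
  obtain ⟨s, hs, rfl⟩ := hs
  by_cases hs0 : s = 0
  · have hb0 : b = 0 := Subtype.ext (by simpa [hs0] using hrs)
    exact ⟨1, one_mem _, one_ne_zero, by rw [hb0, mul_zero]; exact zero_mem _⟩
  · have hsL : (s : L) ≠ 0 := fun h => hs0 (Subtype.ext h)
    have hsb : s * b = r := Subtype.ext (by
      rw [MulMemClass.coe_mul, hrs]
      exact mul_div_cancel₀ _ hsL)
    exact ⟨s, hs, hs0, hsb ▸ hr⟩

variable {n : ℕ} {h : RatField 1} [Fact (Irreducible (Polynomial.X ^ n - Polynomial.C h))]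

lemma finiteType_curveRing (hn : 0 < n) : Algebra.FiniteType ℂ (curveRing n h) := by
  have := finiteDimensional_kummerField h hn
  exact (Subalgebra.fg_iff_finiteType _).1 (fg_intClosure (RatField 1))

lemma adjoin_curveCoordinates_eq_top : IntermediateField.adjoin ℂ
    {algebraMap _ _ pVar, AdjoinRoot.root (Polynomial.X ^ n - Polynomial.C h)} = ⊤ := by
  have htop : (AlgHom.id ℂ (KummerField n h)).fieldRange = ⊤ :=
    AlgHom.fieldRange_eq_top.2 Function.surjective_id
  rw [← htop, fieldRange_kummerField _ (fieldRange_ratField _), Set.pair_comm]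
  congr 2
  rw [Set.range_unique]
  rfl

lemma algebraMap_pVar_mem_curveRing : algebraMap _ (KummerField n h) pVar ∈ curveRing n h := by
  have hp : pVar ∈ (projAtlas 1).ring {default} := by
    rw [projAtlas_ring_default]
    exact ⟨_, rfl⟩
  exact isIntegral_algebraMap (R := (projAtlas 1).ring {default}) (x := ⟨pVar, hp⟩)

lemma exists_curve_coordinates {f : Polynomial ℂ} (hf : h = Polynomial.aeval pVar f) (hn : 0 < n)
    {ξ : ℂ} (hξ : ξ ^ n = 1) :
    ∃ x y, IsKummerCoordinates (curveRingDeck h ξ hξ) ξ n f x y := by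
  let x : curveRing n h := ⟨algebraMap _ _ pVar, algebraMap_pVar_mem_curveRing⟩
  have hx : Transcendental ℂ (algebraMap _ (KummerField n h) pVar) :=
    (transcendental_algebraMap_iff (FaithfulSMul.algebraMap_injective _ _)).2 (transcendental_var 0)
  have hroot : AdjoinRoot.root (Polynomial.X ^ n - Polynomial.C h) ^ n =
      ((Polynomial.aeval x f : curveRing n h) : KummerField n h) := by
    refine (root_pow n h).trans ((congrArg (algebraMap _ _) hf).trans ?_)
    rw [← Polynomial.aeval_algebraMap_apply]
    exact Polynomial.aeval_algHom_apply (curveRing n h).val x f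
  have hmem : AdjoinRoot.root (Polynomial.X ^ n - Polynomial.C h) ∈ curveRing n h :=
    IsIntegral.of_pow hn (hroot ▸ (Polynomial.aeval x f).2)
  refine ⟨x, ⟨_, hmem⟩, ?_, Subtype.ext hroot, Subtype.ext (curveDeck_algebraMap h ξ hξ pVar),
    Subtype.ext (curveDeck_root h hξ), exists_mul_mem_adjoin ?_⟩
  · exact (transcendental_algebraMap_iff (A := KummerField n h) Subtype.val_injective).1 hx
  · rw [Set.image_pair]
    exact adjoin_curveCoordinates_eq_top

end Curve

section Models

lemma HasModel.of_algEquiv {X : LocallyRingedSpace.{0}}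
    {s : X ⟶ (Spec (.of ℂ)).toLocallyRingedSpace} {L L' : Type} [Field L] [Field L'] [Algebra ℂ L]
    [Algebra ℂ L'] (H : HasModel s L) (e : L ≃ₐ[ℂ] L') : HasModel s L' := by
  obtain ⟨B, κ, hB, hfr, hκ, hd, hs⟩ := H
  have := B.fg_iff_finiteType.1 hB
  refine hasModel_of_algHom ((e : L →ₐ[ℂ] L').comp B.val) (e.injective.comp Subtype.val_injective)
    (fun z => ?_) κ hd hs
  obtain ⟨b, hb, hb0, hbz⟩ := hfr (e.symm z)
  refine ⟨⟨_, hbz⟩, ⟨b, hb⟩, (map_ne_zero e).2 hb0, ?_⟩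
  change e b * z = e (b * e.symm z)
  rw [map_mul, e.apply_symm_apply]

lemma irreducible_X_pow_sub_C_formValue {σ : MvPolynomial (Fin 2) ℂ} {a : ℂ}
    (h₀ : (dehomogenize σ).eval a = 0) (h₁ : (dehomogenize σ).derivative.eval a ≠ 0) {n : ℕ}
    (hn : 0 < n) : Irreducible (Polynomial.X ^ n - Polynomial.C (formValue σ pVar)) := by
  rw [← aeval_dehomogenize_eq_formValue]
  exact irreducible_X_pow_sub_C_aeval_var h₀ h₁ hn 0

variable {σ : MvPolynomial (Fin 2) ℂ}

lemma hasModel_doublePlane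
    [Fact (Irreducible (Polynomial.X ^ 2 -
      Polynomial.C (var 1 ^ 6 - formValue σ (var 0) : RatField 2)))] :
    HasModel (doublePlaneToSpec σ).toLRSHom
      (KummerField 2 (var 1 ^ 6 - formValue σ (var 0) : RatField 2)) :=
  hasModel_kummerCover (projAtlas 2) two_pos

variable [Fact (Irreducible (Polynomial.X ^ 2 - Polynomial.C (muField (sectionRatio σ))))]

lemma hasModel_surfaceY :
    HasModel (surfaceYToSpec σ).toLRSHom (KummerField 2 (muField (sectionRatio σ))) :=
  hasModel_kummerCover (hirzebruch 1) two_pos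

lemma exists_algHom_fixedSubalgebra_surfaceY (hσ : dehomogenize σ ≠ 0) {B₁ B₂ : Type}
    [CommRing B₁] [IsDomain B₁] [Algebra ℂ B₁] [Algebra.FiniteType ℂ B₁] [CommRing B₂]
    [IsDomain B₂] [Algebra ℂ B₂] {ξ : ℂ} (hξ : IsPrimitiveRoot ξ 6) {δ₁ : B₁ →ₐ[ℂ] B₁} {x₁ y₁ : B₁}
    (h₁ : IsKummerCoordinates δ₁ ξ 6 (dehomogenize σ) x₁ y₁) {δ₂ : B₂ →ₐ[ℂ] B₂} {x₂ y₂ : B₂}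
    (h₂ : IsKummerCoordinates δ₂ ξ 6 (Polynomial.X * (Polynomial.X - 1)) x₂ y₂)
    (hγ : IsOfFinOrder (Algebra.TensorProduct.map δ₁ δ₂)) :
    ∃ ψ : fixedSubalgebra (Algebra.TensorProduct.map δ₁ δ₂) →ₐ[ℂ]
      KummerField 2 (muField (sectionRatio σ)), Function.Injective ψ ∧
      ∀ z, ∃ a b, ψ b ≠ 0 ∧ ψ b * z = ψ a := by
  have : IsDomain (B₁ ⊗[ℂ] B₂) := isDomain_tensorProduct
  obtain ⟨g, hg⟩ := exists_algHom_fractionField (F := FractionRing (B₁ ⊗[ℂ] B₂)) hγ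
  obtain ⟨x, u, t, hxu, ht, hfixed⟩ := exists_generators_fixedField two_ne_zero hξ h₁ hσ h₂ hg
  rw [aeval_dehomogenize_eq_formValue] at ht
  obtain ⟨φ, hφ⟩ := exists_algHom_surfaceY σ hxu ht
  exact exists_algHom_fixedSubalgebra hγ hg (hφ.trans hfixed.symm)

lemma hasModel_quotProd (hσ : dehomogenize σ ≠ 0)
    [Fact (Irreducible (Polynomial.X ^ 6 - Polynomial.C (formValue σ pVar)))]
    [Fact (Irreducible (Polynomial.X ^ 6 - Polynomial.C (pVar * (pVar - 1))))]
    {ξ : ℂ} (hξ : IsPrimitiveRoot ξ 6) :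
    HasModel (quotProdToSpec (formValue σ pVar) (pVar * (pVar - 1)) ξ hξ.pow_eq_one)
      (KummerField 2 (muField (sectionRatio σ))) := by
  have := finiteType_curveRing (h := formValue σ pVar) (n := 6) (by norm_num)
  have := finiteType_curveRing (h := pVar * (pVar - 1)) (n := 6) (by norm_num)
  have hγ := isOfFinOrder_tensorProductMap
    (isOfFinOrder_curveRingDeck (formValue σ pVar) hξ.pow_eq_one (by norm_num))
    (isOfFinOrder_curveRingDeck (pVar * (pVar - 1)) hξ.pow_eq_one (by norm_num))
  obtain ⟨x₁, y₁, hC⟩ := exists_curve_coordinates (h := formValue σ pVar)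
    (aeval_dehomogenize_eq_formValue σ pVar).symm (by norm_num) hξ.pow_eq_one
  obtain ⟨x₂, y₂, hC'⟩ := exists_curve_coordinates (h := pVar * (pVar - 1))
    (f := Polynomial.X * (Polynomial.X - 1)) (by simp) (by norm_num) hξ.pow_eq_one
  obtain ⟨ψ, hψ, hfr⟩ := exists_algHom_fixedSubalgebra_surfaceY hσ hξ hC hC' hγ
  obtain ⟨j, hj, hd, hs⟩ := exists_quotProd_chart ξ hξ.pow_eq_one hγ
  have := finiteType_tensorProduct ℂ (curveRing 6 (formValue σ pVar))
    (curveRing 6 (pVar * (pVar - 1)))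
  have := finiteType_fixedSubalgebra hγ
  exact hasModel_of_algHom ψ hψ hfr j hd hs

end Models

end KummerSurface

end

open KummerSurface in
theorem mainTheorem5_general (σ : MvPolynomial (Fin 2) ℂ)
    (hC : Irreducible (Polynomial.X ^ 6 - Polynomial.C (formValue σ pVar)))
    (ξ : ℂ) (hξ : IsPrimitiveRoot ξ 6) :
    LRSBirationalOver (surfaceYToSpec σ).toLRSHom
      (quotProdToSpec (formValue σ pVar) (pVar * (pVar - 1)) ξ hξ.pow_eq_one) ∧
    Scheme.BirationalOver (surfaceYToSpec σ) (doublePlaneToSpec σ) := by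
  have hσ := dehomogenize_ne_zero_of_irreducible (by norm_num) hC
  have := Fact.mk hC
  have := Fact.mk (irreducible_X_pow_sub_C_mul_sub_one (n := 6) (by norm_num))
  have := Fact.mk (irreducible_surfaceY hσ)
  have := Fact.mk (irreducible_doublePlane hσ)
  have hY := hasModel_surfaceY (σ := σ)
  obtain ⟨e⟩ := exists_algEquiv_doublePlane σ
  exact ⟨hY.lrsBirationalOver (hasModel_quotProd hσ hξ),
    hY.birationalOver (hasModel_doublePlane.of_algEquiv e.symm)⟩

theorem mainTheorem5 (σ : MvPolynomial (Fin 2) ℂ) (hσ : σ.IsHomogeneous 6) (hσ0 : σ ≠ 0)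
    (q : Fin 6 ↪ Projectivization ℂ (Fin 2 → ℂ))
    (hq : ∀ i, MvPolynomial.eval (q i).rep σ = 0)
    (ξ : ℂ) (hξ : IsPrimitiveRoot ξ 6) :
    KummerSurface.LRSBirationalOver
      (KummerSurface.surfaceYToSpec σ).toLRSHom
      (KummerSurface.quotProdToSpec
        (KummerSurface.formValue σ KummerSurface.pVar)
        (KummerSurface.pVar * (KummerSurface.pVar - 1)) ξ hξ.pow_eq_one) ∧
    Scheme.BirationalOver
      (KummerSurface.surfaceYToSpec σ) (KummerSurface.doublePlaneToSpec σ) := by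
  obtain ⟨a, h₀, h₁⟩ := KummerSurface.exists_simple_root hσ hσ0 (by simp) q hq
  exact mainTheorem5_general σ
    (KummerSurface.irreducible_X_pow_sub_C_formValue h₀ h₁ (by norm_num)) ξ hξ
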